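/- **Setting.** Let $q\in\mathbb C^*$ with $|q|<1$. Fix a logarithm $\log q$ and put $q^s:=e^{s\log q}$ for $s\in\mathbb C$. Let $n\ge 0$ be an integer, $\alpha,\tau\in\mathbb C$, $t:=q^\tau$ and $a_1,a_2,b_1,b_2\in\mathbb C^*$. Write $(x;c)_k:=\prod_{i=0}^{k-1}(1-c^ix)$ for integers $k\ge 0$, $(x;c)_\infty:=\prod_{i\ge0}(1-c^ix)$ for $|c|<1$, and $\left[{i\atop j}\right]_c:=\frac{(c;c)_i}{(c;c)_{i-j}(c;c)_j}$ for $0\le j\le i$. Let $$\Phi(z):=\prod_{i=1}^n\Big\{z_i^\alpha\prod_{r=1}^2\frac{(qa_r^{-1}z_i;q)_\infty}{(b_rz_i;q)_\infty}\Big\}\prod_{1\le j<k\le n}z_j^{2\tau-1}\frac{(qt^{-1}z_k/z_j;q)_\infty}{(tz_k/z_j;q)_\infty},\qquad \Delta(z):=\prod_{1\le i<j\le n}(z_i-z_j),$$ and let Matsuo's polynomials be $$e_i(a,b;z):=\frac1{\Delta(z)}\sum_{\sigma\in S_n}\operatorname{sgn}(\sigma)\,f_i(z_{\sigma(1)},\dots,z_{\sigma(n)}),\quad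 f_i(z):=\prod_{j=1}^{n-i}(1-bz_j)\prod_{j=n-i+1}^n(1-a^{-1}z_j)\prod_{1\le k<l\le n}(z_k-t^{-1}z_l)\quad(0\le i\le n).$$ For $\xi=(\xi_1,\dots,\xi_n)\in(\mathbb C^*)^n$ with fixed logarithms $\log\xi_i$, define the Jackson integral of symmetric Selberg type $$\langle e_i(a_1,b_2),\xi\rangle:=(1-q)^n\sum_{\nu\in\mathbb Z^n}e_i(a_1,b_2;z)\,\Phi(z)\,\Delta(z)\Big|_{z=(\xi_1q^{\nu_1},\dots,\xi_nq^{\nu_n})},$$ where powers on the lattice are $(\xi_iq^{\nu_i})^s:=e^{s(\log\xi_i+\nu_i\log q)}$. **Assumptions.** * The lattice avoids the poles of $\Phi$: $b_r\xi_i\notin q^{\mathbb Z}$ for all $r,i$, and $t\xi_k/\xi_j\notin q^{\mathbb Z}$ for all $j<k$. * The convergence condition $$|qa_1^{-1}a_2^{-1}b_1^{-1}b_2^{-1}|<|q^\alpha|<1,\qquad |qa_1^{-1}a_2^{-1}b_1^{-1}b_2^{-1}|<|q^\alpha t^{2n-2}|<1$$ holds for $\alpha$, and it also holds with $\alpha$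 replaced by $\alpha+1$. * The denominators below do not vanish: $t^k\ne1$ for $1\le k\le n$, and $q^\alpha a_2b_2t^k\ne1$, $q^\alpha a_1b_1t^k\ne 1$ for $0\le k\le 2n-2$. **Theorem.** The sums defining $\langle e_i(a_1,b_2),\xi\rangle$ $(0\le i\le n)$ converge absolutely for $\alpha$ and for $\alpha+1$. Let $T_\alpha$ denote the shift $\alpha\to\alpha+1$, i.e. $T_\alpha f(\alpha)=f(\alpha+1)$. Then $$T_\alpha\big(\langle e_0(a_1,b_2),\xi\rangle,\dots,\langle e_n(a_1,b_2),\xi\rangle\big)=\big(\langle e_0(a_1,b_2),\xi\rangle,\dots,\langle e_n(a_1,b_2),\xi\rangle\big)A,\qquad A=L_AD_AU_A=U'_AD'_AL'_A.$$ Here $L_A=(l_{ij})$, $L'_A=(l'_{ij})$ are lower triangular, $D_A=(d_j\delta_{ij})$, $D'_A=(d'_j\delta_{ij})$ are diagonal and $U_A=(u_{ij})$, $U'_A=(u'_{ij})$ are upper triangular $(0\le i,j\le n)$, with entries ($i\ge j$ for $l_{ij},l'_{ij}$ and $i\le j$ for $u_{ij},u'_{ij}$) $$l_{ij}=(-1)^{i-j}t^{\binom{n-i}2-\binom{n-j}2}\left[{n-j\atop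 n-i}\right]_t\frac{(a_2b_2t^j;t)_{i-j}}{(q^\alpha a_2b_2t^{2j};t)_{i-j}},$$ $$d_j=a_1^{n-j}a_2^jt^{\binom j2+\binom{n-j}2}\frac{(q^\alpha;t)_j(q^\alpha a_2b_2t^{2j};t)_{n-j}}{(q^\alpha a_2b_2t^{j-1};t)_j(q^\alpha a_1a_2b_1b_2t^{n+j-1};t)_{n-j}},$$ $$u_{ij}=(-q^\alpha a_1^{-1}a_2)^{j-i}t^{\binom j2-\binom i2}\left[{j\atop i}\right]_t\frac{(a_1b_1t^{n-j};t)_{j-i}}{(q^\alpha a_2b_2t^{2i};t)_{j-i}},$$ $$u'_{ij}=(-q^\alpha)^{j-i}t^{\binom{n-i}2-\binom{n-j}2}\left[{j\atop i}\right]_t\frac{(a_1b_1t^{n-j};t)_{j-i}}{(q^\alpha a_1b_1t^{2(n-j)};t)_{j-i}},$$ $$d'_j=a_1^{n-j}a_2^jt^{\binom j2+\binom{n-j}2}\frac{(q^\alpha a_1b_1t^{2(n-j)};t)_j(q^\alpha;t)_{n-j}}{(q^\alpha a_1a_2b_1b_2t^{2n-j-1};t)_j(q^\alpha a_1b_1t^{n-j-1};t)_{n-j}},$$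 $$l'_{ij}=(-a_1a_2^{-1})^{i-j}t^{\binom j2-\binom i2}\left[{n-j\atop n-i}\right]_t\frac{(a_2b_2t^j;t)_{i-j}}{(q^\alpha a_1b_1t^{2(n-i)};t)_{i-j}}.$$ -/

import Mathlib

/-! ## Shifted factorials -/

/-- The `c`-shifted factorial `(x; c)_k = (1 - x)(1 - c x) ⋯ (1 - c ^ (k - 1) x)`, `k ≥ 0`. -/
noncomputable def shiftedFactorial (x c : ℂ) (k : ℕ) : ℂ :=
  ∏ i ∈ Finset.range k, (1 - c ^ i * x)

/-- The `c`-binomial coefficient `[i, j]_c = (c; c)_i / ((c; c)_{i - j} (c; c)_j)`, for `j ≤ i`. -/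
noncomputable def cBinom (i j : ℕ) (c : ℂ) : ℂ :=
  shiftedFactorial c c i / (shiftedFactorial c c (i - j) * shiftedFactorial c c j)

/-- The infinite product `(x; c)_∞ = ∏_{i ≥ 0} (1 - c ^ i x)`, for `|c| < 1`. -/
noncomputable def shiftedFactorialInf (x c : ℂ) : ℂ :=
  ∏' i : ℕ, (1 - c ^ i * x)

/-! ## Matsuo's polynomials -/

/-- The pairs `(j, k)` with `j < k`. -/
def ltPairs (n : ℕ) : Finset (Fin n × Fin n) :=
  Finset.univ.filter fun p => p.1 < p.2

/-- The difference product `Δ(z) = ∏_{i < j} (z_i - z_j)`, as a polynomial. -/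
noncomputable def deltaPoly (n : ℕ) : MvPolynomial (Fin n) ℂ :=
  ∏ p ∈ ltPairs n, (MvPolynomial.X p.1 - MvPolynomial.X p.2)

/-- The alternating sum `(𝒜 f)(z) = ∑_σ sgn(σ) f(z_{σ(1)}, …, z_{σ(n)})`. -/
noncomputable def skewSymm {n : ℕ} (f : MvPolynomial (Fin n) ℂ) : MvPolynomial (Fin n) ℂ :=
  ∑ σ : Equiv.Perm (Fin n),
    MvPolynomial.C (((Equiv.Perm.sign σ : ℤˣ) : ℤ) : ℂ) * MvPolynomial.rename σ f

theorem rename_swap_skewSymm {n : ℕ} (f : MvPolynomial (Fin n) ℂ) {i j : Fin n} (hij : i ≠ j) :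
    MvPolynomial.rename (Equiv.swap i j) (skewSymm f) = - skewSymm f := by
  unfold skewSymm
  rw [map_sum, ← Finset.sum_neg_distrib]
  refine Fintype.sum_equiv (Equiv.mulLeft (Equiv.swap i j)) _ _ fun σ => ?_
  simp only [map_mul, MvPolynomial.rename_C, MvPolynomial.rename_rename, Equiv.coe_mulLeft,
    Equiv.Perm.sign_swap hij, Equiv.Perm.coe_mul]
  simp

/-- The substitution `z_i ↦ z_j`. -/
noncomputable def substX {n : ℕ} (i j : Fin n) :
    MvPolynomial (Fin n) ℂ →ₐ[ℂ] MvPolynomial (Fin n) ℂ :=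
  MvPolynomial.aeval fun k => if k = i then MvPolynomial.X j else MvPolynomial.X k

theorem X_sub_X_dvd_of_substX_eq_zero {n : ℕ} {i j : Fin n} {g : MvPolynomial (Fin n) ℂ}
    (h : substX i j g = 0) : (MvPolynomial.X i - MvPolynomial.X j) ∣ g := by
  let I : Ideal (MvPolynomial (Fin n) ℂ) :=
    Ideal.span {MvPolynomial.X i - MvPolynomial.X j}
  have key : (Ideal.Quotient.mkₐ ℂ I).comp (substX i j) = Ideal.Quotient.mkₐ ℂ I := by
    apply MvPolynomial.algHom_ext
    intro k
    by_cases hk : k = i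
    · subst hk
      simp only [substX, AlgHom.comp_apply, MvPolynomial.aeval_X, if_true,
        Ideal.Quotient.mkₐ_eq_mk]
      refine (Ideal.Quotient.eq.2 ?_).symm
      exact Ideal.subset_span rfl
    · simp [substX, hk]
  have h2 := congrArg (fun F => F g) key
  simp only [AlgHom.comp_apply, h, map_zero, Ideal.Quotient.mkₐ_eq_mk] at h2
  exact Ideal.mem_span_singleton.1 (Ideal.Quotient.eq_zero_iff_mem.1 h2.symm)

theorem X_sub_X_dvd_skewSymm {n : ℕ} (f : MvPolynomial (Fin n) ℂ) {i j : Fin n} (hij : i ≠ j) :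
    (MvPolynomial.X i - MvPolynomial.X j) ∣ skewSymm f := by
  apply X_sub_X_dvd_of_substX_eq_zero
  have h1 : substX i j (MvPolynomial.rename (Equiv.swap i j) (skewSymm f))
      = substX i j (skewSymm f) := by
    unfold substX
    rw [MvPolynomial.aeval_rename]
    congr 2
    funext k
    simp only [Function.comp_apply]
    by_cases h1 : k = i
    · subst h1; simp [hij.symm]
    · by_cases h2 : k = j
      · subst h2; simp [h1]
      · rw [Equiv.swap_apply_of_ne_of_ne h1 h2]
  rw [rename_swap_skewSymm f hij, map_neg] at h1
  exact self_eq_neg.1 h1.symm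

theorem irreducible_X_sub_X {n : ℕ} {i j : Fin n} (hij : i ≠ j) :
    Irreducible (MvPolynomial.X i - MvPolynomial.X j : MvPolynomial (Fin n) ℂ) := by
  have h := MvPolynomial.irreducible_sumSMulX
    (Finsupp.single i (1 : ℂ) - Finsupp.single j (1 : ℂ)) ?_ ?_
  · simpa [MvPolynomial.sumSMulX, Finsupp.linearCombination_single] using h
  · exact ⟨i, by simp [hij.symm]⟩
  · intro r hr
    have := hr i
    simp [hij.symm] at this
    exact isUnit_iff_ne_zero.2 this

theorem deltaPoly_dvd_skewSymm {n : ℕ} (f : MvPolynomial (Fin n) ℂ) :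
    deltaPoly n ∣ skewSymm f := by
  unfold deltaPoly
  apply Finset.prod_dvd_of_isRelPrime
  · rintro ⟨i, j⟩ hp ⟨k, l⟩ hp' hne
    simp only [ltPairs, Finset.coe_filter, Finset.mem_univ, true_and, Set.mem_ofPred_eq] at hp hp'
    refine (irreducible_X_sub_X hp.ne).isRelPrime_iff_not_dvd.2 ?_
    intro hd
    have h0 : substX i j (MvPolynomial.X k - MvPolynomial.X l) = 0 := by
      obtain ⟨g, hg⟩ := hd
      simp only at hg
      rw [hg, map_mul]
      simp [substX]
    simp only [substX, map_sub, MvPolynomial.aeval_X, sub_eq_zero] at h0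
    split_ifs at h0 with h1 h2 h2 <;> rw [MvPolynomial.X_injective.eq_iff] at h0
    · exact hp'.ne (h1.trans h2.symm)
    · exact hne (by rw [h1, h0])
    · subst h2; subst h0; exact absurd (hp.trans hp') (lt_irrefl _)
    · exact hp'.ne h0
  · rintro ⟨i, j⟩ hp
    simp only [ltPairs, Finset.mem_filter, Finset.mem_univ, true_and] at hp
    exact X_sub_X_dvd_skewSymm f hp.ne

/-- The polynomial before skew-symmetrization in the definition of Matsuo's polynomials:
`∏_{j ≤ n - i} (1 - b z_j) ∏_{j > n - i} (1 - a⁻¹ z_j) ∏_{k < l} (z_k - t⁻¹ z_l)`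
(the variables are numbered from `0` here, so that `j ≤ n - i` reads `j + i < n`). -/
noncomputable def matsuoSeed (n : ℕ) (t a b : ℂ) (i : ℕ) : MvPolynomial (Fin n) ℂ :=
  (∏ j : Fin n, if (j : ℕ) + i < n then 1 - MvPolynomial.C b * MvPolynomial.X j
      else 1 - MvPolynomial.C a⁻¹ * MvPolynomial.X j) *
    ∏ p ∈ ltPairs n, (MvPolynomial.X p.1 - MvPolynomial.C t⁻¹ * MvPolynomial.X p.2)

/-- Matsuo's polynomial `e_i(a, b; z) = 𝒜(…) / Δ(z)`: the quotient polynomial, which exists by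
`deltaPoly_dvd_skewSymm` and is unique because `Δ ≠ 0`. -/
noncomputable def matsuoPoly (n : ℕ) (t a b : ℂ) (i : ℕ) : MvPolynomial (Fin n) ℂ :=
  Classical.choose (deltaPoly_dvd_skewSymm (matsuoSeed n t a b i))

theorem deltaPoly_mul_matsuoPoly (n : ℕ) (t a b : ℂ) (i : ℕ) :
    deltaPoly n * matsuoPoly n t a b i = skewSymm (matsuoSeed n t a b i) :=
  (Classical.choose_spec (deltaPoly_dvd_skewSymm (matsuoSeed n t a b i))).symm

/-! ## Jackson integrals

Complex powers are handled through logarithms. A logarithm `logq` of `q` and logarithms `u i` of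
the coordinates `ξ_i` are given; `q ^ s` is `exp (s * logq)`, the coordinate `ξ_i q ^ ν_i` has the
logarithm `u i + ν_i * logq`, and its power with exponent `s` is
`exp (s * (u i + ν_i * logq)) = ξ_i ^ s * (q ^ s) ^ ν_i`. Functions of `z` (possibly multivalued)
are therefore written as functions of a vector `u` of logarithms, `z = exp u`. -/

/-- The vector `u + ν log q`, which represents the lattice point `(ξ_1 q ^ ν_1, …, ξ_n q ^ ν_n)`. -/
noncomputable def latticePoint {n : ℕ} (logq : ℂ) (u : Fin n → ℂ) (ν : Fin n → ℤ) : Fin n → ℂ :=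
  fun i => u i + (ν i : ℂ) * logq

/-- The Jackson integral of `F` converges (absolutely) on the lattice through `u`. -/
def JacksonConverges {n : ℕ} (logq : ℂ) (u : Fin n → ℂ) (F : (Fin n → ℂ) → ℂ) : Prop :=
  Summable fun ν : Fin n → ℤ => F (latticePoint logq u ν)

/-- The Jackson integral `(1 - q) ^ n ∑_{ν ∈ ℤ^n} F(ξ_1 q ^ ν_1, …, ξ_n q ^ ν_n)`. -/
noncomputable def jacksonIntegral {n : ℕ} (logq : ℂ) (u : Fin n → ℂ) (F : (Fin n → ℂ) → ℂ) : ℂ :=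
  (1 - Complex.exp logq) ^ n * ∑' ν : Fin n → ℤ, F (latticePoint logq u ν)

/-- The function
`Φ_{n,m}(z) = ∏_i (z_i ^ α ∏_r (q a_r⁻¹ z_i; q)_∞ / (b_r z_i; q)_∞)
  · ∏_{j < k} z_j ^ (2 τ - 1) (q t⁻¹ z_k / z_j; q)_∞ / (t z_k / z_j; q)_∞`
with `q = exp logq`, `t = q ^ τ`, `z = exp u`. -/
noncomputable def selbergPhi {n m : ℕ} (logq τ α : ℂ) (a b : Fin m → ℂ) (u : Fin n → ℂ) : ℂ :=
  let q := Complex.exp logq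
  let t := Complex.exp (τ * logq)
  let z : Fin n → ℂ := fun i => Complex.exp (u i)
  (∏ i : Fin n, (Complex.exp (α * u i) *
      ∏ r : Fin m, shiftedFactorialInf (q * (a r)⁻¹ * z i) q /
        shiftedFactorialInf (b r * z i) q)) *
    ∏ p ∈ ltPairs n, (Complex.exp ((2 * τ - 1) * u p.1) *
      (shiftedFactorialInf (q * t⁻¹ * (z p.2 / z p.1)) q /
        shiftedFactorialInf (t * (z p.2 / z p.1)) q))

/-- The integrand `φ(z) Φ_{n,m}(z) Δ(z)`, for a polynomial `φ`. -/
noncomputable def selbergIntegrand {n m : ℕ} (logq τ α : ℂ) (a b : Fin m → ℂ)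
    (φ : MvPolynomial (Fin n) ℂ) (u : Fin n → ℂ) : ℂ :=
  MvPolynomial.eval (fun i => Complex.exp (u i)) φ * selbergPhi logq τ α a b u *
    MvPolynomial.eval (fun i => Complex.exp (u i)) (deltaPoly n)

/-- For `m = 2`: the inequalities
`|q a₁⁻¹ a₂⁻¹ b₁⁻¹ b₂⁻¹| < |q ^ α| < 1` and
`|q a₁⁻¹ a₂⁻¹ b₁⁻¹ b₂⁻¹| < |q ^ α t ^ (2 n - 2)| < 1`. -/
def ConvergenceCondition (n : ℕ) (logq τ α a₁ a₂ b₁ b₂ : ℂ) : Prop :=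
  let q := Complex.exp logq
  let t := Complex.exp (τ * logq)
  let Q := Complex.exp (α * logq)
  ‖q * a₁⁻¹ * a₂⁻¹ * b₁⁻¹ * b₂⁻¹‖ < ‖Q‖ ∧ ‖Q‖ < 1 ∧
    ‖q * a₁⁻¹ * a₂⁻¹ * b₁⁻¹ * b₂⁻¹‖ < ‖Q * t ^ (2 * (n : ℤ) - 2)‖ ∧
    ‖Q * t ^ (2 * (n : ℤ) - 2)‖ < 1

/-- No lattice point `(ξ_1 q ^ ν_1, …, ξ_n q ^ ν_n)` is a pole of `Φ_{n,m}`: none of the numbers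
`b_r ξ_i` and `t ξ_k / ξ_j` (`j < k`) is an integral power of `q`. -/
def LatticeAvoidsPoles {n m : ℕ} (q t : ℂ) (b : Fin m → ℂ) (ξ : Fin n → ℂ) : Prop :=
  (∀ (r : Fin m) (i : Fin n) (ν : ℤ), b r * ξ i ≠ q ^ ν) ∧
    ∀ (j k : Fin n) (ν : ℤ), j < k → t * (ξ k / ξ j) ≠ q ^ ν

/-! ## The factors of the coefficient matrix

Below `Q` stands for `q ^ α`, and `c2 k` for the binomial coefficient `k choose 2` as an integer. -/

/-- The binomial coefficient `k choose 2` as an integer. -/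
def c2 (k : ℕ) : ℤ := (k.choose 2 : ℕ)

/-- The lower triangular matrix `L_A`. -/
noncomputable def matLA (n : ℕ) (Q t a₂ b₂ : ℂ) : Matrix (Fin (n + 1)) (Fin (n + 1)) ℂ :=
  Matrix.of fun i j =>
    if j ≤ i then
      (-1) ^ ((i : ℕ) - j) * t ^ (c2 (n - i) - c2 (n - j)) * cBinom (n - j) (n - i) t *
        (shiftedFactorial (a₂ * b₂ * t ^ (j : ℕ)) t (i - j) /
          shiftedFactorial (Q * a₂ * b₂ * t ^ (2 * (j : ℕ))) t (i - j))
    else 0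

/-- The diagonal matrix `D_A`. -/
noncomputable def matDA (n : ℕ) (Q t a₁ a₂ b₁ b₂ : ℂ) : Matrix (Fin (n + 1)) (Fin (n + 1)) ℂ :=
  Matrix.diagonal fun j =>
    a₁ ^ (n - (j : ℕ)) * a₂ ^ (j : ℕ) * t ^ (c2 j + c2 (n - j)) *
      ((shiftedFactorial Q t j * shiftedFactorial (Q * a₂ * b₂ * t ^ (2 * (j : ℕ))) t (n - j)) /
        (shiftedFactorial (Q * a₂ * b₂ * t ^ ((j : ℤ) - 1)) t j *
          shiftedFactorial (Q * a₁ * a₂ * b₁ * b₂ * t ^ ((n : ℤ) + j - 1)) t (n - j)))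

/-- The upper triangular matrix `U_A`. -/
noncomputable def matUA (n : ℕ) (Q t a₁ a₂ b₁ b₂ : ℂ) : Matrix (Fin (n + 1)) (Fin (n + 1)) ℂ :=
  Matrix.of fun i j =>
    if i ≤ j then
      (-Q * a₁⁻¹ * a₂) ^ ((j : ℕ) - i) * t ^ (c2 j - c2 i) * cBinom j i t *
        (shiftedFactorial (a₁ * b₁ * t ^ (n - (j : ℕ))) t (j - i) /
          shiftedFactorial (Q * a₂ * b₂ * t ^ (2 * (i : ℕ))) t (j - i))
    else 0

/-- The upper triangular matrix `U'_A`. -/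
noncomputable def matUA' (n : ℕ) (Q t a₁ b₁ : ℂ) : Matrix (Fin (n + 1)) (Fin (n + 1)) ℂ :=
  Matrix.of fun i j =>
    if i ≤ j then
      (-Q) ^ ((j : ℕ) - i) * t ^ (c2 (n - i) - c2 (n - j)) * cBinom j i t *
        (shiftedFactorial (a₁ * b₁ * t ^ (n - (j : ℕ))) t (j - i) /
          shiftedFactorial (Q * a₁ * b₁ * t ^ (2 * (n - (j : ℕ)))) t (j - i))
    else 0

/-- The diagonal matrix `D'_A`. -/
noncomputable def matDA' (n : ℕ) (Q t a₁ a₂ b₁ b₂ : ℂ) : Matrix (Fin (n + 1)) (Fin (n + 1)) ℂ :=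
  Matrix.diagonal fun j =>
    a₁ ^ (n - (j : ℕ)) * a₂ ^ (j : ℕ) * t ^ (c2 j + c2 (n - j)) *
      ((shiftedFactorial (Q * a₁ * b₁ * t ^ (2 * (n - (j : ℕ)))) t j *
          shiftedFactorial Q t (n - j)) /
        (shiftedFactorial (Q * a₁ * a₂ * b₁ * b₂ * t ^ (2 * (n : ℤ) - j - 1)) t j *
          shiftedFactorial (Q * a₁ * b₁ * t ^ ((n : ℤ) - j - 1)) t (n - j)))

/-- The lower triangular matrix `L'_A`. -/
noncomputable def matLA' (n : ℕ) (Q t a₁ a₂ b₁ b₂ : ℂ) : Matrix (Fin (n + 1)) (Fin (n + 1)) ℂ :=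
  Matrix.of fun i j =>
    if j ≤ i then
      (-a₁ * a₂⁻¹) ^ ((i : ℕ) - j) * t ^ (c2 j - c2 i) * cBinom (n - j) (n - i) t *
        (shiftedFactorial (a₂ * b₂ * t ^ (j : ℕ)) t (i - j) /
          shiftedFactorial (Q * a₁ * b₁ * t ^ (2 * (n - (i : ℕ)))) t (i - j))
    else 0

/-!
Write `Q = q^α`, `A(z) = 1 - a₁⁻¹ z`, `B(z) = 1 - b₂ z`. Multiplied by `Δ`, the polynomial `e_i` is
the skew-symmetrization of `∏ g_j(z_j) ∏_{k<l} (z_k - t⁻¹ z_l)` for the word `B^(n-i) A^i`, and the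
shift `α → α + 1` multiplies `Φ` by `z_1 ⋯ z_n`, so the left side of the theorem belongs to the word
`(zB)^(n-i) (zA)^i`. As a function of words in the letters `A`, `B`, `zA`, `zB` the Jackson sum has
three properties (`IsWordFunctional`, proved in `isWordFunctional_wordSum`):

* it is linear in each letter, and `B = A + a₁⁻¹ zB - b₂ zA`;
* a factor `z` passes from a letter to an equal neighbour at the price of a power of `t`, since the
  skew-symmetrization of a function symmetric in two variables vanishes;
* the last letter `A(z)(1 - a₂⁻¹ z)` may be replaced by the first letter `B(z)(1 - b₁ z)`, up to the
  factor `Q t^(n-1)`: this is the invariance of the sum under `z_i → q z_i` (`selbergPhi_update`),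
  followed by a cyclic rotation of the variables.

Let `g k i` be the value at `z_1 ⋯ z_k f_i`, where `f_i` is the polynomial of `B^(n-i) A^i`. The
properties give two recursions of first order, `LowerRec` for `k + i ≤ n` and `UpperRec` for
`k + i ≥ n`. Their solutions (`LowerRec.closed_form`, `UpperRec.closed_form`) express `g (n - i) i`
through `g 0` by `L_A` and one part of `D_A`, and `g n` through the `g (n - i) i` by the other part
of `D_A` and `U_A`; together they give `g n = g 0 · L_A D_A U_A` (`IsWordFunctional.gauss`). The same
argument for the products `z_(n-k+1) ⋯ z_n f_i`, which up to scaling satisfy the same recursions with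
`(a₁, b₁)` and `(a₂, b₂)` exchanged and `i` reversed, gives `U'_A D'_A L'_A`
(`IsWordFunctional.gauss'`).

It remains to see that the two products of matrices are equal, which a single functional does not
show. A noncommutative analogue of the words, in an algebra with three generators in the place of
`1`, `z`, `z²`, carries a one-parameter family of functionals with the same properties, whose values
on the words `B^(n-i) A^i` are explicit products (`evalWord_plane`). These vectors span if `a₁` is
generic; the general case follows by continuity (`gauss_eq_gauss'`).

Absolute convergence comes from the growth of `(c q^ν; q)_∞ / (d q^ν; q)_∞` for `ν → ±∞`
(`exists_norm_shiftedFactorialInf_div_le`): the factor of a pair is of the size of a power with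
exponent `min(ν_j, ν_k)`, which is at most the sum of the powers with exponents `ν_j` and `ν_k`, so
the series is dominated by finitely many products of one-dimensional ones (`summable_selberg`).
-/

/-! ### Shifted factorials and Gaussian binomial coefficients -/

theorem shiftedFactorial_zero (x c : ℂ) : shiftedFactorial x c 0 = 1 := by
  simp [shiftedFactorial]

theorem shiftedFactorial_succ (x c : ℂ) (k : ℕ) :
    shiftedFactorial x c (k + 1) = shiftedFactorial x c k * (1 - c ^ k * x) :=
  Finset.prod_range_succ _ _

theorem shiftedFactorial_succ' (x c : ℂ) (k : ℕ) :
    shiftedFactorial x c (k + 1) = (1 - x) * shiftedFactorial (x * c) c k := by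
  unfold shiftedFactorial
  rw [Finset.prod_range_succ', mul_comm]
  congr 1
  · simp
  · exact Finset.prod_congr rfl fun i _ => by ring

theorem shiftedFactorial_ne_zero {x c : ℂ} {k : ℕ} (h : ∀ i < k, x * c ^ i ≠ 1) :
    shiftedFactorial x c k ≠ 0 := by
  refine Finset.prod_ne_zero_iff.2 fun i hi => ?_
  have := h i (Finset.mem_range.1 hi)
  rw [sub_ne_zero, mul_comm]
  exact this.symm

/-- The Gaussian binomial coefficient in the base `t`, defined by the `t`-Pascal rule; unlike
`cBinom` it vanishes for `k < m`. -/
noncomputable def gaussBinom (t : ℂ) : ℕ → ℕ → ℂ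
  | _, 0 => 1
  | 0, _ + 1 => 0
  | k + 1, m + 1 => t ^ (m + 1) * gaussBinom t k (m + 1) + gaussBinom t k m

theorem gaussBinom_zero_right (t : ℂ) (k : ℕ) : gaussBinom t k 0 = 1 := by
  cases k <;> rfl

theorem gaussBinom_succ_succ (t : ℂ) (k m : ℕ) :
    gaussBinom t (k + 1) (m + 1) = t ^ (m + 1) * gaussBinom t k (m + 1) + gaussBinom t k m := rfl

theorem gaussBinom_eq_zero (t : ℂ) : ∀ {k m : ℕ}, k < m → gaussBinom t k m = 0
  | _, 0, h => absurd h (Nat.not_lt_zero _)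
  | 0, _ + 1, _ => rfl
  | k + 1, m + 1, h => by
    rw [gaussBinom_succ_succ, gaussBinom_eq_zero t (by omega), gaussBinom_eq_zero t (by omega)]
    simp

theorem gaussBinom_self (t : ℂ) (k : ℕ) : gaussBinom t k k = 1 := by
  induction k with
  | zero => rfl
  | succ k ih => rw [gaussBinom_succ_succ, ih, gaussBinom_eq_zero t (by omega)]; simp

theorem gaussBinom_absorb (t : ℂ) (m l : ℕ) :
    (1 - t ^ (m + 1)) * gaussBinom t (m + l) (m + 1) = (1 - t ^ l) * gaussBinom t (m + l) m := by
  induction h : m + l generalizing m l with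
  | zero =>
    obtain ⟨rfl, rfl⟩ : m = 0 ∧ l = 0 := by omega
    simp [gaussBinom]
  | succ N ih =>
    rcases m with _ | m
    · obtain rfl : l = N + 1 := by omega
      have := ih 0 N (by omega)
      rw [gaussBinom_succ_succ, gaussBinom_zero_right, gaussBinom_zero_right] at *
      linear_combination t * this
    · rcases l with _ | l
      · rw [gaussBinom_eq_zero t (by omega)]; simp
      · have h1 := ih (m + 1) l (by omega)
        have h2 := ih m (l + 1) (by omega)
        rw [gaussBinom_succ_succ, gaussBinom_succ_succ]
        linear_combination t ^ (m + 2) * h1 + h2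

/-- The consequence of the two `t`-Pascal rules on which both triangular closed forms rest. -/
theorem gaussBinom_pascal (t x : ℂ) {k m : ℕ} (h : m ≤ k) :
    gaussBinom t (k + 1) (m + 1) * (1 - x * t ^ (m + 1)) =
      t ^ (m + 1) * (1 - x) * gaussBinom t k (m + 1) + (1 - x * t ^ (k + 1)) * gaussBinom t k m := by
  obtain ⟨l, rfl⟩ := Nat.exists_eq_add_of_le h
  have := gaussBinom_absorb t m l
  rw [gaussBinom_succ_succ]
  linear_combination x * t ^ (m + 1) * this

theorem gaussBinom_mul_shiftedFactorial (t : ℂ) (m l : ℕ) :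
    gaussBinom t (m + l) m * (shiftedFactorial t t m * shiftedFactorial t t l) =
      shiftedFactorial t t (m + l) := by
  induction m generalizing l with
  | zero => simp [gaussBinom_zero_right, shiftedFactorial_zero]
  | succ m ih =>
    have h1 := ih (l + 1)
    have h2 := gaussBinom_absorb t m (l + 1)
    rw [shiftedFactorial_succ] at h1 ⊢
    rw [show m + 1 + l = m + (l + 1) by ring]
    linear_combination h1 + shiftedFactorial t t m * shiftedFactorial t t l * h2

theorem cBinom_eq_gaussBinom {t : ℂ} {m l : ℕ} (h : ∀ k, 1 ≤ k → k ≤ m + l → t ^ k ≠ 1) :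
    cBinom (m + l) m t = gaussBinom t (m + l) m := by
  have h0 : ∀ r ≤ m + l, shiftedFactorial t t r ≠ 0 := fun r hr =>
    shiftedFactorial_ne_zero fun i hi => by
      rw [← pow_succ']; exact h _ (by omega) (by omega)
  rw [cBinom, ← gaussBinom_mul_shiftedFactorial, Nat.add_sub_cancel_left,
    mul_comm (shiftedFactorial t t l), mul_div_cancel_right₀]
  exact mul_ne_zero (h0 _ (by omega)) (h0 _ (by omega))

theorem cBinom_symm (t : ℂ) (m l : ℕ) : cBinom (m + l) l t = cBinom (m + l) m t := by
  simp [cBinom, mul_comm]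

/-! ### Closed forms of two recursions -/

theorem choose_two_succ (k : ℕ) : (k + 1).choose 2 = k.choose 2 + k := by
  rw [Nat.choose_succ_succ' k 1, Nat.choose_one_right, add_comm]

/-- The coefficient of `g 0 (i + m)` in the solution `g k i` of `LowerRec`, without its
denominator; `r = n - k - i`. -/
noncomputable def lowerCoeff (a t Q c : ℂ) (k r i m : ℕ) : ℂ :=
  a ^ k * (-1) ^ m * gaussBinom t k m * t ^ (r * k + (k - m).choose 2) *
    shiftedFactorial (c * t ^ i) t m * shiftedFactorial (Q * c * t ^ (r + 2 * i + m)) t (k - m)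

theorem lowerCoeff_succ_zero (a t Q c : ℂ) (k r i : ℕ) :
    lowerCoeff a t Q c (k + 1) r i 0 =
      a * t ^ r * ((1 - Q * c * t ^ (r + 2 * i)) * lowerCoeff a t Q c k (r + 1) i 0) := by
  simp only [lowerCoeff, gaussBinom_zero_right, Nat.sub_zero, choose_two_succ, shiftedFactorial_zero,
    shiftedFactorial_succ', add_zero]
  rw [show Q * c * t ^ (r + 2 * i) * t = Q * c * t ^ (r + 1 + 2 * i) by ring]
  ring

theorem lowerCoeff_succ_succ (a t Q c : ℂ) {k m : ℕ} (r i : ℕ) (h : m ≤ k) :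
    lowerCoeff a t Q c (k + 1) r i (m + 1) =
      a * t ^ r * ((1 - Q * c * t ^ (r + 2 * i)) * lowerCoeff a t Q c k (r + 1) i (m + 1) -
        (1 - c * t ^ i) * lowerCoeff a t Q c k r (i + 1) m) := by
  simp only [lowerCoeff, Nat.add_sub_add_right]
  rw [shiftedFactorial_succ' (c * t ^ i), show c * t ^ i * t = c * t ^ (i + 1) by ring]
  obtain rfl | h := h.eq_or_lt
  · rw [gaussBinom_self, gaussBinom_self, gaussBinom_eq_zero t (Nat.lt_succ_self _)]
    simp only [Nat.sub_self, shiftedFactorial_zero]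
    ring
  · obtain ⟨l, rfl⟩ := Nat.exists_eq_add_of_lt h
    rw [show m + l + 1 - m = l + 1 by omega, show m + l + 1 - (m + 1) = l by omega,
      choose_two_succ, shiftedFactorial_succ' (Q * c * t ^ (r + 2 * i + (m + 1))),
      shiftedFactorial_succ (Q * c * t ^ (r + 2 * (i + 1) + m)),
      show Q * c * t ^ (r + 2 * i + (m + 1)) * t = Q * c * t ^ (r + 2 * (i + 1) + m) by ring,
      show Q * c * t ^ (r + 1 + 2 * i + (m + 1)) = Q * c * t ^ (r + 2 * (i + 1) + m) by ring]
    have := gaussBinom_pascal t (Q * c * t ^ (r + 2 * i)) (k := m + l + 1) (m := m) (by omega)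
    linear_combination a ^ (m + l + 2) * (-1) ^ (m + 1) * t ^ (r * (m + l + 2) + l.choose 2 + l) *
      ((1 - c * t ^ i) * shiftedFactorial (c * t ^ (i + 1)) t m) *
      shiftedFactorial (Q * c * t ^ (r + 2 * (i + 1) + m)) t l * this

/-- The recursion in the region `k + i ≤ n`: with `g k i` for the value of `z_1 ⋯ z_k e_i`, it
lowers the number of factors `z`. -/
def LowerRec (n : ℕ) (t Q a₁ c d : ℂ) (g : ℕ → ℕ → ℂ) : Prop :=
  ∀ k i r, k + 1 + i + r = n →
    (1 - Q * c * d * t ^ (k + 2 * i + 2 * r)) * g (k + 1) i =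
      a₁ * t ^ r * ((1 - Q * c * t ^ (r + 2 * i)) * g k i - (1 - c * t ^ i) * g k (i + 1))

/-- The recursion in the region `k + i ≥ n`: it relates `g k i` to `g (k + 1) i` and
`g (k + 1) (i - 1)`. -/
def UpperRec (n : ℕ) (t Q a₁ a₂ c d : ℂ) (g : ℕ → ℕ → ℂ) : Prop :=
  ∀ p l s, p + l + 1 + s = n →
    (1 - Q * t ^ s) * g (p + l) (s + 1 + p) =
      a₂⁻¹ * (t ^ s)⁻¹ * (1 - Q * c * t ^ (2 * s + p)) * g (p + l + 1) (s + 1 + p) +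
        Q * t ^ (s + p) * a₁⁻¹ * (1 - d * t ^ l) * g (p + l + 1) (s + p)

/-- Each of the `g k i` with `k + i ≤ n` in terms of the `g 0 j`. -/
theorem LowerRec.closed_form {n : ℕ} {t Q a₁ c d : ℂ} {g : ℕ → ℕ → ℂ}
    (hg : LowerRec n t Q a₁ c d g) (k i r : ℕ) (h : k + i + r = n) :
    shiftedFactorial (Q * c * d * t ^ (2 * n - k - 1)) t k * g k i =
      ∑ m ∈ Finset.range (k + 1), lowerCoeff a₁ t Q c k r i m * g 0 (i + m) := by
  induction k generalizing i r with
  | zero => simp [shiftedFactorial_zero, lowerCoeff, gaussBinom]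
  | succ k ih =>
    have h1 := ih i (r + 1) (by omega)
    have h2 := ih (i + 1) r (by omega)
    have h3 := hg k i r (by omega)
    have e1 : ∑ m ∈ Finset.range (k + 1), lowerCoeff a₁ t Q c k (r + 1) i m * g 0 (i + m) =
        ∑ m ∈ Finset.range (k + 1), lowerCoeff a₁ t Q c k (r + 1) i (m + 1) * g 0 (i + (m + 1)) +
          lowerCoeff a₁ t Q c k (r + 1) i 0 * g 0 i := by
      rw [← add_zero (∑ m ∈ Finset.range (k + 1), lowerCoeff a₁ t Q c k (r + 1) i m * g 0 (i + m))]
      rw [show (0 : ℂ) = lowerCoeff a₁ t Q c k (r + 1) i (k + 1) * g 0 (i + (k + 1)) by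
        simp [lowerCoeff, gaussBinom_eq_zero t (Nat.lt_succ_self k)]]
      rw [← Finset.sum_range_succ (fun m => lowerCoeff a₁ t Q c k (r + 1) i m * g 0 (i + m)),
        Finset.sum_range_succ']
      rfl
    rw [Finset.sum_range_succ', shiftedFactorial_succ',
      show Q * c * d * t ^ (2 * n - (k + 1) - 1) * t = Q * c * d * t ^ (2 * n - k - 1) by
        rw [show 2 * n - k - 1 = (2 * n - (k + 1) - 1) + 1 by omega]; ring,
      show 2 * n - (k + 1) - 1 = k + 2 * i + 2 * r by omega]
    rw [Finset.sum_congr rfl fun m hm => by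
      rw [lowerCoeff_succ_succ a₁ t Q c r i (Nat.lt_succ_iff.1 (Finset.mem_range.1 hm))]]
    have e2 : ∑ m ∈ Finset.range (k + 1), a₁ * t ^ r *
          ((1 - Q * c * t ^ (r + 2 * i)) * lowerCoeff a₁ t Q c k (r + 1) i (m + 1) -
            (1 - c * t ^ i) * lowerCoeff a₁ t Q c k r (i + 1) m) * g 0 (i + (m + 1)) =
        a₁ * t ^ r * ((1 - Q * c * t ^ (r + 2 * i)) * ∑ m ∈ Finset.range (k + 1),
            lowerCoeff a₁ t Q c k (r + 1) i (m + 1) * g 0 (i + (m + 1)) -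
          (1 - c * t ^ i) * ∑ m ∈ Finset.range (k + 1),
            lowerCoeff a₁ t Q c k r (i + 1) m * g 0 (i + 1 + m)) := by
      rw [Finset.mul_sum, Finset.mul_sum, ← Finset.sum_sub_distrib, Finset.mul_sum]
      refine Finset.sum_congr rfl fun m _ => ?_
      rw [show i + 1 + m = i + (m + 1) by ring]
      ring
    rw [e2, lowerCoeff_succ_zero, ← h2, add_zero]
    rw [e1] at h1
    linear_combination shiftedFactorial (Q * c * d * t ^ (2 * n - k - 1)) t k * h3 +
      a₁ * t ^ r * (1 - Q * c * t ^ (r + 2 * i)) * h1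

/-- The coefficient of `g (n - s - A) (s + A)` in the solution `g (n - s) (s + A + m)` of
`UpperRec`. The exponent `2 s + A - 1` is `-1` for `s = A = 0`, but then the factor is empty. -/
noncomputable def upperCoeff (n : ℕ) (t Q a₁ a₂ c d : ℂ) (s A m : ℕ) : ℂ :=
  a₂ ^ A * (-Q * a₁⁻¹ * a₂) ^ m * gaussBinom t (A + m) m * t ^ (s * (A + 2 * m) + (A + m).choose 2) *
    (shiftedFactorial (Q * t ^ s) t A * shiftedFactorial (d * t ^ (n - s - (A + m))) t m) /
    (shiftedFactorial (Q * c * t ^ (2 * (s : ℤ) + A - 1)) t A *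
      shiftedFactorial (Q * c * t ^ (2 * s + 2 * A)) t m)

theorem upperCoeff_zero_succ {n : ℕ} {t Q a₁ a₂ c d : ℂ} {s m : ℕ} (hn : s + (m + 1) ≤ n)
    (h : Q * c * t ^ (2 * s + m) ≠ 1) :
    (1 - Q * c * t ^ (2 * s + m)) * upperCoeff n t Q a₁ a₂ c d s 0 (m + 1) =
      (-Q * a₁⁻¹ * a₂) * t ^ (2 * s + m) * (1 - d * t ^ (n - s - (m + 1))) *
        upperCoeff n t Q a₁ a₂ c d s 0 m := by
  have h' : 1 - t ^ m * (Q * c * t ^ (2 * s)) ≠ 0 := by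
    rw [show t ^ m * (Q * c * t ^ (2 * s)) = Q * c * t ^ (2 * s + m) by ring]
    exact sub_ne_zero.2 h.symm
  simp only [upperCoeff, shiftedFactorial_zero, zero_add, mul_zero, add_zero, gaussBinom_self,
    choose_two_succ]
  rw [shiftedFactorial_succ (Q * c * t ^ (2 * s)), shiftedFactorial_succ' (d * _),
    show d * t ^ (n - s - (m + 1)) * t = d * t ^ (n - s - m) by
      rw [show n - s - m = n - s - (m + 1) + 1 by omega]; ring,
    show Q * c * t ^ (2 * s + m) = t ^ m * (Q * c * t ^ (2 * s)) by ring]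
  rw [← mul_div_assoc, ← mul_div_assoc, mul_comm (shiftedFactorial (Q * c * t ^ (2 * s)) t m),
    one_mul, one_mul, one_mul, ← div_div, one_mul]
  congr 1
  rw [div_eq_iff h']
  ring

theorem upperCoeff_succ_zero {n : ℕ} {t Q a₁ a₂ c d : ℂ} (ht : t ≠ 0) {s A : ℕ}
    (h : Q * c * t ^ (2 * s + A) ≠ 1) :
    (1 - Q * c * t ^ (2 * s + A)) * upperCoeff n t Q a₁ a₂ c d s (A + 1) 0 =
      a₂ * t ^ s * (1 - Q * t ^ s) * upperCoeff n t Q a₁ a₂ c d (s + 1) A 0 := by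
  have h' : 1 - Q * c * t ^ (2 * s + A) ≠ 0 := sub_ne_zero.2 h.symm
  simp only [upperCoeff, shiftedFactorial_zero, gaussBinom_zero_right, add_zero, mul_zero,
    choose_two_succ]
  rw [shiftedFactorial_succ' (Q * t ^ s), shiftedFactorial_succ' (Q * c * _),
    show Q * t ^ s * t = Q * t ^ (s + 1) by ring,
    show Q * c * t ^ (2 * (s : ℤ) + ((A + 1 : ℕ) : ℤ) - 1) = Q * c * t ^ (2 * s + A) by
      rw [← zpow_natCast t (2 * s + A)]; congr 2; push_cast; ring,
    show Q * c * t ^ (2 * s + A) * t = Q * c * t ^ (2 * ((s + 1 : ℕ) : ℤ) + A - 1) by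
      rw [← zpow_natCast t (2 * s + A), mul_assoc, ← zpow_add_one₀ ht]; congr 2; push_cast; ring]
  rw [← mul_div_assoc, ← mul_div_assoc, mul_one, mul_one, mul_one, ← div_div]
  congr 1
  · rw [div_eq_iff h']
    ring
  · simp

theorem upperCoeff_succ_succ {n : ℕ} {t Q a₁ a₂ c d : ℂ} (ht : t ≠ 0) {s A m : ℕ}
    (hn : s + (A + m + 2) ≤ n)
    (h : ∀ j, j + 2 ≤ 2 * n → Q * c * t ^ j ≠ 1) :
    (1 - Q * c * t ^ (2 * s + A + m + 1)) * upperCoeff n t Q a₁ a₂ c d s (A + 1) (m + 1) =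
      a₂ * t ^ s * (1 - Q * t ^ s) * upperCoeff n t Q a₁ a₂ c d (s + 1) A (m + 1) +
      (-Q * a₁⁻¹ * a₂) * t ^ (2 * s + A + m + 1) * (1 - d * t ^ (n - s - (A + m + 2))) *
        upperCoeff n t Q a₁ a₂ c d s (A + 1) m := by
  have hP := gaussBinom_pascal t (Q * c * t ^ (2 * s + A)) (k := A + 1 + m) (m := m) (by omega)
  simp only [upperCoeff]
  rw [show A + 1 + (m + 1) = A + 1 + m + 1 by ring, show A + (m + 1) = A + 1 + m by ring,
    choose_two_succ (A + 1 + m)]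
  rw [shiftedFactorial_succ' (Q * t ^ s),
    show Q * t ^ s * t = Q * t ^ (s + 1) by ring,
    shiftedFactorial_succ' (Q * c * t ^ (2 * (s : ℤ) + _ - 1)),
    show Q * c * t ^ (2 * (s : ℤ) + ((A + 1 : ℕ) : ℤ) - 1) = Q * c * t ^ (2 * s + A) by
      rw [← zpow_natCast t (2 * s + A)]; congr 2; push_cast; ring,
    show Q * c * t ^ (2 * s + A) * t = Q * c * t ^ (2 * ((s + 1 : ℕ) : ℤ) + A - 1) by
      rw [← zpow_natCast t (2 * s + A), mul_assoc, ← zpow_add_one₀ ht]; congr 2; push_cast; ring,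
    show n - (s + 1) - (A + 1 + m) = n - s - (A + 1 + m + 1) by omega,
    show n - s - (A + m + 2) = n - s - (A + 1 + m + 1) by omega,
    shiftedFactorial_succ' (d * t ^ (n - s - (A + 1 + m + 1))),
    show d * t ^ (n - s - (A + 1 + m + 1)) * t = d * t ^ (n - s - (A + 1 + m)) by
      rw [show n - s - (A + 1 + m) = n - s - (A + 1 + m + 1) + 1 by omega]; ring,
    show 2 * (s + 1) + 2 * A = 2 * s + 2 * (A + 1) by ring,
    shiftedFactorial_succ (Q * c * t ^ (2 * s + 2 * (A + 1)))]
  have n1 : shiftedFactorial (Q * c * t ^ (2 * ((s + 1 : ℕ) : ℤ) + A - 1)) t A ≠ 0 := by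
    refine shiftedFactorial_ne_zero fun i hi => ?_
    rw [show Q * c * t ^ (2 * ((s + 1 : ℕ) : ℤ) + A - 1) = Q * c * t ^ (2 * s + A + 1) by
      rw [← zpow_natCast t (2 * s + A + 1)]; congr 2; push_cast; ring]
    rw [mul_assoc, ← pow_add]
    exact h _ (by omega)
  have n2 : shiftedFactorial (Q * c * t ^ (2 * s + 2 * (A + 1))) t m ≠ 0 := by
    refine shiftedFactorial_ne_zero fun i hi => ?_
    rw [mul_assoc, ← pow_add]
    exact h _ (by omega)
  have n3 : 1 - Q * c * t ^ (2 * s + A) ≠ 0 := sub_ne_zero.2 (h _ (by omega)).symm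
  have n4 : 1 - t ^ m * (Q * c * t ^ (2 * s + 2 * (A + 1))) ≠ 0 := by
    rw [show t ^ m * (Q * c * t ^ (2 * s + 2 * (A + 1))) = Q * c * t ^ (2 * s + 2 * (A + 1) + m) by
      ring]
    exact sub_ne_zero.2 (h _ (by omega)).symm
  generalize shiftedFactorial (Q * c * t ^ (2 * ((s + 1 : ℕ) : ℤ) + A - 1)) t A = S₁ at *
  generalize shiftedFactorial (Q * c * t ^ (2 * s + 2 * (A + 1))) t m = S₂ at *
  generalize shiftedFactorial (Q * t ^ (s + 1)) t A = S₃
  generalize shiftedFactorial (d * t ^ (n - s - (A + 1 + m))) t m = S₄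
  generalize d * t ^ (n - s - (A + 1 + m + 1)) = y
  generalize -Q * a₁⁻¹ * a₂ = β
  rw [mul_div_assoc', mul_div_assoc', mul_div_assoc',
    div_add_div _ _ (mul_ne_zero n1 (mul_ne_zero n2 n4)) (mul_ne_zero (mul_ne_zero n3 n1) n2),
    div_eq_div_iff (mul_ne_zero (mul_ne_zero n3 n1) (mul_ne_zero n2 n4))
      (mul_ne_zero (mul_ne_zero n1 (mul_ne_zero n2 n4)) (mul_ne_zero (mul_ne_zero n3 n1) n2))]
  linear_combination a₂ ^ (A + 1) * β ^ (m + 1) *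
    t ^ (s * (A + 1 + 2 * (m + 1)) + ((A + 1 + m).choose 2 + (A + 1 + m))) *
    ((1 - Q * t ^ s) * S₃ * ((1 - y) * S₄)) * (S₁ ^ 2 * S₂ ^ 2 * (1 - Q * c * t ^ (2 * s + A)) *
    (1 - t ^ m * (Q * c * t ^ (2 * s + 2 * (A + 1))))) * hP

/-- Each of the `g k j` with `k + j ≥ n` in terms of the `g (n - i) i`. -/
theorem UpperRec.closed_form {n : ℕ} {t Q a₁ a₂ c d : ℂ} (ht : t ≠ 0) (ha₂ : a₂ ≠ 0)
    (h : ∀ j, j + 2 ≤ 2 * n → Q * c * t ^ j ≠ 1) {g : ℕ → ℕ → ℂ}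
    (hg : UpperRec n t Q a₁ a₂ c d g) (p s : ℕ) (hn : s + p ≤ n) :
    g (n - s) (s + p) = ∑ A ∈ Finset.range (p + 1),
      upperCoeff n t Q a₁ a₂ c d s A (p - A) * g (n - s - A) (s + A) := by
  induction p generalizing s with
  | zero => simp [upperCoeff, shiftedFactorial_zero, gaussBinom]
  | succ p ih =>
    have hD : 1 - Q * c * t ^ (2 * s + p) ≠ 0 := sub_ne_zero.2 (h _ (by omega)).symm
    have h1 := ih s (by omega)
    have h2 := ih (s + 1) (by omega)
    have h3 : (1 - Q * c * t ^ (2 * s + p)) * g (n - s) (s + (p + 1)) =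
        a₂ * t ^ s * (1 - Q * t ^ s) * g (n - (s + 1)) (s + 1 + p) +
        (-Q * a₁⁻¹ * a₂) * t ^ (2 * s + p) * (1 - d * t ^ (n - s - (p + 1))) * g (n - s) (s + p) := by
      have := hg p (n - s - (p + 1)) s (by omega)
      rw [show p + (n - s - (p + 1)) = n - (s + 1) by omega,
        show n - (s + 1) + 1 = n - s by omega] at this
      rw [show s + (p + 1) = s + 1 + p by ring]
      have hts : t ^ s ≠ 0 := pow_ne_zero _ ht
      rw [← mul_left_inj' (inv_ne_zero (mul_ne_zero ha₂ hts))]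
      field_simp at this ⊢
      linear_combination -this
    apply mul_left_cancel₀ hD
    rw [h3, h1, h2, Finset.sum_range_succ' (fun A => upperCoeff n t Q a₁ a₂ c d s A (p - A) *
      g (n - s - A) (s + A)) p, Finset.sum_range_succ' _ (p + 1), Finset.sum_range_succ _ p,
      Finset.sum_range_succ _ p]
    have hz : (1 - Q * c * t ^ (2 * s + p)) * upperCoeff n t Q a₁ a₂ c d s 0 (p + 1) =
        (-Q * a₁⁻¹ * a₂) * t ^ (2 * s + p) * (1 - d * t ^ (n - s - (p + 1))) *
          upperCoeff n t Q a₁ a₂ c d s 0 p :=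
      upperCoeff_zero_succ hn (h _ (by omega))
    have hl : (1 - Q * c * t ^ (2 * s + p)) * upperCoeff n t Q a₁ a₂ c d s (p + 1) 0 =
        a₂ * t ^ s * (1 - Q * t ^ s) * upperCoeff n t Q a₁ a₂ c d (s + 1) p 0 :=
      upperCoeff_succ_zero ht (h _ (by omega))
    have hm : (1 - Q * c * t ^ (2 * s + p)) * ∑ A ∈ Finset.range p,
          upperCoeff n t Q a₁ a₂ c d s (A + 1) (p + 1 - (A + 1)) *
            g (n - s - (A + 1)) (s + (A + 1)) =
        a₂ * t ^ s * (1 - Q * t ^ s) * ∑ A ∈ Finset.range p,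
          upperCoeff n t Q a₁ a₂ c d (s + 1) A (p - A) * g (n - (s + 1) - A) (s + 1 + A) +
        (-Q * a₁⁻¹ * a₂) * t ^ (2 * s + p) * (1 - d * t ^ (n - s - (p + 1))) *
          ∑ A ∈ Finset.range p, upperCoeff n t Q a₁ a₂ c d s (A + 1) (p - (A + 1)) *
            g (n - s - (A + 1)) (s + (A + 1)) := by
      rw [Finset.mul_sum, Finset.mul_sum, Finset.mul_sum, ← Finset.sum_add_distrib]
      refine Finset.sum_congr rfl fun A hA => ?_
      obtain ⟨m, rfl⟩ := Nat.exists_eq_add_of_lt (Finset.mem_range.1 hA)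
      have := upperCoeff_succ_succ (a₁ := a₁) (a₂ := a₂) (d := d) ht (s := s) (A := A) (m := m)
        (by omega) h
      rw [show A + m + 1 + 1 - (A + 1) = m + 1 by omega, show A + m + 1 - A = m + 1 by omega,
        show A + m + 1 - (A + 1) = m by omega, show n - (s + 1) - A = n - s - (A + 1) by omega,
        show s + 1 + A = s + (A + 1) by ring]
      rw [show 2 * s + A + m + 1 = 2 * s + (A + m + 1) by ring,
        show A + m + 2 = A + m + 1 + 1 by ring] at this
      linear_combination g (n - s - (A + 1)) (s + (A + 1)) * this
    rw [show n - (s + 1) - p = n - s - (p + 1) by omega, show s + 1 + p = s + (p + 1) by ring]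
    simp only [Nat.sub_self, Nat.sub_zero] at hm ⊢
    linear_combination -hm - g (n - s) (s + 0) * hz - g (n - s - (p + 1)) (s + (p + 1)) * hl

/-! ### From the recursions to the matrices -/

theorem shiftedFactorial_add (x c : ℂ) (m l : ℕ) :
    shiftedFactorial x c (m + l) = shiftedFactorial x c m * shiftedFactorial (x * c ^ m) c l := by
  unfold shiftedFactorial
  rw [Finset.prod_range_add]
  congr 1
  exact Finset.prod_congr rfl fun i _ => by ring

/-- The parameters for which no denominator in the matrices and in the recursions vanishes. -/
structure Admissible (n : ℕ) (t Q a₁ a₂ b₁ b₂ : ℂ) : Prop where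
  t_ne : t ≠ 0
  Q_ne : Q ≠ 0
  a₁_ne : a₁ ≠ 0
  a₂_ne : a₂ ≠ 0
  b₁_ne : b₁ ≠ 0
  b₂_ne : b₂ ≠ 0
  t_pow : ∀ k : ℕ, 1 ≤ k → k ≤ n → t ^ k ≠ 1
  den₂ : ∀ k : ℕ, k + 2 ≤ 2 * n → Q * a₂ * b₂ * t ^ k ≠ 1
  den₁ : ∀ k : ℕ, k + 2 ≤ 2 * n → Q * a₁ * b₁ * t ^ k ≠ 1
  den : ∀ k : ℕ, n ≤ k + 1 → k + 2 ≤ 2 * n → Q * a₁ * a₂ * b₁ * b₂ * t ^ k ≠ 1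

theorem Admissible.swap {n : ℕ} {t Q a₁ a₂ b₁ b₂ : ℂ} (h : Admissible n t Q a₁ a₂ b₁ b₂) :
    Admissible n t Q a₂ a₁ b₂ b₁ :=
  ⟨h.t_ne, h.Q_ne, h.a₂_ne, h.a₁_ne, h.b₂_ne, h.b₁_ne, h.t_pow, h.den₁, h.den₂, fun k h1 h2 => by
    rw [show Q * a₂ * a₁ * b₂ * b₁ = Q * a₁ * a₂ * b₁ * b₂ by ring]; exact h.den k h1 h2⟩

/-- The solution of `LowerRec` on the line `k + i = n`: it is `g 0` times `L_A` times one
part of the factors of `D_A`. -/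
theorem LowerRec.sum_mul_matLA {n : ℕ} {t Q a₁ a₂ b₁ b₂ : ℂ}
    (h : Admissible n t Q a₁ a₂ b₁ b₂) {g : ℕ → ℕ → ℂ}
    (hg : LowerRec n t Q a₁ (a₂ * b₂) (a₁ * b₁) g) (A : Fin (n + 1)) :
    (∑ i : Fin (n + 1), g 0 i * matLA n Q t a₂ b₂ i A) *
      (a₁ ^ (n - (A : ℕ)) * t ^ c2 (n - A) *
        (shiftedFactorial (Q * a₂ * b₂ * t ^ (2 * (A : ℕ))) t (n - A) /
          shiftedFactorial (Q * a₁ * a₂ * b₁ * b₂ * t ^ ((n : ℤ) + A - 1)) t (n - A))) =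
      g (n - A) A := by
  obtain ⟨A, hA⟩ := A
  obtain ⟨k, rfl⟩ := Nat.exists_eq_add_of_le (Nat.lt_succ_iff.1 hA)
  have hcl := hg.closed_form k A 0 (by omega)
  simp only [Nat.add_sub_cancel_left]
  have hX : shiftedFactorial (Q * (a₂ * b₂) * (a₁ * b₁) * t ^ (2 * (A + k) - k - 1)) t k =
      shiftedFactorial (Q * a₁ * a₂ * b₁ * b₂ * t ^ (((A + k : ℕ) : ℤ) + A - 1)) t k := by
    rcases k with _ | k
    · simp [shiftedFactorial_zero]
    · rw [← zpow_natCast t (2 * (A + (k + 1)) - (k + 1) - 1),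
        show (((2 * (A + (k + 1)) - (k + 1) - 1 : ℕ)) : ℤ) = ((A + (k + 1) : ℕ) : ℤ) + A - 1 by omega]
      congr 1
      ring
  have hX0 : shiftedFactorial (Q * a₁ * a₂ * b₁ * b₂ * t ^ (((A + k : ℕ) : ℤ) + A - 1)) t k ≠ 0 := by
    rw [← hX]
    refine shiftedFactorial_ne_zero fun i hi => ?_
    rw [mul_assoc, ← pow_add]
    have := h.den (2 * (A + k) - k - 1 + i) (by omega) (by omega)
    rwa [show Q * a₁ * a₂ * b₁ * b₂ = Q * (a₂ * b₂) * (a₁ * b₁) by ring] at this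
  rw [hX] at hcl
  rw [← mul_right_inj' hX0, hcl]
  have hs : ∑ i : Fin (A + k + 1), g 0 i * matLA (A + k) Q t a₂ b₂ i ⟨A, hA⟩ =
      ∑ m ∈ Finset.range (k + 1), g 0 (A + m) *
        ((-1) ^ m * t ^ (c2 (k - m) - c2 k) * cBinom k (k - m) t *
        (shiftedFactorial (a₂ * b₂ * t ^ A) t m /
          shiftedFactorial (Q * a₂ * b₂ * t ^ (2 * A)) t m)) := by
    simp only [matLA, Matrix.of_apply, Fin.le_def]
    rw [Finset.sum_range (n := k + 1)]
    rw [Fin.sum_univ_eq_sum_range (fun i => g 0 i * (if A ≤ i then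
      (-1) ^ (i - A) * t ^ (c2 (A + k - i) - c2 (A + k - A)) * cBinom (A + k - A) (A + k - i) t *
        (shiftedFactorial (a₂ * b₂ * t ^ A) t (i - A) /
          shiftedFactorial (Q * a₂ * b₂ * t ^ (2 * A)) t (i - A)) else 0)) (A + k + 1),
      add_assoc A k 1, Finset.sum_range_add,
      Finset.sum_eq_zero (fun i hi => by
        rw [if_neg (by have := Finset.mem_range.1 hi; omega), mul_zero]), zero_add,
      Finset.sum_range (n := k + 1)]
    refine Finset.sum_congr rfl fun m _ => ?_
    rw [if_pos (by omega), Nat.add_sub_cancel_left, Nat.add_sub_cancel_left, Nat.add_sub_add_left]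
  rw [hs, Finset.sum_mul, Finset.mul_sum]
  refine Finset.sum_congr rfl fun m hm => ?_
  obtain ⟨l, rfl⟩ := Nat.exists_eq_add_of_le (Nat.lt_succ_iff.1 (Finset.mem_range.1 hm))
  have hS : shiftedFactorial (Q * a₂ * b₂ * t ^ (2 * A)) t m ≠ 0 := by
    refine shiftedFactorial_ne_zero fun i hi => ?_
    rw [mul_assoc, ← pow_add]
    exact h.den₂ _ (by omega)
  have hB : cBinom (m + l) l t = gaussBinom t (m + l) m := by
    rw [cBinom_symm]
    exact cBinom_eq_gaussBinom fun k h1 h2 => h.t_pow k h1 (by omega)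
  have hT : t ^ (c2 l - c2 (m + l)) * t ^ c2 (m + l) = t ^ l.choose 2 := by
    rw [← zpow_add₀ h.t_ne, sub_add_cancel, c2, zpow_natCast]
  rw [Nat.add_sub_cancel_left, hB, lowerCoeff, Nat.add_sub_cancel_left,
    shiftedFactorial_add (Q * a₂ * b₂ * t ^ (2 * A)) t m l]
  rw [show Q * a₂ * b₂ * t ^ (2 * A) * t ^ m = Q * (a₂ * b₂) * t ^ (0 + 2 * A + m) by ring, zero_mul,
    zero_add, zero_add, ← hT]
  field_simp

/-- The solution of `UpperRec` for `k = n`: it is obtained from the values on the line `k + i = n`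
by the remaining factors of `D_A`, and `U_A`. -/
theorem UpperRec.sum_mul_matUA {n : ℕ} {t Q a₁ a₂ b₁ b₂ : ℂ}
    (h : Admissible n t Q a₁ a₂ b₁ b₂) {g : ℕ → ℕ → ℂ}
    (hg : UpperRec n t Q a₁ a₂ (a₂ * b₂) (a₁ * b₁) g) (j : Fin (n + 1)) :
    ∑ A : Fin (n + 1), g (n - A) A * (a₂ ^ (A : ℕ) * t ^ c2 A * (shiftedFactorial Q t A /
        shiftedFactorial (Q * a₂ * b₂ * t ^ ((A : ℤ) - 1)) t A)) *
      matUA n Q t a₁ a₂ b₁ b₂ A j = g n j := by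
  obtain ⟨j, hj⟩ := j
  have hcl := hg.closed_form h.t_ne h.a₂_ne (fun k hk => by
    rw [← mul_assoc]; exact h.den₂ k hk) j 0 (by omega)
  simp only [Nat.sub_zero, zero_add] at hcl
  rw [hcl]
  simp only [matUA, Matrix.of_apply, Fin.le_def]
  rw [Fin.sum_univ_eq_sum_range (fun A => g (n - A) A * (a₂ ^ A * t ^ c2 A * (shiftedFactorial Q t A /
        shiftedFactorial (Q * a₂ * b₂ * t ^ ((A : ℤ) - 1)) t A)) *
      (if A ≤ j then (-Q * a₁⁻¹ * a₂) ^ (j - A) * t ^ (c2 j - c2 A) * cBinom j A t *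
        (shiftedFactorial (a₁ * b₁ * t ^ (n - j)) t (j - A) /
          shiftedFactorial (Q * a₂ * b₂ * t ^ (2 * A)) t (j - A)) else 0)) (n + 1),
    ← Finset.sum_subset (Finset.range_subset_range.2 hj) (fun A _ hA => by
      rw [if_neg (by simpa using hA), mul_zero])]
  refine Finset.sum_congr rfl fun A hA => ?_
  have hA' := Finset.mem_range.1 hA
  rw [if_pos (by omega)]
  obtain ⟨m, rfl⟩ := Nat.exists_eq_add_of_le (Nat.lt_succ_iff.1 hA')
  have hB : cBinom (A + m) A t = gaussBinom t (A + m) m := by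
    rw [← cBinom_symm, add_comm]
    exact cBinom_eq_gaussBinom fun k h1 h2 => h.t_pow k h1 (by omega)
  have hT : t ^ c2 A * t ^ (c2 (A + m) - c2 A) = t ^ (A + m).choose 2 := by
    rw [← zpow_add₀ h.t_ne, add_sub_cancel, c2, zpow_natCast]
  rw [Nat.add_sub_cancel_left, hB, upperCoeff]
  simp only [Nat.cast_zero, mul_zero, zero_mul, zero_add, pow_zero, mul_one, Nat.sub_zero]
  rw [← hT, mul_assoc Q a₂ b₂]
  ring

/-- A family that satisfies both recursions transforms from `k = 0` to `k = n` by the matrix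
`L_A D_A U_A`. -/
theorem eq_sum_mul_gauss {n : ℕ} {t Q a₁ a₂ b₁ b₂ : ℂ}
    (h : Admissible n t Q a₁ a₂ b₁ b₂) {g : ℕ → ℕ → ℂ}
    (hl : LowerRec n t Q a₁ (a₂ * b₂) (a₁ * b₁) g)
    (hu : UpperRec n t Q a₁ a₂ (a₂ * b₂) (a₁ * b₁) g) (j : Fin (n + 1)) :
    g n j = ∑ i : Fin (n + 1), g 0 i *
      (matLA n Q t a₂ b₂ * matDA n Q t a₁ a₂ b₁ b₂ * matUA n Q t a₁ a₂ b₁ b₂) i j := by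
  rw [← hu.sum_mul_matUA h j]
  have hM : ∀ i, (matLA n Q t a₂ b₂ * matDA n Q t a₁ a₂ b₁ b₂ * matUA n Q t a₁ a₂ b₁ b₂) i j = _ :=
    fun i => Matrix.mul_apply
  simp only [hM]
  simp only [matDA, Matrix.mul_diagonal, Finset.mul_sum]
  rw [Finset.sum_comm]
  refine Finset.sum_congr rfl fun A _ => ?_
  rw [← hl.sum_mul_matLA h A, Finset.sum_mul, Finset.sum_mul, Finset.sum_mul]
  refine Finset.sum_congr rfl fun i _ => ?_
  rw [zpow_add₀ h.t_ne]
  ring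

/-! ### Word functionals -/

/-- The letters of the words below. With `A(z) = 1 - a₁⁻¹ z` and `B(z) = 1 - b₂ z` they stand for
the one-variable polynomials `A`, `B`, `z A`, `z B`. -/
inductive Letter
  | a | b | za | zb

open Letter List

/-- A linear functional with the two kinds of properties that produce the recursions: a word
`g_1 ⋯ g_n` stands for the antisymmetrization of `∏ g_j(z_j) ∏_{k<l} (z_k - t⁻¹ z_l)`. The
relation `B = A + a₁⁻¹ z B - b₂ z A` holds at every position (`subst`), a factor `z` may be moved
across an equal letter (`swap_a`, `swap_b`), and the last letter `A(z)(1 - a₂⁻¹ z)` may be replaced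
by the first letter `B(z)(1 - b₁ z)` (`cyc`). -/
structure IsWordFunctional (n : ℕ) (t Q a₁ a₂ b₁ b₂ : ℂ) (Λ : List Letter → ℂ) : Prop where
  subst : ∀ u v : List Letter, u.length + 1 + v.length = n →
    Λ (u ++ b :: v) = Λ (u ++ a :: v) + a₁⁻¹ * Λ (u ++ zb :: v) - b₂ * Λ (u ++ za :: v)
  swap_a : ∀ u v : List Letter, u.length + 2 + v.length = n →
    t * Λ (u ++ a :: za :: v) = Λ (u ++ za :: a :: v)
  swap_b : ∀ u v : List Letter, u.length + 2 + v.length = n →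
    t * Λ (u ++ b :: zb :: v) = Λ (u ++ zb :: b :: v)
  cyc : ∀ w : List Letter, w.length + 1 = n →
    Λ (w ++ [a]) - a₂⁻¹ * Λ (w ++ [za]) = Q * t ^ w.length * (Λ (b :: w) - b₁ * Λ (zb :: w))

theorem replicate_append_cons {α : Type*} (k : ℕ) (x : α) (v : List α) :
    replicate k x ++ x :: v = replicate (k + 1) x ++ v := by
  rw [replicate_succ', append_assoc, singleton_append]

section Moves

variable {n : ℕ} {t : ℂ} {Λ : List Letter → ℂ} {x y : Letter}

theorem pow_mul_move_left
    (h : ∀ u v : List Letter, u.length + 2 + v.length = n →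
      t * Λ (u ++ x :: y :: v) = Λ (u ++ y :: x :: v)) (m : ℕ) (u v : List Letter)
    (hn : u.length + m + 1 + v.length = n) :
    t ^ m * Λ (u ++ (replicate m x ++ y :: v)) = Λ (u ++ y :: (replicate m x ++ v)) := by
  induction m generalizing v with
  | zero => simp
  | succ m ih =>
    have h1 := h (u ++ replicate m x) v (by simp; omega)
    have h2 := ih (x :: v) (by simp; omega)
    simp only [append_assoc, replicate_append_cons] at h1 h2 ⊢
    rw [← h2, ← h1, ← replicate_append_cons]
    ring

theorem pow_mul_move_right
    (h : ∀ u v : List Letter, u.length + 2 + v.length = n →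
      t * Λ (u ++ x :: y :: v) = Λ (u ++ y :: x :: v)) (m : ℕ) (u v : List Letter)
    (hn : u.length + m + 1 + v.length = n) :
    t ^ m * Λ (u ++ x :: (replicate m y ++ v)) = Λ (u ++ (replicate m y ++ x :: v)) := by
  induction m generalizing u with
  | zero => simp
  | succ m ih =>
    have h1 := h u (replicate m y ++ v) (by simp; omega)
    have h2 := ih (u ++ [y]) (by simp; omega)
    simp only [append_assoc, replicate_succ, cons_append, nil_append] at h1 h2 ⊢
    rw [← h2, ← h1]
    ring

end Moves

/-- The word of `z_1 ⋯ z_k e_i`. -/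
def frontWord (n k i : ℕ) : List Letter :=
  replicate (min k (n - i)) zb ++ (replicate (n - i - k) b ++
    (replicate (k + i - n) za ++ replicate (min i (n - k)) a))

/-- The word of `z_(n-k+1) ⋯ z_n e_i`. -/
def backWord (n k i : ℕ) : List Letter :=
  replicate (min (n - i) (n - k)) b ++ (replicate (k - i) zb ++
    (replicate (i - k) a ++ replicate (min i k) za))

theorem frontWord_lower (k i r : ℕ) :
    frontWord (k + i + r) k i = replicate k zb ++ (replicate r b ++ replicate i a) := by
  simp [frontWord, show k + i + r - i = k + r by omega, show k + i - (k + i + r) = 0 by omega,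
    show k + i + r - k = i + r by omega]

theorem frontWord_upper (p l s : ℕ) :
    frontWord (p + l + s) (p + l) (s + p) =
      replicate l zb ++ (replicate p za ++ replicate s a) := by
  simp [frontWord, show p + l + s - (s + p) = l by omega, show l - (p + l) = 0 by omega,
    show p + l + (s + p) - (p + l + s) = p by omega, show p + l + s - (p + l) = s by omega]

theorem backWord_lower (k i r : ℕ) :
    backWord (k + i + r) k (k + r) = replicate i b ++ (replicate r a ++ replicate k za) := by
  simp [backWord, show k + i + r - (k + r) = i by omega, show k + i + r - k = i + r by omega]

theorem backWord_upper (p l s : ℕ) :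
    backWord (p + l + s) (p + l) l = replicate s b ++ (replicate p zb ++ replicate l za) := by
  simp [backWord, show p + l + s - l = p + s by omega, show p + l + s - (p + l) = s by omega,
    show l - (p + l) = 0 by omega]

section Recursions

variable {n : ℕ} {t Q a₁ a₂ b₁ b₂ : ℂ} {Λ : List Letter → ℂ}

/-- One circuit gives the recursion: a letter `b` at the border of the blocks is expanded by
`subst`, the new letters `za` and `zb` are moved to the ends by `swap_a` and `swap_b`, and `cyc`
connects the two ends. The other three recursions arise in the same way. -/
theorem IsWordFunctional.lowerRec (h : IsWordFunctional n t Q a₁ a₂ b₁ b₂ Λ)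
    (ha₁ : a₁ ≠ 0) (ha₂ : a₂ ≠ 0) :
    LowerRec n t Q a₁ (a₂ * b₂) (a₁ * b₁) fun k i => Λ (frontWord n k i) := by
  intro k i r hn
  have e1 : frontWord n k i = replicate k zb ++ (b :: (replicate r b ++ replicate i a)) := by
    rw [show n = k + i + (r + 1) by omega, frontWord_lower, replicate_succ, cons_append]
  have e2 : frontWord n (k + 1) i = zb :: (replicate k zb ++ (replicate r b ++ replicate i a)) := by
    rw [show n = k + 1 + i + r by omega, frontWord_lower, replicate_succ, cons_append]
  have e3 : frontWord n k (i + 1) =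
      replicate k zb ++ (replicate r b ++ a :: replicate i a) := by
    rw [show n = k + (i + 1) + r by omega, frontWord_lower, replicate_succ]
  have hc := h.cyc (replicate k zb ++ (replicate r b ++ replicate i a)) (by simp; omega)
  have m1 := pow_mul_move_left h.swap_a i (replicate k zb ++ replicate r b) [] (by simp; omega)
  have m2 := pow_mul_move_left h.swap_b r (replicate k zb) (replicate i a) (by simp; omega)
  have m3 := pow_mul_move_right h.swap_b k [] (replicate r b ++ replicate i a) (by simp; omega)
  have hs := h.subst (replicate k zb ++ replicate r b) (replicate i a) (by simp; omega)
  simp only [append_assoc, append_nil, nil_append, length_append, length_replicate] at hc m1 m2 m3 hs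
  rw [← replicate_succ'] at hc
  rw [replicate_append_cons, replicate_succ, cons_append] at hs
  rw [replicate_append_cons, replicate_succ, cons_append] at m2
  simp only [e1, e2, e3]
  rw [replicate_succ] at hc
  field_simp at hc hs
  linear_combination -(b₂ * t ^ (i + r) * a₁) * hc - b₂ * a₁ * a₂ * Q * t ^ (2 * i + 2 * r) * m3 -
    a₁ * b₂ * t ^ r * m1 - t ^ r * hs - m2

theorem IsWordFunctional.upperRec (h : IsWordFunctional n t Q a₁ a₂ b₁ b₂ Λ)
    (ht : t ≠ 0) (ha₁ : a₁ ≠ 0) (ha₂ : a₂ ≠ 0) :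
    UpperRec n t Q a₁ a₂ (a₂ * b₂) (a₁ * b₁) fun k i => Λ (frontWord n k i) := by
  intro p l s hn
  have e1 : frontWord n (p + l) (s + 1 + p) =
      replicate l zb ++ (replicate p za ++ a :: replicate s a) := by
    rw [show n = p + l + (s + 1) by omega, frontWord_upper, replicate_succ]
  have e2 : frontWord n (p + l + 1) (s + 1 + p) =
      replicate l zb ++ (za :: (replicate p za ++ replicate s a)) := by
    rw [show n = p + 1 + l + s by omega, show p + l + 1 = p + 1 + l by ring,
      show s + 1 + p = s + (p + 1) by ring, frontWord_upper, replicate_succ, cons_append]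
  have e3 : frontWord n (p + l + 1) (s + p) =
      zb :: (replicate l zb ++ (replicate p za ++ replicate s a)) := by
    rw [show n = p + (l + 1) + s by omega, show p + l + 1 = p + (l + 1) by ring,
      frontWord_upper, replicate_succ, cons_append]
  have hc := h.cyc (replicate l zb ++ (replicate p za ++ replicate s a)) (by simp; omega)
  have m1 := pow_mul_move_left h.swap_a s (replicate l zb ++ replicate p za) [] (by simp; omega)
  have m2 := pow_mul_move_right h.swap_b l [] (replicate p za ++ replicate s a) (by simp; omega)
  have m3 := pow_mul_move_right h.swap_a p (replicate l zb) (replicate s a) (by simp; omega)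
  have hs := h.subst (replicate l zb) (replicate p za ++ replicate s a) (by simp; omega)
  simp only [append_assoc, append_nil, nil_append, length_append, length_replicate] at hc m1 m2 m3 hs
  rw [← replicate_succ', replicate_succ] at hc
  rw [replicate_append_cons l, replicate_succ, cons_append] at hs
  rw [replicate_append_cons p, replicate_succ, cons_append] at m1
  simp only [e1, e2, e3]
  have hts : t ^ s ≠ 0 := pow_ne_zero _ ht
  field_simp at hc hs ⊢
  linear_combination a₁ * t ^ s * hc + a₁ * m1 + a₁ * a₂ * Q * t ^ (2 * s + p) * m2 +
    a₂ * Q * t ^ (2 * s + p) * hs + a₁ * a₂ * Q * t ^ (2 * s) * m3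

/-- The factor that turns the recursions of `z_(n-k+1) ⋯ z_n e_(n-i)` into those of
`z_1 ⋯ z_k e_i` with `(a₁, b₁)` and `(a₂, b₂)` exchanged. -/
def backScale (n : ℕ) (t Q : ℂ) (k i : ℕ) : ℂ :=
  Q ^ i * t ^ ((n - 1) * i + k * (n - i - k) + (n - k) * (i + k - n))

theorem backScale_lower (k i r : ℕ) : backScale (k + i + r) t Q k i =
    Q ^ i * t ^ ((k + i + r - 1) * i + k * r) := by
  simp [backScale, show k + i + r - i - k = r by omega, show i + k - (k + i + r) = 0 by omega]

theorem backScale_upper (p l s : ℕ) : backScale (p + l + s) t Q (p + l) (s + p) =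
    Q ^ (s + p) * t ^ ((p + l + s - 1) * (s + p) + s * p) := by
  simp [backScale, show p + l + s - (s + p) - (p + l) = 0 by omega,
    show s + p + (p + l) - (p + l + s) = p by omega, show p + l + s - (p + l) = s by omega]

theorem IsWordFunctional.lowerRec_back (h : IsWordFunctional n t Q a₁ a₂ b₁ b₂ Λ)
    (ha₁ : a₁ ≠ 0) (ha₂ : a₂ ≠ 0) :
    LowerRec n t Q a₂ (a₁ * b₁) (a₂ * b₂)
      fun k i => backScale n t Q k i * Λ (backWord n k (n - i)) := by
  intro k i r hn
  have e1 : backWord n k (n - i) = replicate i b ++ (a :: (replicate r a ++ replicate k za)) := by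
    rw [show n - i = k + (r + 1) by omega, show n = k + i + (r + 1) by omega, backWord_lower,
      replicate_succ, cons_append]
  have e2 : backWord n (k + 1) (n - i) =
      replicate i b ++ (replicate r a ++ za :: replicate k za) := by
    rw [show n - i = k + 1 + r by omega, show n = k + 1 + i + r by omega, backWord_lower,
      replicate_succ]
  have e3 : backWord n k (n - (i + 1)) =
      b :: (replicate i b ++ (replicate r a ++ replicate k za)) := by
    rw [show n - (i + 1) = k + r by omega, show n = k + (i + 1) + r by omega, backWord_lower,
      replicate_succ, cons_append]
  have s1 : backScale n t Q k i = Q ^ i * t ^ ((k + i + r) * i + k * (r + 1)) := by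
    rw [show n = k + i + (r + 1) by omega, backScale_lower]; rfl
  have s2 : backScale n t Q (k + 1) i = Q ^ i * t ^ ((k + i + r) * i + (k + 1) * r) := by
    rw [show n = k + 1 + i + r by omega, backScale_lower,
      show k + 1 + i + r - 1 = k + i + r by omega]
  have s3 : backScale n t Q k (i + 1) = Q ^ (i + 1) * t ^ ((k + i + r) * (i + 1) + k * r) := by
    rw [show n = k + (i + 1) + r by omega, backScale_lower,
      show k + (i + 1) + r - 1 = k + i + r by omega]
  have hc := h.cyc (replicate i b ++ (replicate r a ++ replicate k za)) (by simp; omega)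
  have m1 := pow_mul_move_right h.swap_a k (replicate i b ++ replicate r a) [] (by simp; omega)
  have m2 := pow_mul_move_left h.swap_b i [] (replicate r a ++ replicate k za) (by simp; omega)
  have m3 := pow_mul_move_left h.swap_a r (replicate i b) (replicate k za) (by simp; omega)
  have hs := h.subst (replicate i b) (replicate r a ++ replicate k za) (by simp; omega)
  simp only [append_assoc, append_nil, nil_append, length_append, length_replicate] at hc m1 m2 m3 hs
  rw [← replicate_succ', replicate_succ] at hc
  rw [replicate_append_cons i, replicate_succ, cons_append] at hs
  rw [replicate_append_cons r, replicate_succ, cons_append] at m1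
  simp only [e1, e2, e3, s1, s2, s3]
  field_simp at hc hs
  linear_combination Q ^ i * t ^ (k * i + k * r + i * r + i ^ 2 + r) * (-hc - a₂ * m1 -
    a₂ * Q * b₁ * t ^ (i + r + k) * m2 - Q * a₂ * b₁ * t ^ (k + 2 * i + r) * hs -
    Q * a₂ * b₁ * a₁ * b₂ * t ^ (k + 2 * i + r) * m3)

theorem IsWordFunctional.upperRec_back (h : IsWordFunctional n t Q a₁ a₂ b₁ b₂ Λ)
    (ht : t ≠ 0) (ha₁ : a₁ ≠ 0) (ha₂ : a₂ ≠ 0) :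
    UpperRec n t Q a₂ a₁ (a₁ * b₁) (a₂ * b₂)
      fun k i => backScale n t Q k i * Λ (backWord n k (n - i)) := by
  intro p l s hn
  have e1 : backWord n (p + l) (n - (s + 1 + p)) =
      b :: (replicate s b ++ (replicate p zb ++ replicate l za)) := by
    rw [show n - (s + 1 + p) = l by omega, show n = p + l + (s + 1) by omega, backWord_upper,
      replicate_succ, cons_append]
  have e2 : backWord n (p + l + 1) (n - (s + 1 + p)) =
      replicate s b ++ (zb :: (replicate p zb ++ replicate l za)) := by
    rw [show n - (s + 1 + p) = l by omega, show n = p + 1 + l + s by omega,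
      show p + l + 1 = p + 1 + l by ring, backWord_upper, replicate_succ, cons_append]
  have e3 : backWord n (p + l + 1) (n - (s + p)) =
      replicate s b ++ (replicate p zb ++ za :: replicate l za) := by
    rw [show n - (s + p) = l + 1 by omega, show n = p + (l + 1) + s by omega,
      show p + l + 1 = p + (l + 1) by ring, backWord_upper, replicate_succ]
  have s1 : backScale n t Q (p + l) (s + 1 + p) =
      Q ^ (s + 1 + p) * t ^ ((p + l + s) * (s + 1 + p) + (s + 1) * p) := by
    rw [show n = p + l + (s + 1) by omega, backScale_upper]; rfl
  have s2 : backScale n t Q (p + l + 1) (s + 1 + p) =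
      Q ^ (s + 1 + p) * t ^ ((p + l + s) * (s + 1 + p) + s * (p + 1)) := by
    rw [show n = p + 1 + l + s by omega, show p + l + 1 = p + 1 + l by ring,
      show s + 1 + p = s + (p + 1) by ring, backScale_upper,
      show p + 1 + l + s - 1 = p + l + s by omega]
  have s3 : backScale n t Q (p + l + 1) (s + p) =
      Q ^ (s + p) * t ^ ((p + l + s) * (s + p) + s * p) := by
    rw [show n = p + (l + 1) + s by omega, show p + l + 1 = p + (l + 1) by ring, backScale_upper,
      show p + (l + 1) + s - 1 = p + l + s by omega]
  have hc := h.cyc (replicate s b ++ (replicate p zb ++ replicate l za)) (by simp; omega)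
  have m1 := pow_mul_move_right h.swap_a l (replicate s b ++ replicate p zb) [] (by simp; omega)
  have m2 := pow_mul_move_left h.swap_b s [] (replicate p zb ++ replicate l za) (by simp; omega)
  have m3 := pow_mul_move_right h.swap_b p (replicate s b) (replicate l za) (by simp; omega)
  have hs := h.subst (replicate s b ++ replicate p zb) (replicate l za) (by simp; omega)
  simp only [append_assoc, append_nil, nil_append, length_append, length_replicate] at hc m1 m2 m3 hs
  rw [replicate_append_cons s, replicate_succ, cons_append] at m3
  rw [← replicate_succ', replicate_succ] at hc
  rw [replicate_append_cons p zb, replicate_succ, cons_append] at hs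
  simp only [e1, e2, e3, s1, s2, s3]
  have hts : t ^ s ≠ 0 := pow_ne_zero _ ht
  field_simp at hc hs ⊢
  linear_combination Q ^ (s + p + 1) * t ^ ((p + l + s) * (s + p) + s * p + 2 * s + p) *
    (a₁ * hc + a₁ * a₂ * Q * b₁ * t ^ (s + p + l) * m2 + a₁ * a₂ * m1 + a₁ * a₂ * t ^ l * m3 +
      a₂ * t ^ l * hs)

end Recursions

/-! ### The two decompositions for a word functional -/

section Decompositions

open Letter List

theorem two_mul_c2 (k : ℕ) : 2 * c2 k = k * (k - 1) := by
  induction k with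
  | zero => simp [c2]
  | succ k ih =>
    simp only [c2, choose_two_succ] at ih ⊢
    push_cast at ih ⊢
    linear_combination ih

theorem c2_sub_c2 {n i j : ℕ} (hi : i ≤ n) (hj : j ≤ n) :
    c2 (n - i) - c2 (n - j) = (n - 1) * ((j : ℤ) - i) + (c2 i - c2 j) := by
  have h1 := two_mul_c2 (n - i)
  have h2 := two_mul_c2 (n - j)
  have h3 := two_mul_c2 i
  have h4 := two_mul_c2 j
  push_cast [hi, hj] at h1 h2
  have : (2 : ℤ) * (c2 (n - i) - c2 (n - j)) = 2 * ((n - 1) * ((j : ℤ) - i) + (c2 i - c2 j)) := by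
    linear_combination h1 - h2 - h3 + h4
  linarith

section Reflection

variable {n : ℕ} {t Q a₁ a₂ b₁ b₂ : ℂ}

/-- The reversal `i ↦ n - i` with the exchange of `(a₁, b₁)` and `(a₂, b₂)` turns `L_A`, `D_A`,
`U_A` into `U'_A`, `D'_A`, `L'_A`, up to conjugation by the powers of `Q t^(n-1)`. -/
theorem matUA'_eq (ht : t ≠ 0) (hQ : Q ≠ 0) (i j : Fin (n + 1)) :
    matUA' n Q t a₁ b₁ i j = (Q * t ^ ((n : ℤ) - 1)) ^ (n - (i : ℕ)) *
      matLA n Q t a₁ b₁ i.rev j.rev * ((Q * t ^ ((n : ℤ) - 1)) ^ (n - (j : ℕ)))⁻¹ := by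
  obtain ⟨i, hi⟩ := i
  obtain ⟨j, hj⟩ := j
  simp only [matUA', matLA, Matrix.of_apply, Fin.le_def, Fin.val_rev]
  by_cases h : i ≤ j
  · rw [if_pos h, if_pos (by omega)]
    have hR : Q * t ^ ((n : ℤ) - 1) ≠ 0 := mul_ne_zero hQ (zpow_ne_zero _ ht)
    have e : (Q * t ^ ((n : ℤ) - 1)) ^ (n - i) = (Q * t ^ ((n : ℤ) - 1)) ^ (j - i) *
        (Q * t ^ ((n : ℤ) - 1)) ^ (n - j) := by rw [← pow_add]; congr 1; omega
    rw [eq_mul_inv_iff_mul_eq₀ (pow_ne_zero _ hR), e]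
    rw [show n + 1 - (i + 1) = n - i by omega, show n + 1 - (j + 1) = n - j by omega,
      show n - i - (n - j) = j - i by omega, show n - (n - i) = i by omega,
      show n - (n - j) = j by omega, c2_sub_c2 (by omega) (by omega), zpow_add₀ ht, zpow_mul,
      show ((j : ℤ) - i) = ((j - i : ℕ) : ℤ) by omega, zpow_natCast, mul_pow, neg_pow Q]
    ring
  · rw [if_neg h, if_neg (by omega)]; simp

theorem matDA'_eq (j : Fin (n + 1)) :
    matDA' n Q t a₁ a₂ b₁ b₂ j j = matDA n Q t a₂ a₁ b₂ b₁ j.rev j.rev := by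
  obtain ⟨j, hj⟩ := j
  simp only [matDA', matDA, Matrix.diagonal_apply_eq, Fin.val_rev]
  rw [show n + 1 - (j + 1) = n - j by omega, show n - (n - j) = j by omega,
    show ((n - j : ℕ) : ℤ) = n - j by omega, show (n : ℤ) + (n - j) - 1 = 2 * n - j - 1 by ring,
    add_comm (c2 (n - j)), mul_comm (a₂ ^ j), mul_comm (shiftedFactorial Q t (n - j)),
    mul_comm (shiftedFactorial (Q * a₁ * b₁ * t ^ ((n : ℤ) - j - 1)) t (n - j)),
    show Q * a₂ * a₁ * b₂ * b₁ = Q * a₁ * a₂ * b₁ * b₂ by ring]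

theorem matLA'_eq (ht : t ≠ 0) (hQ : Q ≠ 0) (i j : Fin (n + 1)) :
    matLA' n Q t a₁ a₂ b₁ b₂ i j = (Q * t ^ ((n : ℤ) - 1)) ^ (n - (i : ℕ)) *
      matUA n Q t a₂ a₁ b₂ b₁ i.rev j.rev * ((Q * t ^ ((n : ℤ) - 1)) ^ (n - (j : ℕ)))⁻¹ := by
  obtain ⟨i, hi⟩ := i
  obtain ⟨j, hj⟩ := j
  simp only [matLA', matUA, Matrix.of_apply, Fin.le_def, Fin.val_rev]
  by_cases h : j ≤ i
  · rw [if_pos h, if_pos (by omega)]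
    have hR : Q * t ^ ((n : ℤ) - 1) ≠ 0 := mul_ne_zero hQ (zpow_ne_zero _ ht)
    have e : (Q * t ^ ((n : ℤ) - 1)) ^ (n - j) = (Q * t ^ ((n : ℤ) - 1)) ^ (i - j) *
        (Q * t ^ ((n : ℤ) - 1)) ^ (n - i) := by rw [← pow_add]; congr 1; omega
    have e2 : (t : ℂ) ^ (((n : ℤ) - 1) * ((i : ℤ) - j)) = (t ^ ((n : ℤ) - 1)) ^ (i - j) := by
      rw [show ((i : ℤ) - j) = ((i - j : ℕ) : ℤ) by omega, zpow_mul, zpow_natCast]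
    have hT : t ^ ((n : ℤ) - 1) ≠ 0 := zpow_ne_zero _ ht
    rw [e, mul_inv, ← mul_assoc, eq_mul_inv_iff_mul_eq₀ (pow_ne_zero _ hR),
      eq_mul_inv_iff_mul_eq₀ (pow_ne_zero _ hR)]
    rw [show n + 1 - (i + 1) = n - i by omega, show n + 1 - (j + 1) = n - j by omega,
      show n - j - (n - i) = i - j by omega,
      show n - (n - j) = j by omega, c2_sub_c2 (by omega) (by omega), zpow_add₀ ht, e2,
      mul_pow Q, show -Q * a₂⁻¹ * a₁ = Q * (-a₁ * a₂⁻¹) by ring, mul_pow Q (-a₁ * a₂⁻¹)]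
    ring
  · rw [if_neg h, if_neg (by omega)]; simp

end Reflection

section Gauss

variable {n : ℕ} {t Q a₁ a₂ b₁ b₂ : ℂ} {Λ : List Letter → ℂ}

/-- The word of `z_1 ⋯ z_n e_j` in terms of those of the `e_i`, by the matrix `L_A D_A U_A`. -/
theorem IsWordFunctional.gauss (h : IsWordFunctional n t Q a₁ a₂ b₁ b₂ Λ)
    (hp : Admissible n t Q a₁ a₂ b₁ b₂) (j : Fin (n + 1)) :
    Λ (replicate (n - (j : ℕ)) zb ++ replicate (j : ℕ) za) =
      ∑ i : Fin (n + 1), Λ (replicate (n - (i : ℕ)) b ++ replicate (i : ℕ) a) *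
      (matLA n Q t a₂ b₂ * matDA n Q t a₁ a₂ b₁ b₂ * matUA n Q t a₁ a₂ b₁ b₂) i j := by
  have := eq_sum_mul_gauss hp (h.lowerRec hp.a₁_ne hp.a₂_ne)
    (h.upperRec hp.t_ne hp.a₁_ne hp.a₂_ne) j
  simpa [frontWord, show ∀ i : Fin (n + 1), (i : ℕ) - n = 0 from fun i => by omega,
    show ∀ i : Fin (n + 1), n - (i : ℕ) - n = 0 from fun i => by omega,
    show ∀ i : Fin (n + 1), min (i : ℕ) n = i from fun i => by omega] using this

/-- The word of `z_1 ⋯ z_n e_j` in terms of those of the `e_i`, by the matrix `U'_A D'_A L'_A`: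
the factors `z` are attached from the right end, where `IsWordFunctional.gauss` attaches them from
the left end. -/
theorem IsWordFunctional.gauss' (h : IsWordFunctional n t Q a₁ a₂ b₁ b₂ Λ)
    (hp : Admissible n t Q a₁ a₂ b₁ b₂) (j : Fin (n + 1)) :
    Λ (replicate (n - (j : ℕ)) zb ++ replicate (j : ℕ) za) =
      ∑ i : Fin (n + 1), Λ (replicate (n - (i : ℕ)) b ++ replicate (i : ℕ) a) *
      (matUA' n Q t a₁ b₁ * matDA' n Q t a₁ a₂ b₁ b₂ * matLA' n Q t a₁ a₂ b₁ b₂) i j := by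
  have ht := hp.t_ne
  have hQ := hp.Q_ne
  have key := eq_sum_mul_gauss hp.swap (h.lowerRec_back hp.a₁_ne hp.a₂_ne)
    (h.upperRec_back hp.t_ne hp.a₁_ne hp.a₂_ne) j.rev
  have hR : Q * t ^ ((n : ℤ) - 1) ≠ 0 := mul_ne_zero hQ (zpow_ne_zero _ ht)
  have hs : ∀ i : ℕ, i ≤ n →
      backScale n t Q n i = (Q * t ^ ((n : ℤ) - 1)) ^ i ∧
      backScale n t Q 0 i = (Q * t ^ ((n : ℤ) - 1)) ^ i := by
    intro i hi
    have : t ^ ((n - 1) * i) = (t ^ ((n : ℤ) - 1)) ^ i := by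
      rcases n with _ | n
      · obtain rfl : i = 0 := by omega
        simp
      · rw [pow_mul]; congr 1; rw [← zpow_natCast]; congr 1; simp
    constructor
    · rw [backScale, show n - i - n = 0 by omega, show n - n = 0 by omega]
      simp only [mul_zero, zero_mul, add_zero]
      rw [this, mul_pow]
    · rw [backScale, show i + 0 - n = 0 by omega]
      simp only [mul_zero, zero_mul, add_zero]
      rw [this, mul_pow]
  have hM : ∀ i, (matUA' n Q t a₁ b₁ * matDA' n Q t a₁ a₂ b₁ b₂ *
      matLA' n Q t a₁ a₂ b₁ b₂) i j = (Q * t ^ ((n : ℤ) - 1)) ^ (n - (i : ℕ)) *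
        (matLA n Q t a₁ b₁ * matDA n Q t a₂ a₁ b₂ b₁ * matUA n Q t a₂ a₁ b₂ b₁) i.rev j.rev *
          ((Q * t ^ ((n : ℤ) - 1)) ^ (n - (j : ℕ)))⁻¹ := by
    intro i
    rw [Matrix.mul_apply, Matrix.mul_apply, Finset.mul_sum, Finset.sum_mul]
    refine Fintype.sum_equiv Fin.revPerm _ _ fun k => ?_
    have e1 : (matUA' n Q t a₁ b₁ * matDA' n Q t a₁ a₂ b₁ b₂) i k =
        matUA' n Q t a₁ b₁ i k * matDA' n Q t a₁ a₂ b₁ b₂ k k := by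
      simp only [matDA', Matrix.mul_diagonal, Matrix.diagonal_apply_eq]
    have e2 : (matLA n Q t a₁ b₁ * matDA n Q t a₂ a₁ b₂ b₁) i.rev k.rev =
        matLA n Q t a₁ b₁ i.rev k.rev * matDA n Q t a₂ a₁ b₂ b₁ k.rev k.rev := by
      simp only [matDA, Matrix.mul_diagonal, Matrix.diagonal_apply_eq]
    have hk : (Q * t ^ ((n : ℤ) - 1)) ^ (n - (k : ℕ)) ≠ 0 := pow_ne_zero _ hR
    rw [Fin.revPerm_apply, e1, e2, matUA'_eq ht hQ, matDA'_eq, matLA'_eq ht hQ]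
    field_simp
  simp only [hM]
  have hj := (hs (j.rev : ℕ) (by omega)).1
  rw [hj] at key
  have hjn : (j.rev : ℕ) = n - (j : ℕ) := by rw [Fin.val_rev]; omega
  rw [hjn] at key
  have hj0 : (Q * t ^ ((n : ℤ) - 1)) ^ (n - (j : ℕ)) ≠ 0 := pow_ne_zero _ hR
  rw [← mul_right_inj' hj0]
  have hw : backWord n n (n - (n - (j : ℕ))) =
      replicate (n - (j : ℕ)) zb ++ replicate (j : ℕ) za := by
    rw [show n - (n - (j : ℕ)) = j by omega]
    simp [backWord, show (j : ℕ) - n = 0 by omega, show min (j : ℕ) n = j by omega]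
  rw [hw] at key
  rw [key, Finset.mul_sum]
  refine Fintype.sum_equiv Fin.revPerm _ _ fun i => ?_
  have hin : ((Fin.revPerm i : Fin (n + 1)) : ℕ) = n - (i : ℕ) := by
    rw [Fin.revPerm_apply, Fin.val_rev]; omega
  have hw' : backWord n 0 (n - (i : ℕ)) =
      replicate (n - (n - (i : ℕ))) b ++ replicate (n - (i : ℕ)) a := by
    simp [backWord]
  rw [(hs (i : ℕ) (by omega)).2, hw', hin, Fin.revPerm_apply, Fin.rev_rev,
    show n - (n - (i : ℕ)) = i by omega]
  field_simp

end Gauss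

end Decompositions

/-! ### A family of word functionals -/

section Family

open Letter List

section Model

variable (s : ℂ)

/-- For `φ p r k` the value of a functional on the ordered monomial `W ^ p Y ^ r X ^ k` in the
algebra with the relations `X Y = s Y X`, `Y W = s W Y`, `X W = s W X + (s - 1) Y ^ 2`, the values
of this functional on `X W ^ p Y ^ r X ^ k`. -/
def leftX (φ : ℕ → ℕ → ℕ → ℂ) (p r k : ℕ) : ℂ :=
  s ^ (p + r) * φ p r (k + 1) + s ^ (p - 1) * (s ^ p - 1) * φ (p - 1) (r + 2) k

/-- The values of a functional on `Y W ^ p Y ^ r X ^ k`. -/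
def leftY (φ : ℕ → ℕ → ℕ → ℂ) (p r k : ℕ) : ℂ := s ^ p * φ p (r + 1) k

/-- The values of a functional on `W W ^ p Y ^ r X ^ k`. -/
def leftW (φ : ℕ → ℕ → ℕ → ℂ) (p r k : ℕ) : ℂ := φ (p + 1) r k

/-- The values of a functional on `W ^ p Y ^ r X ^ k X`. -/
def rightX (φ : ℕ → ℕ → ℕ → ℂ) (p r k : ℕ) : ℂ := φ p r (k + 1)

/-- The values of a functional on `W ^ p Y ^ r X ^ k Y`. -/
def rightY (φ : ℕ → ℕ → ℕ → ℂ) (p r k : ℕ) : ℂ := s ^ k * φ p (r + 1) k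

/-- The values of a functional on `W ^ p Y ^ r X ^ k W`. -/
def rightW (φ : ℕ → ℕ → ℕ → ℂ) (p r k : ℕ) : ℂ :=
  s ^ (k + r) * φ (p + 1) r k + s ^ (k - 1) * (s ^ k - 1) * φ p (r + 2) (k - 1)

variable (a' b' : ℂ)

/-- The left multiplication by a letter, in which `X`, `Y`, `W` take the places of `1`, `z`, `z²`,
and `a'`, `b'` those of `a₁⁻¹`, `b₂`. -/
def leftOp (φ : ℕ → ℕ → ℕ → ℂ) : Letter → ℕ → ℕ → ℕ → ℂ
  | a => fun p r k => leftX s φ p r k - a' * leftY s φ p r k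
  | b => fun p r k => leftX s φ p r k - b' * leftY s φ p r k
  | za => fun p r k => leftY s φ p r k - a' * leftW φ p r k
  | zb => fun p r k => leftY s φ p r k - b' * leftW φ p r k

/-- The right multiplication by a letter. -/
def rightOp (φ : ℕ → ℕ → ℕ → ℂ) : Letter → ℕ → ℕ → ℕ → ℂ
  | a => fun p r k => rightX φ p r k - a' * rightY s φ p r k
  | b => fun p r k => rightX φ p r k - b' * rightY s φ p r k
  | za => fun p r k => rightY s φ p r k - a' * rightW s φ p r k
  | zb => fun p r k => rightY s φ p r k - b' * rightW s φ p r k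

/-- The value of the functional `φ` on the product of the letters of a word. -/
def evalWord (φ : ℕ → ℕ → ℕ → ℂ) (l : List Letter) : ℂ := l.foldl (leftOp s a' b') φ 0 0 0

variable {s a' b'}

theorem evalWord_cons (φ : ℕ → ℕ → ℕ → ℂ) (g : Letter) (l : List Letter) :
    evalWord s a' b' φ (g :: l) = evalWord s a' b' (leftOp s a' b' φ g) l := rfl

theorem evalWord_append (φ : ℕ → ℕ → ℕ → ℂ) (u l : List Letter) :
    evalWord s a' b' φ (u ++ l) = evalWord s a' b' (u.foldl (leftOp s a' b') φ) l := by
  simp [evalWord]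

theorem leftOp_linear (x y : ℂ) (φ ψ : ℕ → ℕ → ℕ → ℂ) (g : Letter) :
    leftOp s a' b' (x • φ + y • ψ) g = x • leftOp s a' b' φ g + y • leftOp s a' b' ψ g := by
  funext p r k
  cases g <;> simp [leftOp, leftX, leftY, leftW] <;> ring

theorem evalWord_linear (x y : ℂ) (φ ψ : ℕ → ℕ → ℕ → ℂ) (l : List Letter) :
    evalWord s a' b' (x • φ + y • ψ) l = x * evalWord s a' b' φ l + y * evalWord s a' b' ψ l := by
  induction l generalizing φ ψ with
  | nil => simp [evalWord]
  | cons g l ih => rw [evalWord_cons, leftOp_linear, ih]; rfl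

/-- Multiplications from the two sides commute, because the algebra is associative. -/
theorem rightOp_leftOp (φ : ℕ → ℕ → ℕ → ℂ) (g h : Letter) :
    rightOp s a' b' (leftOp s a' b' φ h) g = leftOp s a' b' (rightOp s a' b' φ g) h := by
  funext p r k
  rcases p with _ | p <;> rcases k with _ | k <;> cases g <;> cases h <;>
    simp [leftOp, rightOp, leftX, leftY, leftW, rightX, rightY, rightW] <;> ring_nf

theorem evalWord_concat (φ : ℕ → ℕ → ℕ → ℂ) (g : Letter) (w : List Letter) :
    evalWord s a' b' φ (w ++ [g]) = evalWord s a' b' (rightOp s a' b' φ g) w := by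
  induction w generalizing φ with
  | nil =>
    cases g <;> simp [evalWord, leftOp, rightOp, leftX, leftY, leftW, rightX, rightY, rightW]
  | cons h w ih => rw [cons_append, evalWord_cons, ih, rightOp_leftOp, evalWord_cons]

theorem evalWord_eq_zero {φ : ℕ → ℕ → ℕ → ℂ} {w : List Letter}
    (h : ∀ p r k, p + r + k = w.length → φ p r k = 0) : evalWord s a' b' φ w = 0 := by
  induction w generalizing φ with
  | nil => exact h 0 0 0 rfl
  | cons g w ih =>
    refine ih fun p r k hd => ?_
    have hX : leftX s φ p r k = 0 := by
      rcases p with _ | p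
      · simp [leftX, h 0 r (k + 1) (by simp; omega)]
      · rw [leftX, h (p + 1) r (k + 1) (by simp; omega),
          h (p + 1 - 1) (r + 2) k (by simp; omega)]
        simp
    have hY : leftY s φ p r k = 0 := by rw [leftY, h p (r + 1) k (by simp; omega), mul_zero]
    have hW : leftW φ p r k = 0 := h (p + 1) r k (by simp; omega)
    cases g <;> simp [leftOp, hX, hY, hW]

variable (s) in
/-- The functional with prescribed values `x ^ r s ^ (r choose 2)` on the monomials
`Y ^ r X ^ k`, extended by solving the cyclic relation for the highest power of `W`. -/
noncomputable def modelFun (R a₁' a₂' b₁ b₂ x : ℂ) : ℕ → ℕ → ℕ → ℂ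
  | 0, r, _ => x ^ r * s ^ r.choose 2
  | 1, r, k =>
    (R * (s ^ r * modelFun R a₁' a₂' b₁ b₂ x 0 r (k + 1) -
        (b₁ + b₂) * modelFun R a₁' a₂' b₁ b₂ x 0 (r + 1) k) -
      (modelFun R a₁' a₂' b₁ b₂ x 0 r (k + 1) -
        (a₁' + a₂') * s ^ k * modelFun R a₁' a₂' b₁ b₂ x 0 (r + 1) k +
        a₁' * a₂' * (s ^ (k - 1) * (s ^ k - 1)) *
          modelFun R a₁' a₂' b₁ b₂ x 0 (r + 2) (k - 1))) /
      (a₁' * a₂' * s ^ (k + r) - R * b₁ * b₂)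
  | p + 2, r, k =>
    (R * (s ^ (p + 1 + r) * modelFun R a₁' a₂' b₁ b₂ x (p + 1) r (k + 1) +
        s ^ p * (s ^ (p + 1) - 1) * modelFun R a₁' a₂' b₁ b₂ x p (r + 2) k -
        (b₁ + b₂) * s ^ (p + 1) * modelFun R a₁' a₂' b₁ b₂ x (p + 1) (r + 1) k) -
      (modelFun R a₁' a₂' b₁ b₂ x (p + 1) r (k + 1) -
        (a₁' + a₂') * s ^ k * modelFun R a₁' a₂' b₁ b₂ x (p + 1) (r + 1) k +
        a₁' * a₂' * (s ^ (k - 1) * (s ^ k - 1)) *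
          modelFun R a₁' a₂' b₁ b₂ x (p + 1) (r + 2) (k - 1))) /
      (a₁' * a₂' * s ^ (k + r) - R * b₁ * b₂)

theorem modelFun_cyc {R a₁' a₂' b₁ b₂ x : ℂ} {p r k : ℕ}
    (h : a₁' * a₂' * s ^ (k + r) - R * b₁ * b₂ ≠ 0) :
    rightOp s a₁' b₂ (modelFun s R a₁' a₂' b₁ b₂ x) a p r k -
        a₂' * rightOp s a₁' b₂ (modelFun s R a₁' a₂' b₁ b₂ x) za p r k =
      R * (leftOp s a₁' b₂ (modelFun s R a₁' a₂' b₁ b₂ x) b p r k -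
        b₁ * leftOp s a₁' b₂ (modelFun s R a₁' a₂' b₁ b₂ x) zb p r k) := by
  rcases p with _ | p
  · have h1 := eq_div_iff h |>.1 (modelFun.eq_2 s R a₁' a₂' b₁ b₂ x r k)
    simp only [rightOp, leftOp, leftX, leftY, leftW, rightX, rightY, rightW, zero_add, pow_zero,
      sub_self, mul_zero, zero_mul, add_zero, one_mul]
    linear_combination h1
  · have h1 := eq_div_iff h |>.1 (modelFun.eq_3 s R a₁' a₂' b₁ b₂ x r k p)
    simp only [rightOp, leftOp, leftX, leftY, leftW, rightX, rightY, rightW, Nat.add_sub_cancel]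
    linear_combination h1

end Model

/-- The functional `modelFun` gives a word functional for all parameters; its values on the
words of the `e_i` are products. -/
theorem isWordFunctional_evalWord {n : ℕ} {t Q a₁ a₂ b₁ b₂ : ℂ}
    (h : Admissible n t Q a₁ a₂ b₁ b₂) (x : ℂ) :
    IsWordFunctional n t Q a₁ a₂ b₁ b₂ (evalWord t⁻¹ a₁⁻¹ b₂
      (modelFun t⁻¹ (Q * t ^ (n - 1)) a₁⁻¹ a₂⁻¹ b₁ b₂ x)) where
  subst u v _ := by
    simp only [evalWord_append, evalWord_cons]
    generalize u.foldl _ _ = φ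
    have : leftOp t⁻¹ a₁⁻¹ b₂ φ b = (1 : ℂ) • leftOp t⁻¹ a₁⁻¹ b₂ φ a +
        (1 : ℂ) • (a₁⁻¹ • leftOp t⁻¹ a₁⁻¹ b₂ φ zb + (-b₂) • leftOp t⁻¹ a₁⁻¹ b₂ φ za) := by
      funext p r k
      simp [leftOp]
      ring
    rw [this, evalWord_linear, evalWord_linear]
    ring
  swap_a u v _ := by
    simp only [evalWord_append, evalWord_cons]
    generalize u.foldl _ _ = φ
    have : leftOp t⁻¹ a₁⁻¹ b₂ (leftOp t⁻¹ a₁⁻¹ b₂ φ za) a =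
        t • leftOp t⁻¹ a₁⁻¹ b₂ (leftOp t⁻¹ a₁⁻¹ b₂ φ a) za + (0 : ℂ) • φ := by
      have ht := h.t_ne
      funext p r k
      rcases p with _ | p <;> simp [leftOp, leftX, leftY, leftW] <;> field_simp <;> ring
    rw [this, evalWord_linear]
    ring
  swap_b u v _ := by
    simp only [evalWord_append, evalWord_cons]
    generalize u.foldl _ _ = φ
    have : leftOp t⁻¹ a₁⁻¹ b₂ (leftOp t⁻¹ a₁⁻¹ b₂ φ zb) b =
        t • leftOp t⁻¹ a₁⁻¹ b₂ (leftOp t⁻¹ a₁⁻¹ b₂ φ b) zb + (0 : ℂ) • φ := by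
      have ht := h.t_ne
      funext p r k
      rcases p with _ | p <;> simp [leftOp, leftX, leftY, leftW] <;> field_simp <;> ring
    rw [this, evalWord_linear]
    ring
  cyc w hw := by
    simp only [evalWord_concat, evalWord_cons]
    rw [show n - 1 = w.length by omega]
    set φ := modelFun t⁻¹ (Q * t ^ w.length) a₁⁻¹ a₂⁻¹ b₁ b₂ x with hφ
    have := evalWord_eq_zero (s := t⁻¹) (a' := a₁⁻¹) (b' := b₂) (w := w)
      (φ := (1 : ℂ) • ((1 : ℂ) • rightOp t⁻¹ a₁⁻¹ b₂ φ a + (-a₂⁻¹) • rightOp t⁻¹ a₁⁻¹ b₂ φ za) +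
        (-(Q * t ^ w.length)) • ((1 : ℂ) • leftOp t⁻¹ a₁⁻¹ b₂ φ b +
          (-b₁) • leftOp t⁻¹ a₁⁻¹ b₂ φ zb)) ?_
    · rw [evalWord_linear, evalWord_linear, evalWord_linear] at this
      linear_combination this
    · intro p r k hd
      have hne : a₁⁻¹ * a₂⁻¹ * t⁻¹ ^ (k + r) - (Q * t ^ w.length) * b₁ * b₂ ≠ 0 := by
        have h1 := h.den (w.length + (k + r)) (by omega) (by omega)
        have ht := h.t_ne
        have ha₁ := h.a₁_ne
        have ha₂ := h.a₂_ne
        intro h0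
        apply h1
        have htk : t ^ (k + r) ≠ 0 := pow_ne_zero _ ht
        rw [inv_pow] at h0
        field_simp at h0
        rw [pow_add]
        linear_combination -h0
      have := modelFun_cyc (x := x) (p := p) hne
      rw [← hφ] at this
      simp only [Pi.add_apply, Pi.smul_apply, smul_eq_mul]
      linear_combination this

/-- On the words of the `e_i` only the values on the `Y ^ r X ^ k` matter, and those that `modelFun`
prescribes are multiplicative: the letters `b` and `a` act as the numbers `1 - b' s^j x` and
`1 - a' s^j x`, where `j` is their position. -/
theorem evalWord_plane {s a' b' : ℂ} {φ : ℕ → ℕ → ℕ → ℂ} {x y : ℂ}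
    (h : ∀ r k, φ 0 r k = y * (x ^ r * s ^ r.choose 2)) (m l : ℕ) :
    evalWord s a' b' φ (replicate m b ++ replicate l a) =
      y * shiftedFactorial (b' * x) s m * shiftedFactorial (a' * x * s ^ m) s l := by
  have step : ∀ {φ : ℕ → ℕ → ℕ → ℂ} {x y : ℂ} (c : ℂ) (r k : ℕ),
      (∀ r k, φ 0 r k = y * (x ^ r * s ^ r.choose 2)) →
      leftX s φ 0 r k - c * leftY s φ 0 r k =
        (y * (1 - c * x)) * ((x * s) ^ r * s ^ r.choose 2) := by
    intro φ x y c r k h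
    simp only [leftX, leftY, h, choose_two_succ, zero_add, pow_zero, sub_self, mul_zero, zero_mul,
      add_zero]
    ring
  induction m generalizing φ x y with
  | zero =>
    induction l generalizing φ x y with
    | zero => simp [evalWord, shiftedFactorial_zero, h]
    | succ l ih =>
      have := ih (φ := leftOp s a' b' φ a) fun r k => step a' r k h
      rw [replicate_zero, nil_append] at this ⊢
      rw [replicate_succ, evalWord_cons, this, shiftedFactorial_succ', shiftedFactorial_zero,
        shiftedFactorial_zero, show a' * (x * s) * s ^ 0 = a' * x * s ^ 0 * s by ring]
      ring
  | succ m ih =>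
    rw [replicate_succ, cons_append, evalWord_cons,
      ih (φ := leftOp s a' b' φ b) fun r k => step b' r k h, shiftedFactorial_succ',
      show b' * (x * s) = b' * x * s by ring,
      show a' * (x * s) * s ^ m = a' * x * s ^ (m + 1) by ring]
    ring

end Family

/-! ### The two decompositions agree -/

section Agreement

open Letter List Filter Topology

/-- The two Gauss decompositions agree when `a₁ b₂ ∉ {1, t⁻¹, …, t^(1-n)}`: at the points
`x = t ^ m / b₂` the values of the functionals `modelFun` on the words of the `e_i` form a
triangular matrix with nonzero diagonal. -/
theorem gauss_eq_gauss'_of_generic {n : ℕ} {t Q a₁ a₂ b₁ b₂ : ℂ}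
    (h : Admissible n t Q a₁ a₂ b₁ b₂) (hgen : ∀ j < n, a₁ * b₂ * t ^ j ≠ 1) :
    matLA n Q t a₂ b₂ * matDA n Q t a₁ a₂ b₁ b₂ * matUA n Q t a₁ a₂ b₁ b₂ =
      matUA' n Q t a₁ b₁ * matDA' n Q t a₁ a₂ b₁ b₂ * matLA' n Q t a₁ a₂ b₁ b₂ := by
  have ht := h.t_ne
  have ha₁ := h.a₁_ne
  have hb₂ := h.b₂_ne
  generalize hM : matLA n Q t a₂ b₂ * matDA n Q t a₁ a₂ b₁ b₂ * matUA n Q t a₁ a₂ b₁ b₂ = M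
  generalize hM' : matUA' n Q t a₁ b₁ * matDA' n Q t a₁ a₂ b₁ b₂ * matLA' n Q t a₁ a₂ b₁ b₂ = M'
  let v : ℕ → ℕ → ℂ := fun m i => shiftedFactorial (t ^ m) t⁻¹ (n - i) *
    shiftedFactorial (a₁⁻¹ * b₂⁻¹ * t ^ m * t⁻¹ ^ (n - i)) t⁻¹ i
  have hv : ∀ (m : ℕ) (j : Fin (n + 1)), ∑ i : Fin (n + 1), v m i * (M i j - M' i j) = 0 := by
    intro m j
    have hw := isWordFunctional_evalWord h (t ^ m * b₂⁻¹)
    have h1 := hw.gauss h j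
    rw [hw.gauss' h j, hM, hM'] at h1
    simp only [mul_sub, Finset.sum_sub_distrib]
    have hval : ∀ i : ℕ, evalWord t⁻¹ a₁⁻¹ b₂ (modelFun t⁻¹ (Q * t ^ (n - 1)) a₁⁻¹ a₂⁻¹ b₁ b₂
        (t ^ m * b₂⁻¹)) (replicate (n - i) b ++ replicate i a) = v m i := by
      intro i
      rw [evalWord_plane (x := t ^ m * b₂⁻¹) (y := 1) fun r k => by rw [modelFun, one_mul], one_mul,
        show b₂ * (t ^ m * b₂⁻¹) = t ^ m by field_simp,
        show a₁⁻¹ * (t ^ m * b₂⁻¹) = a₁⁻¹ * b₂⁻¹ * t ^ m by ring]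
    simp only [hval] at h1
    rw [h1, sub_self]
  have hzero : ∀ m i : ℕ, m ≤ n → i < n - m → v m i = 0 := by
    intro m i hm hi
    have : shiftedFactorial (t ^ m) t⁻¹ (n - i) = 0 :=
      Finset.prod_eq_zero (i := m) (Finset.mem_range.2 (by omega)) (by
        rw [inv_pow, inv_mul_cancel₀ (pow_ne_zero _ ht), sub_self])
    simp only [v, this, zero_mul]
  have hdiag : ∀ m : ℕ, m ≤ n → v m (n - m) ≠ 0 := by
    intro m hm
    have hpow : ∀ j ≤ m, t ^ m * t⁻¹ ^ j = t ^ (m - j) := fun j hj => by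
      rw [inv_pow, pow_sub₀ _ ht hj]
    refine mul_ne_zero (shiftedFactorial_ne_zero fun j hj => ?_)
      (shiftedFactorial_ne_zero fun j hj => ?_)
    · rw [hpow _ (by omega)]
      exact h.t_pow _ (by omega) (by omega)
    · rw [mul_assoc _ (t ^ m), hpow _ (by omega), show m - (n - (n - m)) = 0 by omega, pow_zero,
        mul_one]
      intro h0
      apply hgen j (by omega)
      have := congrArg (fun x => x⁻¹) h0
      simpa [mul_comm, mul_assoc] using this
  have key : ∀ m : ℕ, m ≤ n → ∀ i : Fin (n + 1), (i : ℕ) + m = n → ∀ j, M i j - M' i j = 0 := by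
    intro m
    induction m using Nat.strong_induction_on with
    | _ m ih =>
      intro hm i hi j
      have := hv m j
      rw [Finset.sum_eq_single i] at this
      · rw [show (i : ℕ) = n - m by omega] at this
        exact (mul_eq_zero.1 this).resolve_left (hdiag m hm)
      · intro k _ hk
        have hk' : (k : ℕ) ≠ i := fun h => hk (Fin.ext h)
        rcases lt_or_gt_of_ne hk' with hlt | hgt
        · rw [hzero m k hm (by omega), zero_mul]
        · rw [ih (n - k) (by omega) (by omega) k (by omega), mul_zero]
      · intro hk; exact absurd (Finset.mem_univ _) hk
  ext i j
  exact sub_eq_zero.1 (key (n - i) (by omega) i (by omega) j)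

theorem eventually_nhdsNE_ne (x c : ℂ) : ∀ᶠ y in 𝓝[≠] x, y ≠ c := by
  by_cases hx : x = c
  · subst hx; exact self_mem_nhdsWithin
  · exact (eventually_ne_nhds hx).filter_mono nhdsWithin_le_nhds

theorem continuous_shiftedFactorial (c : ℂ) (k : ℕ) : Continuous fun x => shiftedFactorial x c k := by
  unfold shiftedFactorial
  fun_prop

theorem Admissible.eventually {n : ℕ} {t Q a₁ a₂ b₁ b₂ : ℂ}
    (h : Admissible n t Q a₁ a₂ b₁ b₂) : ∀ᶠ x in 𝓝 a₁, Admissible n t Q x a₂ b₁ b₂ := by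
  have h1 : ∀ k ∈ Finset.range (2 * n), k + 2 ≤ 2 * n → ∀ᶠ x in 𝓝 a₁, Q * x * b₁ * t ^ k ≠ 1 :=
    fun k _ hk => ContinuousAt.eventually_ne (by fun_prop) (h.den₁ k hk)
  have h2 : ∀ k ∈ Finset.range (2 * n), n ≤ k + 1 → k + 2 ≤ 2 * n →
      ∀ᶠ x in 𝓝 a₁, Q * x * a₂ * b₁ * b₂ * t ^ k ≠ 1 :=
    fun k _ hk hk' => ContinuousAt.eventually_ne (by fun_prop) (h.den k hk hk')
  have h1' : ∀ᶠ x in 𝓝 a₁, ∀ k ∈ Finset.range (2 * n), k + 2 ≤ 2 * n → Q * x * b₁ * t ^ k ≠ 1 :=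
    (eventually_all_finset _).2 fun k hk => by
      by_cases hk' : k + 2 ≤ 2 * n
      · exact (h1 k hk hk').mono fun x hx _ => hx
      · exact Eventually.of_forall fun x h => absurd h hk'
  have h2' : ∀ᶠ x in 𝓝 a₁, ∀ k ∈ Finset.range (2 * n), n ≤ k + 1 → k + 2 ≤ 2 * n →
      Q * x * a₂ * b₁ * b₂ * t ^ k ≠ 1 :=
    (eventually_all_finset _).2 fun k hk => by
      by_cases hk' : n ≤ k + 1 ∧ k + 2 ≤ 2 * n
      · exact (h2 k hk hk'.1 hk'.2).mono fun x hx _ _ => hx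
      · exact Eventually.of_forall fun x h h' => absurd ⟨h, h'⟩ hk'
  filter_upwards [h1', h2', eventually_ne_nhds h.a₁_ne] with x hx1 hx2 hx0
  exact ⟨h.t_ne, h.Q_ne, hx0, h.a₂_ne, h.b₁_ne, h.b₂_ne, h.t_pow, h.den₂,
    fun k hk => hx1 k (Finset.mem_range.2 (by omega)) hk,
    fun k hk hk' => hx2 k (Finset.mem_range.2 (by omega)) hk hk'⟩

theorem Admissible.shiftedFactorial_den_ne_zero {n : ℕ} {t Q a₁ a₂ b₁ b₂ : ℂ}
    (h : Admissible n t Q a₁ a₂ b₁ b₂) {e : ℤ} {k : ℕ}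
    (hk : 0 < k → (n : ℤ) - 1 ≤ e ∧ e + k ≤ 2 * n - 1) :
    shiftedFactorial (Q * a₁ * a₂ * b₁ * b₂ * t ^ e) t k ≠ 0 := by
  refine shiftedFactorial_ne_zero fun i hi => ?_
  obtain ⟨h1, h2⟩ := hk (by omega)
  obtain ⟨e, rfl⟩ := Int.eq_ofNat_of_zero_le (a := e) (by omega)
  rw [zpow_natCast, mul_assoc, ← pow_add]
  exact h.den _ (by omega) (by omega)

theorem Admissible.shiftedFactorial_den₁_ne_zero {n : ℕ} {t Q a₁ a₂ b₁ b₂ : ℂ}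
    (h : Admissible n t Q a₁ a₂ b₁ b₂) {e : ℤ} {k : ℕ}
    (hk : 0 < k → 0 ≤ e ∧ e + k ≤ 2 * n - 1) :
    shiftedFactorial (Q * a₁ * b₁ * t ^ e) t k ≠ 0 := by
  refine shiftedFactorial_ne_zero fun i hi => ?_
  obtain ⟨h1, h2⟩ := hk (by omega)
  obtain ⟨e, rfl⟩ := Int.eq_ofNat_of_zero_le (a := e) (by omega)
  rw [zpow_natCast, mul_assoc, ← pow_add]
  exact h.den₁ _ (by omega)

theorem ContinuousAt.shiftedFactorial {f : ℂ → ℂ} {x : ℂ} (hf : ContinuousAt f x) (c : ℂ) (k : ℕ) :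
    ContinuousAt (fun y => shiftedFactorial (f y) c k) x :=
  (continuous_shiftedFactorial c k).continuousAt.comp hf

theorem continuousAt_gauss {n : ℕ} {t Q a₁ a₂ b₁ b₂ : ℂ} (h : Admissible n t Q a₁ a₂ b₁ b₂) :
    ContinuousAt (fun x => matLA n Q t a₂ b₂ * matDA n Q t x a₂ b₁ b₂ * matUA n Q t x a₂ b₁ b₂)
      a₁ := by
  have ha₁ := h.a₁_ne
  refine ContinuousAt.mul (ContinuousAt.mul continuousAt_const ?_) ?_
  · refine (continuous_id.matrix_diagonal).continuousAt.comp (continuousAt_pi.2 fun j => ?_)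
    refine ContinuousAt.mul (by fun_prop) (ContinuousAt.div continuousAt_const ?_ ?_)
    · refine ContinuousAt.mul continuousAt_const (ContinuousAt.shiftedFactorial (by fun_prop) _ _)
    · refine mul_ne_zero (shiftedFactorial_ne_zero fun i hi => ?_)
        (h.shiftedFactorial_den_ne_zero fun _ => by omega)
      rw [show ((j : ℕ) : ℤ) - 1 = ((j - 1 : ℕ) : ℤ) by omega, zpow_natCast, mul_assoc, ← pow_add]
      exact h.den₂ _ (by omega)
  · refine continuousAt_pi.2 fun i => continuousAt_pi.2 fun j => ?_
    simp only [matUA, Matrix.of_apply]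
    split_ifs
    · refine ContinuousAt.mul (by fun_prop (disch := assumption)) (ContinuousAt.div_const
        (ContinuousAt.shiftedFactorial (by fun_prop) _ _) _)
    · exact continuousAt_const

theorem continuousAt_gauss' {n : ℕ} {t Q a₁ a₂ b₁ b₂ : ℂ} (h : Admissible n t Q a₁ a₂ b₁ b₂) :
    ContinuousAt (fun x => matUA' n Q t x b₁ * matDA' n Q t x a₂ b₁ b₂ *
      matLA' n Q t x a₂ b₁ b₂) a₁ := by
  have ha₁ := h.a₁_ne
  refine ContinuousAt.mul (ContinuousAt.mul ?_ ?_) ?_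
  · refine continuousAt_pi.2 fun i => continuousAt_pi.2 fun j => ?_
    simp only [matUA', Matrix.of_apply]
    split_ifs with hij
    · refine ContinuousAt.mul continuousAt_const (ContinuousAt.div
        (ContinuousAt.shiftedFactorial (by fun_prop) _ _)
        (ContinuousAt.shiftedFactorial (by fun_prop) _ _) ?_)
      rw [← zpow_natCast]
      rw [Fin.le_def] at hij
      exact h.shiftedFactorial_den₁_ne_zero fun _ => by omega
    · exact continuousAt_const
  · refine (continuous_id.matrix_diagonal).continuousAt.comp (continuousAt_pi.2 fun j => ?_)
    refine ContinuousAt.mul (by fun_prop) (ContinuousAt.div ?_ (ContinuousAt.mul ?_ ?_) ?_)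
    · exact ContinuousAt.mul (ContinuousAt.shiftedFactorial (by fun_prop) _ _) continuousAt_const
    · exact ContinuousAt.shiftedFactorial (by fun_prop) _ _
    · exact ContinuousAt.shiftedFactorial (by fun_prop) _ _
    · exact mul_ne_zero (h.shiftedFactorial_den_ne_zero fun _ => by omega)
        (h.shiftedFactorial_den₁_ne_zero fun _ => by omega)
  · refine continuousAt_pi.2 fun i => continuousAt_pi.2 fun j => ?_
    simp only [matLA', Matrix.of_apply]
    split_ifs with hij
    · refine ContinuousAt.mul (by fun_prop) (ContinuousAt.div continuousAt_const
        (ContinuousAt.shiftedFactorial (by fun_prop) _ _) ?_)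
      rw [← zpow_natCast]
      rw [Fin.le_def] at hij
      exact h.shiftedFactorial_den₁_ne_zero fun _ => by omega
    · exact continuousAt_const

/-- The two Gauss decompositions define the same matrix. The restriction on `a₁ b₂` in
`gauss_eq_gauss'_of_generic` is removed by continuity in `a₁`. -/
theorem gauss_eq_gauss' {n : ℕ} {t Q a₁ a₂ b₁ b₂ : ℂ} (h : Admissible n t Q a₁ a₂ b₁ b₂) :
    matLA n Q t a₂ b₂ * matDA n Q t a₁ a₂ b₁ b₂ * matUA n Q t a₁ a₂ b₁ b₂ =
      matUA' n Q t a₁ b₁ * matDA' n Q t a₁ a₂ b₁ b₂ * matLA' n Q t a₁ a₂ b₁ b₂ := by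
  have h1 := (continuousAt_gauss h).continuousWithinAt (s := {a₁}ᶜ)
  have h2 := (continuousAt_gauss' h).continuousWithinAt (s := {a₁}ᶜ)
  have hgen : ∀ᶠ x in 𝓝[≠] a₁, ∀ j ∈ Finset.range n, x ≠ (b₂ * t ^ j)⁻¹ :=
    (eventually_all_finset _).2 fun j _ => eventually_nhdsNE_ne _ _
  have heq : ∀ᶠ x in 𝓝[≠] a₁,
      matLA n Q t a₂ b₂ * matDA n Q t x a₂ b₁ b₂ * matUA n Q t x a₂ b₁ b₂ =
        matUA' n Q t x b₁ * matDA' n Q t x a₂ b₁ b₂ * matLA' n Q t x a₂ b₁ b₂ := by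
    filter_upwards [hgen, h.eventually.filter_mono nhdsWithin_le_nhds] with x hx hA
    refine gauss_eq_gauss'_of_generic hA fun j hj h0 => hx j (Finset.mem_range.2 hj) ?_
    rw [mul_assoc] at h0
    exact eq_inv_of_mul_eq_one_left h0
  exact tendsto_nhds_unique_of_eventuallyEq h1 h2 heq

end Agreement

/-! ### Growth of infinite shifted factorials -/

section QFactorial

variable {q : ℂ}

theorem summable_pow_mul (hq : ‖q‖ < 1) (x : ℂ) : Summable fun i : ℕ => ‖-(q ^ i * x)‖ := by
  simp only [norm_neg, norm_mul, norm_pow]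
  exact (summable_geometric_of_lt_one (norm_nonneg _) hq).mul_right _

theorem multipliable_shiftedFactorialInf (hq : ‖q‖ < 1) (x : ℂ) :
    Multipliable fun i : ℕ => 1 - q ^ i * x := by
  simpa only [sub_eq_add_neg] using multipliable_one_add_of_summable (summable_pow_mul hq x)

theorem shiftedFactorialInf_eq_mul (hq : ‖q‖ < 1) (x : ℂ) :
    shiftedFactorialInf x q = (1 - x) * shiftedFactorialInf (q * x) q := by
  unfold shiftedFactorialInf
  have h2 : Multipliable fun i : ℕ => 1 - q ^ (i + 1) * x := by
    refine (multipliable_shiftedFactorialInf hq (q * x)).congr fun i => ?_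
    ring
  have h := tprod_eq_zero_mul' (f := fun i : ℕ => 1 - q ^ i * x) h2
  rw [h, pow_zero, one_mul]
  congr 2
  funext i
  ring

theorem shiftedFactorialInf_eq_shiftedFactorial_mul (hq : ‖q‖ < 1) (x : ℂ) (k : ℕ) :
    shiftedFactorialInf x q = shiftedFactorial x q k * shiftedFactorialInf (q ^ k * x) q := by
  induction k with
  | zero => simp [shiftedFactorial_zero]
  | succ k ih =>
    rw [ih, shiftedFactorialInf_eq_mul hq (q ^ k * x), shiftedFactorial_succ, pow_succ' q k,
      mul_assoc q]
    ring

theorem norm_shiftedFactorial_le (hq : ‖q‖ < 1) (x : ℂ) (k : ℕ) :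
    ‖shiftedFactorial x q k‖ ≤ Real.exp (‖x‖ / (1 - ‖q‖)) := by
  unfold shiftedFactorial
  rw [norm_prod]
  calc ∏ i ∈ Finset.range k, ‖1 - q ^ i * x‖
      ≤ ∏ i ∈ Finset.range k, Real.exp (‖q‖ ^ i * ‖x‖) := by
        refine Finset.prod_le_prod (fun _ _ => norm_nonneg _) fun i _ => ?_
        refine (norm_sub_le _ _).trans ?_
        rw [norm_one, norm_mul, norm_pow, add_comm]
        exact Real.add_one_le_exp _
    _ = Real.exp ((∑ i ∈ Finset.range k, ‖q‖ ^ i) * ‖x‖) := by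
        rw [← Real.exp_sum, Finset.sum_mul]
    _ ≤ Real.exp (‖x‖ / (1 - ‖q‖)) := by
        refine Real.exp_le_exp.2 ?_
        rw [div_eq_inv_mul, ← tsum_geometric_of_lt_one (norm_nonneg _) hq]
        exact mul_le_mul_of_nonneg_right ((summable_geometric_of_lt_one (norm_nonneg _) hq).sum_le_tsum
          _ fun _ _ => by positivity) (norm_nonneg _)

theorem norm_shiftedFactorialInf_le (hq : ‖q‖ < 1) (x : ℂ) :
    ‖shiftedFactorialInf x q‖ ≤ Real.exp (‖x‖ / (1 - ‖q‖)) :=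
  le_of_tendsto ((multipliable_shiftedFactorialInf hq x).hasProd.tendsto_prod_nat.norm)
    (Filter.Eventually.of_forall fun k => norm_shiftedFactorial_le hq x k)

theorem shiftedFactorialInf_ne_zero (hq : ‖q‖ < 1) {x : ℂ} (h : ∀ i : ℕ, q ^ i * x ≠ 1) :
    shiftedFactorialInf x q ≠ 0 := by
  unfold shiftedFactorialInf
  simp only [sub_eq_add_neg]
  refine tprod_one_add_ne_zero_of_summable (fun i => ?_) (summable_pow_mul hq x)
  rw [← sub_eq_add_neg]
  exact sub_ne_zero.2 (h i).symm

/-- The growth of `(c q^ν; q)_∞ / (d q^ν; q)_∞`: it is bounded for `ν ≥ 0`, and `O(|c / d|^(-ν))`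
for `ν ≤ 0`. -/
theorem exists_norm_shiftedFactorialInf_div_le (hq : ‖q‖ < 1) (hq0 : q ≠ 0) {c d : ℂ} (hc : c ≠ 0)
    (hd : d ≠ 0) (h : ∀ ν : ℤ, d ≠ q ^ ν) :
    ∃ C : ℝ, 0 ≤ C ∧ ∀ ν : ℤ, ‖shiftedFactorialInf (c * q ^ ν) q /
      shiftedFactorialInf (d * q ^ ν) q‖ ≤ C * ‖d / c‖ ^ (min ν 0) := by
  have hd' : ∀ (ν : ℤ), d * q ^ ν ≠ 1 := fun ν h0 => h (-ν) (by
    rw [zpow_neg]; exact eq_inv_of_mul_eq_one_left h0)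
  have hinf : ∀ ν : ℤ, shiftedFactorialInf (d * q ^ ν) q ≠ 0 := fun ν =>
    shiftedFactorialInf_ne_zero hq fun i => by
      have := hd' (ν + i)
      rwa [zpow_add₀ hq0, zpow_natCast, ← mul_assoc, mul_comm] at this
  have hinf' : shiftedFactorialInf (q / d) q ≠ 0 :=
    shiftedFactorialInf_ne_zero hq fun i h0 => by
      refine h (i + 1) ?_
      rw [zpow_add_one₀ hq0, zpow_natCast]
      field_simp at h0
      rw [← h0]
  set E : ℂ → ℝ := fun x => Real.exp (‖x‖ / (1 - ‖q‖)) with hE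
  have hEpos : ∀ x, 0 < E x := fun x => Real.exp_pos _
  have hq1 : 0 < 1 - ‖q‖ := by linarith
  have hpow : ∀ k : ℕ, ‖q ^ k‖ ≤ 1 := fun k => by
    rw [norm_pow]; exact pow_le_one₀ (norm_nonneg _) hq.le
  have hmono : ∀ (x : ℂ) (k : ℕ), ‖shiftedFactorialInf (q ^ k * x) q‖ ≤ E x := fun x k => by
    refine (norm_shiftedFactorialInf_le hq _).trans (Real.exp_le_exp.2 ?_)
    refine div_le_div_of_nonneg_right ?_ hq1.le
    rw [norm_mul]
    exact mul_le_of_le_one_left (norm_nonneg _) (hpow k)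
  set C₁ := E c * (E d / ‖shiftedFactorialInf d q‖) with hC₁
  set C₂ := ‖shiftedFactorialInf c q / shiftedFactorialInf d q‖ *
    (E (q / c) * (E (q / d) / ‖shiftedFactorialInf (q / d) q‖)) with hC₂
  have hC₁' : 0 ≤ C₁ := by positivity
  have hC₂' : 0 ≤ C₂ := by positivity
  refine ⟨C₁ + C₂, add_nonneg hC₁' hC₂', fun ν => ?_⟩
  obtain ⟨k, rfl | rfl⟩ := Int.eq_nat_or_neg ν
  · rw [min_eq_right (by omega), zpow_zero, mul_one]
    refine le_trans ?_ (le_add_of_nonneg_right hC₂')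
    rw [norm_div, zpow_natCast, div_eq_mul_inv]
    have h1 := shiftedFactorialInf_eq_shiftedFactorial_mul hq d k
    have h0 := hinf k
    rw [zpow_natCast, mul_comm d] at h0
    have h00 := hinf 0
    rw [zpow_zero, mul_one] at h00
    refine mul_le_mul ?_ ?_ (by positivity) (hEpos _).le
    · rw [mul_comm]; exact hmono c k
    · rw [le_div_iff₀ (norm_pos_iff.2 h00), h1, norm_mul, mul_comm d,
        mul_comm ‖shiftedFactorial d q k‖, inv_mul_cancel_left₀ (norm_ne_zero_iff.2 h0)]
      exact norm_shiftedFactorial_le hq d k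
  · rw [min_eq_left (by omega)]
    have hne : ∀ k : ℕ, shiftedFactorial (q / d) q k ≠ 0 := fun k h0 => by
      apply hinf'
      rw [shiftedFactorialInf_eq_shiftedFactorial_mul hq _ k, h0, zero_mul]
    have key : ∀ k : ℕ, shiftedFactorialInf (c * q ^ (-(k : ℤ))) q /
        shiftedFactorialInf (d * q ^ (-(k : ℤ))) q =
        shiftedFactorialInf c q / shiftedFactorialInf d q *
          ((c / d) ^ k * (shiftedFactorial (q / c) q k / shiftedFactorial (q / d) q k)) := by
      intro k
      induction k with
      | zero => simp [shiftedFactorial_zero]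
      | succ k ih =>
        have e : ∀ x : ℂ, shiftedFactorialInf (x * q ^ (-((k + 1 : ℕ) : ℤ))) q =
            (1 - x * q ^ (-((k + 1 : ℕ) : ℤ))) * shiftedFactorialInf (x * q ^ (-(k : ℤ))) q := by
          intro x
          rw [shiftedFactorialInf_eq_mul hq, mul_left_comm q, ← zpow_one_add₀ hq0]
          congr 4
          push_cast; ring
        have e2 : ∀ x : ℂ, x ≠ 0 → 1 - x * q ^ (-((k + 1 : ℕ) : ℤ)) =
            -(x * q ^ (-((k + 1 : ℕ) : ℤ))) * (1 - q ^ k * (q / x)) := by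
          intro x hx
          rw [zpow_neg, zpow_natCast]
          have := pow_ne_zero (k + 1) hq0
          field_simp
          ring
        have hk := hne (k + 1)
        rw [shiftedFactorial_succ] at hk
        obtain ⟨hk1, hk2⟩ := mul_ne_zero_iff.1 hk
        have hz : q ^ (-((k + 1 : ℕ) : ℤ)) ≠ 0 := zpow_ne_zero _ hq0
        rw [e, e, mul_div_mul_comm, ih, e2 c hc, e2 d hd, shiftedFactorial_succ,
          shiftedFactorial_succ, pow_succ, mul_div_mul_comm, mul_div_mul_comm, neg_div_neg_eq,
          mul_div_mul_right _ _ hz]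
        ring
    rw [key, norm_mul, norm_mul, zpow_neg, zpow_natCast, norm_pow, ← inv_pow, ← norm_inv, inv_div]
    have h1 : ‖shiftedFactorial (q / c) q k / shiftedFactorial (q / d) q k‖ ≤
        E (q / c) * (E (q / d) / ‖shiftedFactorialInf (q / d) q‖) := by
      rw [norm_div, div_eq_mul_inv]
      refine mul_le_mul (norm_shiftedFactorial_le hq _ k) ?_ (by positivity) (hEpos _).le
      rw [le_div_iff₀ (norm_pos_iff.2 hinf'), shiftedFactorialInf_eq_shiftedFactorial_mul hq _ k,
        norm_mul, inv_mul_cancel_left₀ (norm_ne_zero_iff.2 (hne k))]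
      exact hmono _ k
    calc _ = ‖shiftedFactorialInf c q / shiftedFactorialInf d q‖ *
          ‖shiftedFactorial (q / c) q k / shiftedFactorial (q / d) q k‖ * ‖c / d‖ ^ k := by ring
      _ ≤ C₂ * ‖c / d‖ ^ k :=
        mul_le_mul_of_nonneg_right (mul_le_mul_of_nonneg_left h1 (norm_nonneg _)) (by positivity)
      _ ≤ _ := by gcongr; linarith

end QFactorial

section Summability

theorem summable_prod_apply {n : ℕ} {h : Fin n → ℤ → ℝ} (h0 : ∀ i ν, 0 ≤ h i ν)
    (hs : ∀ i, Summable (h i)) : Summable fun ν : Fin n → ℤ => ∏ i, h i (ν i) := by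
  induction n with
  | zero => exact (hasSum_fintype _).summable
  | succ n ih =>
    have h1 := ih (h := fun i => h i.succ) (fun i => h0 _) (fun i => hs _)
    have h2 := (hs 0).mul_of_nonneg h1 (h0 0) fun ν => Finset.prod_nonneg fun i _ => h0 _ _
    rw [← (Fin.consEquiv fun _ => ℤ).summable_iff]
    refine h2.congr fun ν => ?_
    simp [Fin.prod_univ_succ, Fin.consEquiv]

theorem summable_zpow_mul_zpow_min {y B : ℝ} (hy : 0 < y) (hy1 : y < 1) (hB : 0 < B)
    (hyB : 1 < y * B) : Summable fun ν : ℤ => y ^ ν * B ^ (min ν 0) := by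
  refine Summable.of_nat_of_neg ?_ ?_
  · refine (summable_geometric_of_lt_one hy.le hy1).congr fun k => ?_
    rw [min_eq_right (by omega)]; simp
  · refine (summable_geometric_of_lt_one (inv_nonneg.2 (mul_pos hy hB).le)
      (inv_lt_one_of_one_lt₀ hyB)).congr fun k => ?_
    rw [min_eq_left (by omega), ← mul_zpow, zpow_neg, zpow_natCast, inv_pow]

end Summability

/-! ### Products over pairs and a comparison series -/

section Pairs

variable {n : ℕ}

theorem mem_ltPairs {p : Fin n × Fin n} : p ∈ ltPairs n ↔ p.1 < p.2 := by
  simp [ltPairs]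

/-- A product over pairs of a symmetric function is invariant under permutations. -/
theorem prod_ltPairs_comp_perm {M : Type*} [CommMonoid M] (G : Fin n → Fin n → M)
    (hG : ∀ i j, G i j = G j i) (σ : Equiv.Perm (Fin n)) :
    ∏ p ∈ ltPairs n, G (σ p.1) (σ p.2) = ∏ p ∈ ltPairs n, G p.1 p.2 := by
  let e : Equiv.Perm (Fin n) → Fin n × Fin n → Fin n × Fin n := fun σ p =>
    if σ p.1 < σ p.2 then (σ p.1, σ p.2) else (σ p.2, σ p.1)
  have hmem : ∀ (σ : Equiv.Perm (Fin n)), ∀ p ∈ ltPairs n, e σ p ∈ ltPairs n := by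
    intro σ p hp
    rw [mem_ltPairs] at hp ⊢
    simp only [e]
    split_ifs with h
    · exact h
    · exact lt_of_le_of_ne (not_lt.1 h) fun h' => hp.ne' (σ.injective h')
  have hinv : ∀ (σ τ : Equiv.Perm (Fin n)), (∀ i, τ (σ i) = i) → ∀ p ∈ ltPairs n,
      e τ (e σ p) = p := by
    intro σ τ h p hp
    rw [mem_ltPairs] at hp
    by_cases h1 : σ p.1 < σ p.2
    · simp [e, h1, h, hp]
    · simp [e, h1, h, hp.not_gt]
  refine Finset.prod_nbij' (e σ) (e σ⁻¹) (hmem σ) (hmem σ⁻¹) (hinv _ _ (by simp))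
    (hinv _ _ (by simp)) fun p _ => ?_
  simp only [e]
  split_ifs
  · rfl
  · exact hG _ _

/-- In a selection of one entry from each pair, every index is selected at most `n - 1` times. -/
theorem card_filter_ltPairs_le (S : Finset (Fin n × Fin n)) (i : Fin n) :
    ((ltPairs n).filter fun p => (if p ∈ S then p.1 else p.2) = i).card ≤ n - 1 := by
  have : (Finset.univ.erase i).card = n - 1 := by simp
  rw [← this]
  refine Finset.card_le_card_of_injOn (fun p => if p.1 = i then p.2 else p.1) ?_ ?_
  · intro p hp
    obtain ⟨hp1, hp2⟩ := Finset.mem_filter.1 hp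
    rw [mem_ltPairs] at hp1
    simp only [Finset.coe_erase, Finset.coe_univ]
    refine ⟨trivial, ?_⟩
    simp only [Set.mem_singleton_iff]
    split_ifs with h
    · exact fun h' => hp1.ne (h.trans h'.symm)
    · exact h
  · rintro ⟨p1, p2⟩ hp ⟨r1, r2⟩ hr h
    obtain ⟨hp1, hp2⟩ := Finset.mem_filter.1 hp
    obtain ⟨hr1, hr2⟩ := Finset.mem_filter.1 hr
    rw [mem_ltPairs] at hp1 hr1
    simp only at h hp1 hr1
    have hp2' : p1 = i ∨ p2 = i := by split_ifs at hp2 <;> tauto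
    have hr2' : r1 = i ∨ r2 = i := by split_ifs at hr2 <;> tauto
    clear hp2 hr2 hp hr
    rcases hp2' with rfl | rfl <;> rcases hr2' with rfl | rfl <;>
      simp only [if_true, hp1.ne, hr1.ne, if_false] at h
    · rw [h]
    · exact absurd (h ▸ hp1) hr1.not_gt
    · exact absurd (h ▸ hp1) hr1.not_gt
    · rw [h]

theorem zpow_min_le_add {T : ℝ} (hT : 0 < T) (x y : ℤ) : T ^ (min x y) ≤ T ^ x + T ^ y := by
  rcases min_choice x y with h | h <;> rw [h]
  · exact le_add_of_nonneg_right (zpow_nonneg hT.le _)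
  · exact le_add_of_nonneg_left (zpow_nonneg hT.le _)

/-- The minima over pairs are removed by choosing an entry from every pair. -/
theorem prod_zpow_min_le {T : ℝ} (hT : 0 < T) (ν : Fin n → ℤ) :
    ∏ p ∈ ltPairs n, T ^ (min (ν p.1) (ν p.2)) ≤ ∑ S ∈ (ltPairs n).powerset,
      ∏ i, (T ^ ((ltPairs n).filter fun p => (if p ∈ S then p.1 else p.2) = i).card) ^ ν i := by
  calc ∏ p ∈ ltPairs n, T ^ (min (ν p.1) (ν p.2))
      ≤ ∏ p ∈ ltPairs n, (T ^ ν p.1 + T ^ ν p.2) :=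
        Finset.prod_le_prod (fun _ _ => zpow_nonneg hT.le _) fun p _ => zpow_min_le_add hT _ _
    _ = _ := by
        rw [Finset.prod_add]
        refine Finset.sum_congr rfl fun S hS => ?_
        have hS' := Finset.mem_powerset.1 hS
        have h1 : (∏ p ∈ S, T ^ ν p.1) * ∏ p ∈ ltPairs n \ S, T ^ ν p.2 =
            ∏ p ∈ ltPairs n, T ^ ν (if p ∈ S then p.1 else p.2) := by
          rw [← Finset.prod_sdiff hS', mul_comm]
          congr 1
          · refine Finset.prod_congr rfl fun p hp => ?_
            rw [if_neg (Finset.mem_sdiff.1 hp).2]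
          · refine Finset.prod_congr rfl fun p hp => ?_
            rw [if_pos hp]
        rw [h1, ← Finset.prod_fiberwise (ltPairs n) (fun p => if p ∈ S then p.1 else p.2)]
        refine Finset.prod_congr rfl fun i _ => ?_
        rw [Finset.prod_congr rfl fun p hp => by rw [(Finset.mem_filter.1 hp).2],
          Finset.prod_const, ← zpow_natCast, ← zpow_natCast, ← zpow_mul, ← zpow_mul, mul_comm]

/-- If `y` and `y T ^ N` lie in an interval, so do the `y T ^ d` with `d ≤ N`. -/
theorem mul_pow_mem_Ioo {T y x₁ x₂ : ℝ} {N d : ℕ} (hT : 0 < T) (hy : 0 < y) (hd : d ≤ N)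
    (h1 : y ∈ Set.Ioo x₁ x₂) (h2 : y * T ^ N ∈ Set.Ioo x₁ x₂) : y * T ^ d ∈ Set.Ioo x₁ x₂ := by
  rcases le_total T 1 with h | h
  · have e1 : T ^ N ≤ T ^ d := pow_le_pow_of_le_one hT.le h hd
    have e2 : T ^ d ≤ 1 := pow_le_one₀ hT.le h
    exact ⟨h2.1.trans_le (by gcongr), (by nlinarith : y * T ^ d ≤ y).trans_lt h1.2⟩
  · have e1 : T ^ d ≤ T ^ N := pow_le_pow_right₀ h hd
    have e2 : 1 ≤ T ^ d := one_le_pow₀ h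
    exact ⟨h1.1.trans_le (by nlinarith), (by gcongr : y * T ^ d ≤ y * T ^ N).trans_lt h2.2⟩

/-- The comparison series for Jackson integrals of Selberg type. -/
theorem summable_selberg {y T B : ℝ} (hT : 0 < T) (hy : 0 < y) (hB : 0 < B)
    (h1 : y ∈ Set.Ioo B⁻¹ 1) (h2 : y * T ^ (n - 1) ∈ Set.Ioo B⁻¹ 1) :
    Summable fun ν : Fin n → ℤ => (∏ i, (y ^ ν i * B ^ (min (ν i) 0))) *
      ∏ p ∈ ltPairs n, T ^ (min (ν p.1) (ν p.2)) := by
  have hs : Summable fun ν : Fin n → ℤ => ∑ S ∈ (ltPairs n).powerset, ∏ i,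
      ((y * T ^ ((ltPairs n).filter fun p => (if p ∈ S then p.1 else p.2) = i).card) ^ ν i *
        B ^ (min (ν i) 0)) := by
    refine summable_sum fun S _ => summable_prod_apply (h := fun i ν =>
      (y * T ^ ((ltPairs n).filter fun p => (if p ∈ S then p.1 else p.2) = i).card) ^ ν *
        B ^ (min ν 0)) (fun i ν => by positivity) fun i => ?_
    obtain ⟨e1, e2⟩ := mul_pow_mem_Ioo hT hy (card_filter_ltPairs_le S i) h1 h2
    refine summable_zpow_mul_zpow_min (by positivity) e2 hB ?_
    rwa [inv_lt_iff_one_lt_mul₀ hB] at e1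
  refine Summable.of_nonneg_of_le (fun ν => ?_) (fun ν => ?_) hs
  · exact mul_nonneg (Finset.prod_nonneg fun i _ => by positivity)
      (Finset.prod_nonneg fun i _ => by positivity)
  · refine (mul_le_mul_of_nonneg_left (prod_zpow_min_le hT ν)
      (Finset.prod_nonneg fun i _ => by positivity)).trans_eq ?_
    rw [Finset.mul_sum]
    refine Finset.sum_congr rfl fun S _ => ?_
    rw [← Finset.prod_mul_distrib]
    refine Finset.prod_congr rfl fun i _ => ?_
    rw [mul_zpow]
    ring

theorem exists_norm_prod_le {ι N : Type*} (s : Finset ι) (f : ι → N → ℂ) (g : ι → N → ℝ)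
    (h : ∀ i ∈ s, ∃ C : ℝ, 0 ≤ C ∧ ∀ ν, ‖f i ν‖ ≤ C * g i ν) :
    ∃ C : ℝ, 0 ≤ C ∧ ∀ ν, ‖∏ i ∈ s, f i ν‖ ≤ C * ∏ i ∈ s, g i ν := by
  have : ∀ i, ∃ C : ℝ, 0 ≤ C ∧ (i ∈ s → ∀ ν, ‖f i ν‖ ≤ C * g i ν) := fun i => by
    by_cases hi : i ∈ s
    · obtain ⟨C, h0, hC⟩ := h i hi
      exact ⟨C, h0, fun _ => hC⟩
    · exact ⟨0, le_rfl, fun h => absurd h hi⟩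
  choose C h0 hC using this
  refine ⟨∏ i ∈ s, C i, Finset.prod_nonneg fun i _ => h0 i, fun ν => ?_⟩
  rw [norm_prod, ← Finset.prod_mul_distrib]
  exact Finset.prod_le_prod (fun _ _ => norm_nonneg _) fun i hi => hC i hi ν

end Pairs

/-! ### Growth of `Φ` on the lattice -/

section Lattice

variable {n : ℕ} (logq : ℂ) (u : Fin n → ℂ)

theorem exp_mul_latticePoint (s : ℂ) (ν : Fin n → ℤ) (i : Fin n) :
    Complex.exp (s * latticePoint logq u ν i) =
      Complex.exp (s * u i) * Complex.exp (s * logq) ^ ν i := by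
  rw [latticePoint, ← Complex.exp_int_mul, ← Complex.exp_add]
  congr 1
  ring

theorem exp_latticePoint (ν : Fin n → ℤ) (i : Fin n) :
    Complex.exp (latticePoint logq u ν i) = Complex.exp (u i) * Complex.exp logq ^ ν i := by
  simpa using exp_mul_latticePoint logq u 1 ν i

theorem exp_latticePoint_div (ν : Fin n → ℤ) (i j : Fin n) :
    Complex.exp (latticePoint logq u ν i) / Complex.exp (latticePoint logq u ν j) =
      Complex.exp (u i) / Complex.exp (u j) * Complex.exp logq ^ (ν i - ν j) := by
  rw [exp_latticePoint, exp_latticePoint, zpow_sub₀ (Complex.exp_ne_zero _), mul_div_mul_comm]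

theorem exp_two_mul_sub_one_mul (τ logq : ℂ) : Complex.exp ((2 * τ - 1) * logq) =
    Complex.exp (τ * logq) ^ 2 / Complex.exp logq := by
  rw [← Complex.exp_nat_mul, ← Complex.exp_sub]
  congr 1
  push_cast
  ring

/-- The growth of `Φ` on the lattice. -/
theorem exists_norm_selbergPhi_le {τ α a₁ a₂ b₁ b₂ : ℂ} (hq : ‖Complex.exp logq‖ < 1)
    (ha₁ : a₁ ≠ 0) (ha₂ : a₂ ≠ 0) (hb₁ : b₁ ≠ 0) (hb₂ : b₂ ≠ 0)
    (hpoles : LatticeAvoidsPoles (Complex.exp logq) (Complex.exp (τ * logq)) ![b₁, b₂]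
      fun i => Complex.exp (u i)) :
    ∃ C : ℝ, 0 ≤ C ∧ ∀ ν : Fin n → ℤ,
      ‖selbergPhi logq τ α ![a₁, a₂] ![b₁, b₂] (latticePoint logq u ν)‖ ≤
        C * ((∏ i, (‖Complex.exp (α * logq)‖ ^ ν i *
            ‖a₁ * a₂ * b₁ * b₂ / Complex.exp logq ^ 2‖ ^ (min (ν i) 0))) *
          ∏ p ∈ ltPairs n,
            ‖Complex.exp (τ * logq) ^ 2 / Complex.exp logq‖ ^ (min (ν p.1) (ν p.2))) := by
  have hq0 := Complex.exp_ne_zero logq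
  have ht0 := Complex.exp_ne_zero (τ * logq)
  obtain ⟨C₁, hC₁, h₁⟩ := exists_norm_prod_le Finset.univ
    (fun (i : Fin n) (ν : Fin n → ℤ) => Complex.exp (α * latticePoint logq u ν i) *
      ∏ r : Fin 2, shiftedFactorialInf (Complex.exp logq * (![a₁, a₂] r)⁻¹ *
          Complex.exp (latticePoint logq u ν i)) (Complex.exp logq) /
        shiftedFactorialInf (![b₁, b₂] r * Complex.exp (latticePoint logq u ν i))
          (Complex.exp logq))
    (fun i ν => ‖Complex.exp (α * logq)‖ ^ ν i *
      ‖a₁ * a₂ * b₁ * b₂ / Complex.exp logq ^ 2‖ ^ (min (ν i) 0)) (by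
    intro i _
    have hu := Complex.exp_ne_zero (u i)
    obtain ⟨C, hC, h⟩ := exists_norm_shiftedFactorialInf_div_le hq hq0
      (c := Complex.exp logq * a₁⁻¹ * Complex.exp (u i)) (d := b₁ * Complex.exp (u i))
      (by simp [ha₁]) (by simp [hb₁]) (hpoles.1 0 i)
    obtain ⟨C', hC', h'⟩ := exists_norm_shiftedFactorialInf_div_le hq hq0
      (c := Complex.exp logq * a₂⁻¹ * Complex.exp (u i)) (d := b₂ * Complex.exp (u i))
      (by simp [ha₂]) (by simp [hb₂]) (hpoles.1 1 i)
    refine ⟨‖Complex.exp (α * u i)‖ * (C * C'), by positivity, fun ν => ?_⟩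
    rw [exp_mul_latticePoint, exp_latticePoint, Fin.prod_univ_two]
    simp only [Matrix.cons_val_zero, Matrix.cons_val_one]
    have e : ‖a₁ * a₂ * b₁ * b₂ / Complex.exp logq ^ 2‖ =
        ‖b₁ * Complex.exp (u i) / (Complex.exp logq * a₁⁻¹ * Complex.exp (u i))‖ *
        ‖b₂ * Complex.exp (u i) / (Complex.exp logq * a₂⁻¹ * Complex.exp (u i))‖ := by
      rw [← norm_mul]
      congr 1
      field_simp
    have h1 := h (ν i)
    have h2 := h' (ν i)
    rw [mul_assoc (_ * _), mul_assoc b₁] at h1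
    rw [mul_assoc (_ * _), mul_assoc b₂] at h2
    rw [e, mul_zpow, norm_mul, norm_mul (Complex.exp _) (_ ^ _), norm_mul (_ / _) (_ / _),
      norm_zpow]
    exact (mul_le_mul_of_nonneg_left (mul_le_mul h1 h2 (norm_nonneg _) (by positivity))
      (by positivity)).trans_eq (by ring))
  obtain ⟨C₂, hC₂, h₂⟩ := exists_norm_prod_le (ltPairs n)
    (fun (p : Fin n × Fin n) (ν : Fin n → ℤ) =>
      Complex.exp ((2 * τ - 1) * latticePoint logq u ν p.1) *
      (shiftedFactorialInf (Complex.exp logq * (Complex.exp (τ * logq))⁻¹ *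
          (Complex.exp (latticePoint logq u ν p.2) / Complex.exp (latticePoint logq u ν p.1)))
          (Complex.exp logq) /
        shiftedFactorialInf (Complex.exp (τ * logq) *
          (Complex.exp (latticePoint logq u ν p.2) / Complex.exp (latticePoint logq u ν p.1)))
          (Complex.exp logq)))
    (fun p ν => ‖Complex.exp (τ * logq) ^ 2 / Complex.exp logq‖ ^ (min (ν p.1) (ν p.2))) (by
    intro p hp
    have hu1 := Complex.exp_ne_zero (u p.1)
    have hu2 := Complex.exp_ne_zero (u p.2)
    obtain ⟨C, hC, h⟩ := exists_norm_shiftedFactorialInf_div_le hq hq0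
      (c := Complex.exp logq * (Complex.exp (τ * logq))⁻¹ *
        (Complex.exp (u p.2) / Complex.exp (u p.1)))
      (d := Complex.exp (τ * logq) * (Complex.exp (u p.2) / Complex.exp (u p.1)))
      (by simp) (by simp) (fun ν => hpoles.2 p.1 p.2 ν (mem_ltPairs.1 hp))
    refine ⟨‖Complex.exp ((2 * τ - 1) * u p.1)‖ * C, by positivity, fun ν => ?_⟩
    have e : ‖Complex.exp (τ * logq) ^ 2 / Complex.exp logq‖ =
        ‖Complex.exp (τ * logq) * (Complex.exp (u p.2) / Complex.exp (u p.1)) /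
        (Complex.exp logq * (Complex.exp (τ * logq))⁻¹ *
          (Complex.exp (u p.2) / Complex.exp (u p.1)))‖ := by
      congr 1
      field_simp
    have e2 : min (ν p.1) (ν p.2) = ν p.1 + min (ν p.2 - ν p.1) 0 := by omega
    have h1 := h (ν p.2 - ν p.1)
    rw [exp_mul_latticePoint, exp_latticePoint_div, exp_two_mul_sub_one_mul τ logq, e2,
      zpow_add₀ (norm_ne_zero_iff.2 (div_ne_zero (pow_ne_zero 2 ht0) hq0)), norm_mul,
      norm_mul (Complex.exp _) (_ ^ _), norm_zpow]
    rw [← e, mul_assoc (_ * _), mul_assoc (Complex.exp (τ * logq))] at h1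
    simp only [mul_assoc] at h1 ⊢
    refine (mul_le_mul_of_nonneg_left (mul_le_mul_of_nonneg_left h1
      (by positivity)) (by positivity)).trans_eq (by ring))
  refine ⟨C₁ * C₂, mul_nonneg hC₁ hC₂, fun ν => ?_⟩
  unfold selbergPhi
  rw [norm_mul, mul_mul_mul_comm]
  exact mul_le_mul (h₁ ν) (h₂ ν) (norm_nonneg _)
    (mul_nonneg hC₁ (Finset.prod_nonneg fun i _ => by positivity))

/-- The convergence conditions at `α` and at `α + 1` say that `|q^α|` and `|q^α t^(2n-2)|` lie
between `|a₁ a₂ b₁ b₂|⁻¹` and `1`. -/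
theorem ConvergenceCondition.mem_Ioo {τ α a₁ a₂ b₁ b₂ : ℂ}
    (hconv : ConvergenceCondition n logq τ α a₁ a₂ b₁ b₂)
    (hconv' : ConvergenceCondition n logq τ (α + 1) a₁ a₂ b₁ b₂) :
    ‖Complex.exp (α * logq)‖ ∈ Set.Ioo ‖a₁ * a₂ * b₁ * b₂‖⁻¹ 1 ∧
      ‖Complex.exp (α * logq)‖ * ‖Complex.exp (τ * logq)‖ ^ (2 * (n - 1)) ∈
        Set.Ioo ‖a₁ * a₂ * b₁ * b₂‖⁻¹ 1 := by
  have hshift : Complex.exp ((α + 1) * logq) = Complex.exp (α * logq) * Complex.exp logq := by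
    rw [← Complex.exp_add]; congr 1; ring
  have hq0 := Complex.exp_ne_zero logq
  obtain ⟨-, k1, -, k2⟩ := hconv
  obtain ⟨k3, -, k4, -⟩ := hconv'
  rw [hshift] at k3 k4
  have hnorm : ‖Complex.exp logq * a₁⁻¹ * a₂⁻¹ * b₁⁻¹ * b₂⁻¹‖ =
      ‖Complex.exp logq‖ * ‖a₁ * a₂ * b₁ * b₂‖⁻¹ := by
    rw [← norm_inv, ← norm_mul]
    congr 1
    field_simp
  have hqp := norm_pos_iff.2 hq0
  rw [hnorm, norm_mul (Complex.exp _), mul_comm, mul_lt_mul_iff_of_pos_right hqp] at k3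
  rw [hnorm, norm_mul (_ * _) (_ ^ _), norm_mul (Complex.exp _), mul_comm ‖Complex.exp logq‖,
    mul_right_comm ‖Complex.exp (α * logq)‖, mul_lt_mul_iff_of_pos_right hqp,
    ← norm_mul] at k4
  refine ⟨⟨k3, k1⟩, ?_⟩
  rcases Nat.eq_zero_or_pos n with rfl | hn
  · simpa using And.intro k3 k1
  · have e : (2 * (n : ℤ) - 2) = ((2 * (n - 1) : ℕ) : ℤ) := by omega
    rw [e, zpow_natCast, norm_mul _ (_ ^ _), norm_pow] at k2 k4
    exact ⟨k4, k2⟩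

/-- `Φ` times a function of moderate growth is summable on the lattice. -/
theorem summable_mul_selbergPhi {τ α a₁ a₂ b₁ b₂ : ℂ} (hq : ‖Complex.exp logq‖ < 1)
    (ha₁ : a₁ ≠ 0) (ha₂ : a₂ ≠ 0) (hb₁ : b₁ ≠ 0) (hb₂ : b₂ ≠ 0)
    (hpoles : LatticeAvoidsPoles (Complex.exp logq) (Complex.exp (τ * logq)) ![b₁, b₂]
      fun i => Complex.exp (u i))
    (hconv : ConvergenceCondition n logq τ α a₁ a₂ b₁ b₂)
    (hconv' : ConvergenceCondition n logq τ (α + 1) a₁ a₂ b₁ b₂)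
    (g : (Fin n → ℤ) → ℂ)
    (hg : ∃ C : ℝ, 0 ≤ C ∧ ∀ ν, ‖g ν‖ ≤ C * ((∏ i, (‖Complex.exp logq‖ ^ 2) ^ (min (ν i) 0)) *
      ∏ p ∈ ltPairs n, ‖Complex.exp logq‖ ^ (min (ν p.1) (ν p.2)))) :
    Summable fun ν => g ν * selbergPhi logq τ α ![a₁, a₂] ![b₁, b₂] (latticePoint logq u ν) := by
  obtain ⟨C, hC, h⟩ := hg
  obtain ⟨C', hC', h'⟩ := exists_norm_selbergPhi_le (α := α) logq u hq ha₁ ha₂ hb₁ hb₂ hpoles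
  have hq0 := Complex.exp_ne_zero logq
  have ht0 := Complex.exp_ne_zero (τ * logq)
  have hQ0 := Complex.exp_ne_zero (α * logq)
  obtain ⟨h1, h2⟩ := hconv.mem_Ioo logq hconv'
  rw [pow_mul] at h2
  have hs := summable_selberg (n := n) (y := ‖Complex.exp (α * logq)‖)
    (T := ‖Complex.exp (τ * logq)‖ ^ 2) (B := ‖a₁ * a₂ * b₁ * b₂‖) (by positivity) (by positivity)
    (norm_pos_iff.2 (mul_ne_zero (mul_ne_zero (mul_ne_zero ha₁ ha₂) hb₁) hb₂)) h1 h2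
  refine Summable.of_norm_bounded (hs.mul_left (C * C')) fun ν => ?_
  rw [norm_mul]
  refine (mul_le_mul (h ν) (h' ν) (norm_nonneg _) (mul_nonneg hC (mul_nonneg
    (Finset.prod_nonneg fun i _ => by positivity)
    (Finset.prod_nonneg fun i _ => by positivity)))).trans_eq ?_
  rw [mul_mul_mul_comm, mul_mul_mul_comm (∏ i, (‖Complex.exp logq‖ ^ 2) ^ (min (ν i) 0)),
    ← Finset.prod_mul_distrib, ← Finset.prod_mul_distrib]
  congr 2
  · refine Finset.prod_congr rfl fun i _ => ?_
    rw [mul_left_comm, ← mul_zpow, norm_div, norm_pow, mul_div_cancel₀ _ (by positivity)]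
  · refine Finset.prod_congr rfl fun p _ => ?_
    rw [← mul_zpow, norm_div, norm_pow, mul_div_cancel₀ _ (by positivity)]

end Lattice

/-! ### Skew-symmetrized sums and the polynomials of words -/

section SkewSymmetrization

open Letter

section SkewSum

variable {n : ℕ} {N : Type*} (z : N → Fin n → ℂ) (w : N → ℂ)

/-- The sum over the points `z ν` with the weights `w ν` of the skew-symmetrization
`∑_σ sgn(σ) φ(z_{σ(1)}, …, z_{σ(n)})`, with the summation over `σ` outside. -/
noncomputable def skewSum (φ : (Fin n → ℂ) → ℂ) : ℂ :=
  ∑ σ : Equiv.Perm (Fin n), ((Equiv.Perm.sign σ : ℤˣ) : ℂ) * ∑' ν, φ (z ν ∘ σ) * w ν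

/-- All the series in `skewSum` converge. -/
def SkewSummable (φ : (Fin n → ℂ) → ℂ) : Prop :=
  ∀ σ : Equiv.Perm (Fin n), Summable fun ν => φ (z ν ∘ σ) * w ν

variable {z w}

theorem SkewSummable.const_mul {φ : (Fin n → ℂ) → ℂ} (h : SkewSummable z w φ) (c : ℂ) :
    SkewSummable z w fun x => c * φ x := fun σ => by
  simpa only [mul_assoc] using (h σ).mul_left c

theorem SkewSummable.add {φ ψ : (Fin n → ℂ) → ℂ} (h : SkewSummable z w φ)
    (h' : SkewSummable z w ψ) : SkewSummable z w fun x => φ x + ψ x := fun σ => by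
  simpa only [add_mul] using (h σ).add (h' σ)

theorem skewSum_const_mul (φ : (Fin n → ℂ) → ℂ) (c : ℂ) :
    skewSum z w (fun x => c * φ x) = c * skewSum z w φ := by
  unfold skewSum
  rw [Finset.mul_sum]
  refine Finset.sum_congr rfl fun σ _ => ?_
  simp only [mul_assoc, tsum_mul_left]
  ring

theorem skewSum_add {φ ψ : (Fin n → ℂ) → ℂ} (h : SkewSummable z w φ)
    (h' : SkewSummable z w ψ) :
    skewSum z w (fun x => φ x + ψ x) = skewSum z w φ + skewSum z w ψ := by
  unfold skewSum
  rw [← Finset.sum_add_distrib]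
  refine Finset.sum_congr rfl fun σ _ => ?_
  simp only [add_mul]
  rw [(h σ).tsum_add (h' σ), mul_add]

theorem skewSum_comp_perm (φ : (Fin n → ℂ) → ℂ) (ρ : Equiv.Perm (Fin n)) :
    skewSum z w (fun x => φ (x ∘ ρ)) = ((Equiv.Perm.sign ρ : ℤˣ) : ℂ) * skewSum z w φ := by
  unfold skewSum
  rw [Finset.mul_sum]
  refine Fintype.sum_equiv (Equiv.mulRight ρ) _ _ fun σ => ?_
  have h1 : (((Equiv.Perm.sign ρ : ℤˣ) : ℤ) : ℂ) * ((Equiv.Perm.sign ρ : ℤˣ) : ℤ) = 1 := by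
    rw [← Int.cast_mul, ← Units.val_mul, Int.units_mul_self]
    simp
  simp only [Equiv.coe_mulRight, Equiv.Perm.sign_mul, Units.val_mul, Int.cast_mul,
    Equiv.Perm.coe_mul, Function.comp_assoc]
  linear_combination (-(((Equiv.Perm.sign σ : ℤˣ) : ℤ) : ℂ) *
    ∑' ν, φ (z ν ∘ σ ∘ ρ) * w ν) * h1

/-- The skew-symmetrization of a function with a symmetry of sign `-1` vanishes. -/
theorem skewSum_eq_zero {φ : (Fin n → ℂ) → ℂ} {i j : Fin n} (hij : i ≠ j)
    (h : ∀ x, φ (x ∘ Equiv.swap i j) = φ x) : skewSum z w φ = 0 := by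
  have h1 := skewSum_comp_perm (z := z) (w := w) φ (Equiv.swap i j)
  simp only [h, Equiv.Perm.sign_swap hij] at h1
  refine self_eq_neg.1 ?_
  simpa using h1

end SkewSum

section PairProducts

theorem prod_ltPairs_eq {M : Type*} [CommMonoid M] {n : ℕ} (G : Fin n → Fin n → M) :
    ∏ p ∈ ltPairs n, G p.1 p.2 = ∏ i, ∏ j, if i < j then G i j else 1 := by
  rw [ltPairs, Finset.prod_filter, ← Finset.univ_product_univ, Finset.prod_product]

theorem prod_ltPairs_succ {M : Type*} [CommMonoid M] {m : ℕ} (G : Fin (m + 1) → Fin (m + 1) → M) :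
    ∏ p ∈ ltPairs (m + 1), G p.1 p.2 =
      (∏ j : Fin m, G 0 j.succ) * ∏ p ∈ ltPairs m, G p.1.succ p.2.succ := by
  rw [prod_ltPairs_eq, prod_ltPairs_eq fun i j : Fin m => G i.succ j.succ]
  simp [Fin.prod_univ_succ]

theorem prod_ltPairs_castSucc {M : Type*} [CommMonoid M] {m : ℕ}
    (G : Fin (m + 1) → Fin (m + 1) → M) :
    ∏ p ∈ ltPairs (m + 1), G p.1 p.2 =
      (∏ j : Fin m, G j.castSucc (Fin.last m)) *
        ∏ p ∈ ltPairs m, G p.1.castSucc p.2.castSucc := by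
  rw [prod_ltPairs_eq, prod_ltPairs_eq fun i j : Fin m => G i.castSucc j.castSucc]
  simp only [Fin.prod_univ_castSucc, Fin.castSucc_lt_last, Fin.castSucc_lt_castSucc_iff, if_true,
    Finset.prod_mul_distrib, lt_irrefl, if_false, mul_one, (Fin.castSucc_lt_last _).not_gt,
    Finset.prod_const_one]
  rw [mul_comm]

/-- A product over the indices `k ≠ i` as a product over the pairs that contain `i`. -/
theorem prod_ltPairs_mem {M : Type*} [CommMonoid M] {n : ℕ} (i : Fin n) (H : Fin n → M) :
    ∏ p ∈ ltPairs n, (if p.1 = i then H p.2 else if p.2 = i then H p.1 else 1) =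
      ∏ k, if k = i then 1 else H k := by
  have h : ∀ p ∈ ltPairs n, (if p.1 = i then H p.2 else if p.2 = i then H p.1 else 1) =
      (if p.1 = i then H p.2 else 1) * (if p.2 = i then H p.1 else 1) := fun p hp => by
    rw [mem_ltPairs] at hp
    by_cases h1 : p.1 = i
    · rw [if_pos h1, if_pos h1, if_neg (by rw [← h1]; exact hp.ne'), mul_one]
    · rw [if_neg h1, if_neg h1, one_mul]
  rw [Finset.prod_congr rfl h, Finset.prod_mul_distrib,
    prod_ltPairs_eq fun a b => if a = i then H b else 1,
    prod_ltPairs_eq fun a b => if b = i then H a else 1, Finset.prod_comm, ← Finset.prod_mul_distrib]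
  refine Finset.prod_congr rfl fun k _ => ?_
  have e1 : (∏ j, if j < k then (if j = i then H k else 1) else 1) = if i < k then H k else 1 := by
    rw [Finset.prod_eq_single i] <;> simp +contextual
  have e2 : (∏ j, if k < j then (if j = i then H k else 1) else 1) = if k < i then H k else 1 := by
    rw [Finset.prod_eq_single i] <;> simp +contextual
  rw [e1, e2]
  rcases lt_trichotomy k i with h | h | h
  · simp [h, h.ne, h.not_gt]
  · simp [h]
  · simp [h, h.ne', h.not_gt]

theorem prod_ite_eq_perm {M : Type*} [CommMonoid M] {m : ℕ} (σ : Equiv.Perm (Fin (m + 1)))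
    (H : Fin (m + 1) → M) :
    (∏ k, if k = σ 0 then 1 else H k) = ∏ j : Fin m, H (σ j.succ) := by
  rw [← Equiv.prod_comp σ, Fin.prod_univ_succ]
  simp [Fin.succ_ne_zero]

/-- Removing the pair `(i, i + 1)` from a product over pairs leaves a product that is invariant
under the exchange of `i` and `i + 1`. -/
theorem prod_ltPairs_erase_swap {M : Type*} [CommMonoid M] {n : ℕ} {i j : Fin n}
    (hij : (j : ℕ) = i + 1) (G : Fin n → Fin n → M) :
    ∏ p ∈ (ltPairs n).erase (i, j), G (Equiv.swap i j p.1) (Equiv.swap i j p.2) =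
      ∏ p ∈ (ltPairs n).erase (i, j), G p.1 p.2 := by
  have hmem : ∀ p ∈ (ltPairs n).erase (i, j),
      (Equiv.swap i j p.1, Equiv.swap i j p.2) ∈ (ltPairs n).erase (i, j) := by
    rintro ⟨a, b⟩ hp
    rw [Finset.mem_erase, mem_ltPairs] at hp ⊢
    simp only [ne_eq, Prod.mk.injEq, Fin.ext_iff, Fin.lt_def, Equiv.swap_apply_def] at hp ⊢
    split_ifs <;> omega
  exact Finset.prod_nbij' (fun p => (Equiv.swap i j p.1, Equiv.swap i j p.2))
    (fun p => (Equiv.swap i j p.1, Equiv.swap i j p.2)) hmem hmem (by simp) (by simp) (by simp)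

end PairProducts

section WordPoly

/-- The one-variable polynomial that a letter stands for: `a`, `b`, `za`, `zb` are `1 - a₁⁻¹ z`,
`1 - b₂ z`, `z (1 - a₁⁻¹ z)`, `z (1 - b₂ z)`. -/
noncomputable def Letter.eval (a₁ b₂ : ℂ) : Letter → ℂ → ℂ
  | a, z => 1 - a₁⁻¹ * z
  | b, z => 1 - b₂ * z
  | za, z => z * (1 - a₁⁻¹ * z)
  | zb, z => z * (1 - b₂ * z)

/-- The polynomial `∏_j g_j(z_j) ∏_{k<l} (z_k - s z_l)` of a word `g_1 ⋯ g_n`; the letters beyond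
the end of a word that is too short are read as `a`. -/
noncomputable def wordPoly (n : ℕ) (s a₁ b₂ : ℂ) (l : List Letter) (z : Fin n → ℂ) : ℂ :=
  (∏ j : Fin n, (l.getD j a).eval a₁ b₂ (z j)) * ∏ p ∈ ltPairs n, (z p.1 - s * z p.2)

variable {n : ℕ} {s a₁ b₂ : ℂ}

theorem prod_getD_append_cons (u v : List Letter) (x y : Letter) {i : Fin n}
    (hi : (i : ℕ) = u.length) (z : Fin n → ℂ) :
    ∏ j : Fin n, ((u ++ x :: v).getD j a).eval a₁ b₂ (z j) = x.eval a₁ b₂ (z i) *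
      ∏ j ∈ Finset.univ.erase i, ((u ++ y :: v).getD j a).eval a₁ b₂ (z j) := by
  rw [← Finset.mul_prod_erase _ _ (Finset.mem_univ i)]
  congr 1
  · simp [hi]
  · refine Finset.prod_congr rfl fun j hj => ?_
    have hj' : (j : ℕ) ≠ u.length := fun h =>
      (Finset.ne_of_mem_erase hj) (Fin.ext (h.trans hi.symm))
    congr 1
    rcases lt_or_gt_of_ne hj' with h | h
    · rw [List.getD_append _ _ _ _ h, List.getD_append _ _ _ _ h]
    · rw [List.getD_append_right _ _ _ _ h.le, List.getD_append_right _ _ _ _ h.le]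
      obtain ⟨k, hk⟩ := Nat.exists_eq_succ_of_ne_zero (Nat.sub_ne_zero_of_lt h)
      rw [hk, List.getD_cons_succ, List.getD_cons_succ]

theorem wordPoly_subst (u v : List Letter) (hn : u.length + 1 + v.length = n) (z : Fin n → ℂ) :
    wordPoly n s a₁ b₂ (u ++ b :: v) z = wordPoly n s a₁ b₂ (u ++ a :: v) z +
      (a₁⁻¹ * wordPoly n s a₁ b₂ (u ++ zb :: v) z +
        (-b₂) * wordPoly n s a₁ b₂ (u ++ za :: v) z) := by
  have h := fun x => prod_getD_append_cons (n := n) (a₁ := a₁) (b₂ := b₂) u v x a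
    (i := ⟨u.length, by omega⟩) rfl z
  have e : ∀ c, b.eval a₁ b₂ c = a.eval a₁ b₂ c +
      (a₁⁻¹ * zb.eval a₁ b₂ c - b₂ * za.eval a₁ b₂ c) := fun c => by
    simp only [Letter.eval]
    ring
  simp only [wordPoly, h, e]
  ring

/-- The difference of the two sides of `swap_a` or `swap_b` is symmetric in the two variables: it
contains the factor `(z_i - s z_j) (z_j - s z_i)`. -/
theorem wordPoly_swap_comp {x y : Letter} (hxy : ∀ z, y.eval a₁ b₂ z = z * x.eval a₁ b₂ z)
    {t : ℂ} (ht : t * s = 1) (u v : List Letter) (hn : u.length + 2 + v.length = n)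
    (z : Fin n → ℂ) :
    let φ : (Fin n → ℂ) → ℂ := fun z => t * wordPoly n s a₁ b₂ (u ++ x :: y :: v) z +
      (-1) * wordPoly n s a₁ b₂ (u ++ y :: x :: v) z
    φ (z ∘ Equiv.swap ⟨u.length, by omega⟩ ⟨u.length + 1, by omega⟩) = φ z := by
  intro φ
  set i : Fin n := ⟨u.length, by omega⟩ with hi
  set j : Fin n := ⟨u.length + 1, by omega⟩ with hj
  have hij : i ≠ j := by simp [hi, hj]
  set P : (Fin n → ℂ) → ℂ := fun z =>
    ∏ k : Fin n, ((u ++ x :: x :: v).getD k a).eval a₁ b₂ (z k)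
  set R : (Fin n → ℂ) → ℂ := fun z => ∏ p ∈ (ltPairs n).erase (i, j), (z p.1 - s * z p.2)
  have h1 : ∀ z : Fin n → ℂ, ∏ k : Fin n, ((u ++ y :: x :: v).getD k a).eval a₁ b₂ (z k) =
      z i * P z := fun z => by
    simp only [P]
    rw [prod_getD_append_cons u (x :: v) x x (i := i) rfl,
      prod_getD_append_cons u (x :: v) y x (i := i) rfl, hxy, mul_assoc]
  have h2 : ∀ z : Fin n → ℂ, ∏ k : Fin n, ((u ++ x :: y :: v).getD k a).eval a₁ b₂ (z k) =
      z j * P z := fun z => by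
    have e := fun g => prod_getD_append_cons (a₁ := a₁) (b₂ := b₂) (u ++ [x]) v g x (i := j)
      (by simp [hj]) z
    simp only [List.append_assoc, List.singleton_append] at e
    simp only [P]
    rw [e x, e y, hxy, mul_assoc]
  have h3 : ∀ z : Fin n → ℂ, ∏ p ∈ ltPairs n, (z p.1 - s * z p.2) = (z i - s * z j) * R z :=
    fun z => by
      simp only [R]
      exact (Finset.mul_prod_erase (ltPairs n) (fun p => z p.1 - s * z p.2) (a := (i, j))
        (mem_ltPairs.2 (by simp [hi, hj, Fin.lt_def]))).symm
  have hP : P (z ∘ Equiv.swap i j) = P z := by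
    simp only [P]
    rw [← Equiv.prod_comp (Equiv.swap i j)]
    refine Finset.prod_congr rfl fun k _ => ?_
    rw [Function.comp_apply, Equiv.swap_apply_self]
    congr 1
    rcases eq_or_ne k i with rfl | hki
    · rw [Equiv.swap_apply_left]
      simp [hi, hj]
    · rcases eq_or_ne k j with rfl | hkj
      · rw [Equiv.swap_apply_right]
        simp [hi, hj]
      · rw [Equiv.swap_apply_of_ne_of_ne hki hkj]
  have hR : R (z ∘ Equiv.swap i j) = R z :=
    prod_ltPairs_erase_swap (by simp [hi, hj]) fun k l => z k - s * z l
  have hφ : ∀ z, φ z = t * ((z j - s * z i) * (z i - s * z j)) * (P z * R z) := fun z => by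
    simp only [φ, wordPoly, h1, h2, h3]
    linear_combination (z i * P z * (z i - s * z j) * R z) * ht
  rw [hφ, hφ, hP, hR]
  simp only [Function.comp_apply, Equiv.swap_apply_left, Equiv.swap_apply_right]
  ring

end WordPoly

end SkewSymmetrization

/-! ### The `q`-difference equation of `Φ` -/

section Difference

open Letter

section Growth

variable {n : ℕ} {q : ℂ}

theorem zpow_le_zpow_min {r : ℝ} (hr0 : 0 < r) (hr1 : r ≤ 1) (k l : ℤ) : r ^ k ≤ r ^ min k l :=
  zpow_le_zpow_right_of_le_one₀ hr0 hr1 (min_le_left k l)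

theorem one_le_zpow_min_zero {r : ℝ} (hr0 : 0 < r) (hr1 : r ≤ 1) (k : ℤ) : 1 ≤ r ^ min k 0 := by
  simpa using zpow_le_zpow_right_of_le_one₀ hr0 hr1 (min_le_right k 0)

theorem Letter.exists_norm_eval_le (hq : ‖q‖ < 1) (hq0 : q ≠ 0) (a₁ b₂ c : ℂ) (g : Letter) :
    ∃ C : ℝ, 0 ≤ C ∧ ∀ ν : ℤ, ‖g.eval a₁ b₂ (c * q ^ ν)‖ ≤ C * (‖q‖ ^ 2) ^ (min ν 0) := by
  have hr0 := norm_pos_iff.2 hq0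
  have h1 : ∀ (d : ℂ) (ν : ℤ), ‖1 - d * (c * q ^ ν)‖ ≤ (1 + ‖d * c‖) * ‖q‖ ^ (min ν 0) := by
    intro d ν
    refine (norm_sub_le _ _).trans ?_
    rw [← mul_assoc, norm_mul, norm_zpow, norm_one, add_mul, one_mul]
    exact add_le_add (one_le_zpow_min_zero hr0 hq.le ν)
      (mul_le_mul_of_nonneg_left (zpow_le_zpow_min hr0 hq.le ν 0) (norm_nonneg _))
  have h2 : ∀ (d : ℂ) (ν : ℤ), ‖1 - d * (c * q ^ ν)‖ ≤
      (1 + ‖d * c‖) * (‖q‖ ^ 2) ^ (min ν 0) := by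
    intro d ν
    refine (h1 d ν).trans (mul_le_mul_of_nonneg_left ?_ (by positivity))
    rw [← zpow_natCast, ← zpow_mul, mul_comm, zpow_mul, zpow_natCast]
    exact le_self_pow₀ (one_le_zpow_min_zero hr0 hq.le ν) two_ne_zero
  have h3 : ∀ (d : ℂ) (ν : ℤ), ‖c * q ^ ν * (1 - d * (c * q ^ ν))‖ ≤
      (‖c‖ * (1 + ‖d * c‖)) * (‖q‖ ^ 2) ^ (min ν 0) := by
    intro d ν
    rw [norm_mul, norm_mul, norm_zpow, pow_two, mul_zpow, mul_mul_mul_comm]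
    exact mul_le_mul (mul_le_mul_of_nonneg_left (zpow_le_zpow_min hr0 hq.le ν 0) (norm_nonneg _))
      (h1 d ν) (norm_nonneg _) (by positivity)
  cases g
  · exact ⟨_, by positivity, h2 _⟩
  · exact ⟨_, by positivity, h2 _⟩
  · exact ⟨_, by positivity, h3 _⟩
  · exact ⟨_, by positivity, h3 _⟩

theorem norm_mul_zpow_sub_le (hq : ‖q‖ < 1) (hq0 : q ≠ 0) (s c d : ℂ) (k l : ℤ) :
    ‖c * q ^ k - s * (d * q ^ l)‖ ≤ (‖c‖ + ‖s * d‖) * ‖q‖ ^ (min k l) := by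
  have hr0 := norm_pos_iff.2 hq0
  refine (norm_sub_le _ _).trans ?_
  rw [← mul_assoc, norm_mul, norm_mul, norm_zpow, norm_zpow, add_mul]
  refine add_le_add (mul_le_mul_of_nonneg_left (zpow_le_zpow_min hr0 hq.le k l) (norm_nonneg _))
    (mul_le_mul_of_nonneg_left ?_ (norm_nonneg _))
  rw [min_comm]
  exact zpow_le_zpow_min hr0 hq.le l k

/-- The growth of the polynomial of a word on the lattice. -/
theorem exists_norm_wordPoly_le (hq : ‖q‖ < 1) (hq0 : q ≠ 0) (s a₁ b₂ : ℂ) (l : List Letter)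
    (ξ : Fin n → ℂ) (σ : Equiv.Perm (Fin n)) :
    ∃ C : ℝ, 0 ≤ C ∧ ∀ ν : Fin n → ℤ,
      ‖wordPoly n s a₁ b₂ l ((fun i => ξ i * q ^ ν i) ∘ σ)‖ ≤
        C * ((∏ i, (‖q‖ ^ 2) ^ (min (ν i) 0)) *
          ∏ p ∈ ltPairs n, ‖q‖ ^ (min (ν p.1) (ν p.2))) := by
  obtain ⟨C₁, hC₁, h₁⟩ := exists_norm_prod_le Finset.univ
    (fun (j : Fin n) (ν : Fin n → ℤ) =>
      (l.getD j a).eval a₁ b₂ (ξ (σ j) * q ^ ν (σ j)))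
    (fun j ν => (‖q‖ ^ 2) ^ (min (ν (σ j)) 0)) (fun j _ => by
      obtain ⟨C, hC, h⟩ := Letter.exists_norm_eval_le hq hq0 a₁ b₂ (ξ (σ j)) (l.getD j a)
      exact ⟨C, hC, fun ν => h _⟩)
  obtain ⟨C₂, hC₂, h₂⟩ := exists_norm_prod_le (ltPairs n)
    (fun (p : Fin n × Fin n) (ν : Fin n → ℤ) =>
      ξ (σ p.1) * q ^ ν (σ p.1) - s * (ξ (σ p.2) * q ^ ν (σ p.2)))
    (fun p ν => ‖q‖ ^ (min (ν (σ p.1)) (ν (σ p.2))))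
    (fun p _ => ⟨_, by positivity, fun ν => norm_mul_zpow_sub_le hq hq0 _ _ _ _ _⟩)
  refine ⟨C₁ * C₂, mul_nonneg hC₁ hC₂, fun ν => ?_⟩
  rw [← Equiv.prod_comp σ, ← prod_ltPairs_comp_perm (fun i j => ‖q‖ ^ (min (ν i) (ν j)))
    (fun i j => by rw [min_comm]) σ, mul_mul_mul_comm, wordPoly, norm_mul]
  exact mul_le_mul (h₁ ν) (h₂ ν) (norm_nonneg _)
    (mul_nonneg hC₁ (Finset.prod_nonneg fun i _ => by positivity))

end Growth

section Shift

variable {n : ℕ} {logq τ : ℂ}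

theorem LatticeAvoidsPoles.latticePoint {m : ℕ} {b : Fin m → ℂ} {u : Fin n → ℂ}
    (h : LatticeAvoidsPoles (Complex.exp logq) (Complex.exp (τ * logq)) b
      fun i => Complex.exp (u i)) (ν : Fin n → ℤ) :
    LatticeAvoidsPoles (Complex.exp logq) (Complex.exp (τ * logq)) b
      fun i => Complex.exp (_root_.latticePoint logq u ν i) := by
  have hq0 := Complex.exp_ne_zero logq
  refine ⟨fun r i k hk => h.1 r i (k - ν i) ?_, fun i j k hij hk => h.2 i j (k - (ν j - ν i)) hij ?_⟩
  · simp only [exp_latticePoint, ← mul_assoc] at hk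
    rw [zpow_sub₀ hq0, eq_div_iff (zpow_ne_zero _ hq0), hk]
  · simp only [exp_latticePoint_div, ← mul_assoc] at hk
    rw [zpow_sub₀ hq0, eq_div_iff (zpow_ne_zero _ hq0), hk]

theorem latticePoint_add_single (u : Fin n → ℂ) (ν : Fin n → ℤ) (i : Fin n) :
    latticePoint logq u (ν + Pi.single i 1) =
      Function.update (latticePoint logq u ν) i (latticePoint logq u ν i + logq) := by
  funext k
  rcases eq_or_ne k i with rfl | hk
  · simp [latticePoint]; ring
  · simp [latticePoint, hk]

/-- The shift `x ↦ q x` of a quotient of infinite shifted factorials. The numerator may vanish. -/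
theorem one_sub_mul_shiftedFactorialInf_div {q : ℂ} (hq : ‖q‖ < 1) (c d x : ℂ)
    (h : 1 - d * x ≠ 0) :
    (1 - c * x) * (shiftedFactorialInf (c * (q * x)) q / shiftedFactorialInf (d * (q * x)) q) =
      (1 - d * x) * (shiftedFactorialInf (c * x) q / shiftedFactorialInf (d * x) q) := by
  rw [shiftedFactorialInf_eq_mul hq (c * x), shiftedFactorialInf_eq_mul hq (d * x),
    mul_left_comm c, mul_left_comm d, mul_div_mul_comm, ← mul_assoc (1 - d * x),
    mul_div_cancel₀ _ h]

/-- The `q`-difference equation of `Φ`, symmetric in the variables other than `z_i`. -/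
theorem selbergPhi_update {α a₁ a₂ b₁ b₂ : ℂ} (hq : ‖Complex.exp logq‖ < 1) (u : Fin n → ℂ)
    (hpoles : LatticeAvoidsPoles (Complex.exp logq) (Complex.exp (τ * logq)) ![b₁, b₂]
      fun i => Complex.exp (u i)) (i : Fin n) :
    (1 - Complex.exp logq * a₁⁻¹ * Complex.exp (u i)) *
        (1 - Complex.exp logq * a₂⁻¹ * Complex.exp (u i)) *
        (∏ k, if k = i then 1 else
          Complex.exp logq * Complex.exp (u i) - Complex.exp (τ * logq) * Complex.exp (u k)) *
        selbergPhi logq τ α ![a₁, a₂] ![b₁, b₂] (Function.update u i (u i + logq)) =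
      Complex.exp (α * logq) * ((1 - b₁ * Complex.exp (u i)) * (1 - b₂ * Complex.exp (u i))) *
        (∏ k, if k = i then 1 else Complex.exp (τ * logq) ^ 2 *
          (Complex.exp (u i) - (Complex.exp (τ * logq))⁻¹ * Complex.exp (u k))) *
        selbergPhi logq τ α ![a₁, a₂] ![b₁, b₂] u := by
  have hE : Complex.exp ((2 * τ - 1) * (u i + logq)) = Complex.exp ((2 * τ - 1) * u i) *
      (Complex.exp (τ * logq) ^ 2 / Complex.exp logq) := by
    rw [← exp_two_mul_sub_one_mul, ← Complex.exp_add, mul_add]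
  have hα : Complex.exp (α * (u i + logq)) = Complex.exp (α * u i) * Complex.exp (α * logq) := by
    rw [← Complex.exp_add, mul_add]
  have hq0 := Complex.exp_ne_zero logq
  have ht0 := Complex.exp_ne_zero (τ * logq)
  have hp1 : ∀ r, 1 - ![b₁, b₂] r * Complex.exp (u i) ≠ 0 := fun r h0 =>
    hpoles.1 r i 0 (by rw [zpow_zero]; exact (sub_eq_zero.1 h0).symm)
  unfold selbergPhi
  simp only
  set q := Complex.exp logq with hqdef
  set t := Complex.exp (τ * logq) with htdef
  have hupd : Complex.exp (u i + logq) = q * Complex.exp (u i) := by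
    rw [Complex.exp_add, mul_comm]
  set v := Function.update u i (u i + logq) with hv
  have hvi : v i = u i + logq := Function.update_self _ _ _
  have hvk : ∀ k, k ≠ i → v k = u k := fun k hk => Function.update_of_ne hk _ _
  have hs : ∀ x : Fin n → ℂ, (∏ k, Complex.exp (α * x k) * ∏ r : Fin 2, shiftedFactorialInf
      (q * (![a₁, a₂] r)⁻¹ * Complex.exp (x k)) q /
        shiftedFactorialInf (![b₁, b₂] r * Complex.exp (x k)) q) = _ * _ :=
    fun x => (Finset.mul_prod_erase _ _ (Finset.mem_univ i)).symm
  rw [← prod_ltPairs_mem i, ← prod_ltPairs_mem i, hs u, hs v,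
    Finset.prod_congr (s₁ := Finset.univ.erase i) rfl fun k hk => by
      rw [hvk k (Finset.ne_of_mem_erase hk)]]
  have hS : (1 - q * a₁⁻¹ * Complex.exp (u i)) * (1 - q * a₂⁻¹ * Complex.exp (u i)) *
      (Complex.exp (α * v i) * ∏ r : Fin 2, shiftedFactorialInf (q * (![a₁, a₂] r)⁻¹ *
        Complex.exp (v i)) q / shiftedFactorialInf (![b₁, b₂] r * Complex.exp (v i)) q) =
      Complex.exp (α * logq) * ((1 - b₁ * Complex.exp (u i)) * (1 - b₂ * Complex.exp (u i))) *
      (Complex.exp (α * u i) * ∏ r : Fin 2, shiftedFactorialInf (q * (![a₁, a₂] r)⁻¹ *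
        Complex.exp (u i)) q / shiftedFactorialInf (![b₁, b₂] r * Complex.exp (u i)) q) := by
    rw [hvi, hα, hupd, Fin.prod_univ_two, Fin.prod_univ_two]
    have h0 := one_sub_mul_shiftedFactorialInf_div hq (q * a₁⁻¹) b₁ _ (hp1 0)
    have h1 := one_sub_mul_shiftedFactorialInf_div hq (q * a₂⁻¹) b₂ _ (hp1 1)
    simp only [Matrix.cons_val_zero, Matrix.cons_val_one]
    linear_combination Complex.exp (α * logq) * Complex.exp (α * u i) *
      (congrArg₂ (· * ·) h0 h1)
  have hG : ∀ p ∈ ltPairs n,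
      (if p.1 = i then q * Complex.exp (u i) - t * Complex.exp (u p.2) else
        if p.2 = i then q * Complex.exp (u i) - t * Complex.exp (u p.1) else 1) *
      (Complex.exp ((2 * τ - 1) * v p.1) *
        (shiftedFactorialInf (q * t⁻¹ * (Complex.exp (v p.2) / Complex.exp (v p.1))) q /
          shiftedFactorialInf (t * (Complex.exp (v p.2) / Complex.exp (v p.1))) q)) =
      (if p.1 = i then t ^ 2 * (Complex.exp (u i) - t⁻¹ * Complex.exp (u p.2)) else
        if p.2 = i then t ^ 2 * (Complex.exp (u i) - t⁻¹ * Complex.exp (u p.1)) else 1) *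
      (Complex.exp ((2 * τ - 1) * u p.1) *
        (shiftedFactorialInf (q * t⁻¹ * (Complex.exp (u p.2) / Complex.exp (u p.1))) q /
          shiftedFactorialInf (t * (Complex.exp (u p.2) / Complex.exp (u p.1))) q)) := by
    rintro ⟨j, k⟩ hp
    rw [mem_ltPairs] at hp
    simp only at hp ⊢
    have hj := Complex.exp_ne_zero (u j)
    have hk := Complex.exp_ne_zero (u k)
    by_cases hji : j = i
    · subst hji
      rw [if_pos rfl, if_pos rfl, hvi, hvk k hp.ne', hE, hupd]
      have hx : Complex.exp (u k) / Complex.exp (u j) =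
          q * (Complex.exp (u k) / (q * Complex.exp (u j))) := by field_simp
      have hne : 1 - t * (Complex.exp (u k) / (q * Complex.exp (u j))) ≠ 0 := fun h0 => by
        refine hpoles.2 j k 1 hp ?_
        simp only [zpow_one]
        rw [hx, mul_left_comm, (sub_eq_zero.1 h0).symm, mul_one]
      have h := one_sub_mul_shiftedFactorialInf_div hq (q * t⁻¹) t _ hne
      rw [← hx] at h
      have e1 : q * Complex.exp (u j) - t * Complex.exp (u k) =
          q * Complex.exp (u j) * (1 - t * (Complex.exp (u k) / (q * Complex.exp (u j)))) := by
        field_simp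
      have e2 : t ^ 2 * (Complex.exp (u j) - t⁻¹ * Complex.exp (u k)) = t ^ 2 * Complex.exp (u j) *
          (1 - q * t⁻¹ * (Complex.exp (u k) / (q * Complex.exp (u j)))) := by
        field_simp
      have e3 : q * (t ^ 2 / q) = t ^ 2 := mul_div_cancel₀ _ hq0
      rw [e1, e2]
      linear_combination (-(t ^ 2 * Complex.exp (u j) * Complex.exp ((2 * τ - 1) * u j))) * h +
        (Complex.exp (u j) * (1 - t * (Complex.exp (u k) / (q * Complex.exp (u j)))) *
          Complex.exp ((2 * τ - 1) * u j) *
          (shiftedFactorialInf (q * t⁻¹ * (Complex.exp (u k) / (q * Complex.exp (u j)))) q /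
            shiftedFactorialInf (t * (Complex.exp (u k) / (q * Complex.exp (u j)))) q)) * e3
    · by_cases hki : k = i
      · subst hki
        rw [if_neg hji, if_pos rfl, if_neg hji, if_pos rfl, hvi, hvk j hji, hupd, mul_div_assoc q]
        have hne : 1 - t * (Complex.exp (u k) / Complex.exp (u j)) ≠ 0 := fun h0 =>
          hpoles.2 j k 0 hp (by rw [zpow_zero]; exact (sub_eq_zero.1 h0).symm)
        have h := one_sub_mul_shiftedFactorialInf_div hq (q * t⁻¹) t _ hne
        have e1 : q * Complex.exp (u k) - t * Complex.exp (u j) = -t * Complex.exp (u j) *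
            (1 - q * t⁻¹ * (Complex.exp (u k) / Complex.exp (u j))) := by
          field_simp
          ring
        have e2 : t ^ 2 * (Complex.exp (u k) - t⁻¹ * Complex.exp (u j)) = -t * Complex.exp (u j) *
            (1 - t * (Complex.exp (u k) / Complex.exp (u j))) := by
          field_simp
          ring
        rw [e1, e2]
        linear_combination (-t * Complex.exp (u j) * Complex.exp ((2 * τ - 1) * u j)) * h
      · rw [if_neg hji, if_neg hki, if_neg hji, if_neg hki, hvk j hji, hvk k hki]
  have hG' := (Finset.prod_mul_distrib.symm.trans (Finset.prod_congr rfl hG)).trans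
    Finset.prod_mul_distrib
  linear_combination (∏ k ∈ Finset.univ.erase i, (Complex.exp (α * u k) * ∏ r : Fin 2,
    shiftedFactorialInf (q * (![a₁, a₂] r)⁻¹ * Complex.exp (u k)) q /
      shiftedFactorialInf (![b₁, b₂] r * Complex.exp (u k)) q)) * congrArg₂ (· * ·) hS hG'

end Shift

end Difference

/-! ### Jackson sums of words -/

section WordSums

open Letter

section Cyc

variable {m : ℕ} {s a₁ b₂ : ℂ}

theorem wordPoly_cons (g : Letter) (w : List Letter) (x : Fin (m + 1) → ℂ) :
    wordPoly (m + 1) s a₁ b₂ (g :: w) x = g.eval a₁ b₂ (x 0) *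
      (∏ j : Fin m, (x 0 - s * x j.succ)) * wordPoly m s a₁ b₂ w (x ∘ Fin.succ) := by
  rw [wordPoly, wordPoly, Fin.prod_univ_succ, prod_ltPairs_succ fun i j => x i - s * x j]
  simp only [Fin.val_zero, Fin.val_succ, List.getD_cons_zero, List.getD_cons_succ,
    Function.comp_apply]
  ring

/-- The last letter of a word in front: the rotation of the variables turns the factors
`z_k - s z_n` into `z_k - s z_1`. -/
theorem wordPoly_append_comp_finRotate (g : Letter) (w : List Letter) (hw : w.length = m)
    (x : Fin (m + 1) → ℂ) :
    wordPoly (m + 1) s a₁ b₂ (w ++ [g]) (x ∘ finRotate (m + 1)) = g.eval a₁ b₂ (x 0) *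
      (∏ j : Fin m, (x j.succ - s * x 0)) * wordPoly m s a₁ b₂ w (x ∘ Fin.succ) := by
  have h1 : ∀ j : Fin m, (x ∘ finRotate (m + 1)) j.castSucc = x j.succ := fun j => by
    rw [Function.comp_apply, finRotate_apply, Fin.coeSucc_eq_succ]
  have h2 : (x ∘ finRotate (m + 1)) (Fin.last m) = x 0 := by
    rw [Function.comp_apply, finRotate_last]
  rw [wordPoly, wordPoly, Fin.prod_univ_castSucc, prod_ltPairs_castSucc fun i j =>
    (x ∘ finRotate (m + 1)) i - s * (x ∘ finRotate (m + 1)) j, h2]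
  simp only [h1, Fin.val_last, Fin.val_castSucc, Function.comp_apply]
  have h3 : (w ++ [g]).getD m a = g := by
    rw [List.getD_append_right _ _ _ _ hw.le, hw, Nat.sub_self]; rfl
  have h4 : ∀ j : Fin m, (w ++ [g]).getD j a = w.getD j a := fun j =>
    List.getD_append _ _ _ _ (by omega)
  simp only [h3, h4]
  ring

end Cyc

section Jackson

variable {n : ℕ} {logq τ α a₁ a₂ b₁ b₂ : ℂ} {u : Fin n → ℂ}

theorem skewSummable_wordPoly (hq : ‖Complex.exp logq‖ < 1)
    (ha₁ : a₁ ≠ 0) (ha₂ : a₂ ≠ 0) (hb₁ : b₁ ≠ 0) (hb₂ : b₂ ≠ 0)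
    (hpoles : LatticeAvoidsPoles (Complex.exp logq) (Complex.exp (τ * logq)) ![b₁, b₂]
      fun i => Complex.exp (u i))
    (hconv : ConvergenceCondition n logq τ α a₁ a₂ b₁ b₂)
    (hconv' : ConvergenceCondition n logq τ (α + 1) a₁ a₂ b₁ b₂) (s : ℂ) (l : List Letter) :
    SkewSummable (fun ν i => Complex.exp (latticePoint logq u ν i))
      (fun ν => selbergPhi logq τ α ![a₁, a₂] ![b₁, b₂] (latticePoint logq u ν))
      (wordPoly n s a₁ b₂ l) := by
  intro σ
  refine summable_mul_selbergPhi logq u hq ha₁ ha₂ hb₁ hb₂ hpoles hconv hconv' _ ?_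
  simp only [exp_latticePoint]
  exact exists_norm_wordPoly_le hq (Complex.exp_ne_zero _) s a₁ b₂ l _ σ

/-- Exactness: the sum over the lattice does not change under the shift of the variable that the
permutation `σ` puts in the first place, and by `selbergPhi_update` this shift turns the
polynomials of the words `w a`, `w za` into those of `b w`, `zb w`. -/
theorem tsum_wordPoly_finRotate {m : ℕ} {u : Fin (m + 1) → ℂ} (hq : ‖Complex.exp logq‖ < 1)
    (hpoles : LatticeAvoidsPoles (Complex.exp logq) (Complex.exp (τ * logq)) ![b₁, b₂]
      fun i => Complex.exp (u i)) (w : List Letter) (hw : w.length = m)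
    (σ : Equiv.Perm (Fin (m + 1))) :
    let s := (Complex.exp (τ * logq))⁻¹
    let z : (Fin (m + 1) → ℤ) → Fin (m + 1) → ℂ := fun ν i =>
      Complex.exp (latticePoint logq u ν i)
    let Φ : (Fin (m + 1) → ℤ) → ℂ := fun ν =>
      selbergPhi logq τ α ![a₁, a₂] ![b₁, b₂] (latticePoint logq u ν)
    ∑' ν, (wordPoly (m + 1) s a₁ b₂ (w ++ [a]) (z ν ∘ σ ∘ finRotate (m + 1)) +
        (-a₂⁻¹) * wordPoly (m + 1) s a₁ b₂ (w ++ [za]) (z ν ∘ σ ∘ finRotate (m + 1))) * Φ ν =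
      (-1) ^ m * (Complex.exp (α * logq) * Complex.exp (τ * logq) ^ m) *
        ∑' ν, (wordPoly (m + 1) s a₁ b₂ (b :: w) (z ν ∘ σ) +
          (-b₁) * wordPoly (m + 1) s a₁ b₂ (zb :: w) (z ν ∘ σ)) * Φ ν := by
  intro s z Φ
  have ht0 := Complex.exp_ne_zero (τ * logq)
  rw [← (Equiv.addRight (Pi.single (σ 0) (1 : ℤ))).tsum_eq, ← tsum_mul_left]
  refine tsum_congr fun ν => ?_
  have hz0 : z (ν + Pi.single (σ 0) 1) (σ 0) = Complex.exp logq * z ν (σ 0) := by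
    simp only [z, latticePoint_add_single, Function.update_self, Complex.exp_add, mul_comm]
  have hzs : ∀ j : Fin m, z (ν + Pi.single (σ 0) 1) (σ j.succ) = z ν (σ j.succ) := fun j => by
    simp only [z, latticePoint_add_single]
    rw [Function.update_of_ne (fun h => Fin.succ_ne_zero j (σ.injective h))]
  have hzs' : (z (ν + Pi.single (σ 0) 1) ∘ σ) ∘ Fin.succ = (z ν ∘ σ) ∘ Fin.succ := funext hzs
  have h := selbergPhi_update (α := α) (a₁ := a₁) (a₂ := a₂) hq _ (hpoles.latticePoint ν) (σ 0)
  rw [← latticePoint_add_single, prod_ite_eq_perm σ, prod_ite_eq_perm σ, Finset.prod_mul_distrib,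
    Finset.prod_const, Finset.card_fin] at h
  simp only [Equiv.coe_addRight, ← Function.comp_assoc]
  rw [wordPoly_append_comp_finRotate _ _ hw, wordPoly_append_comp_finRotate _ _ hw,
    wordPoly_cons, wordPoly_cons, hzs']
  simp only [Function.comp_apply, hz0, hzs, Letter.eval]
  have e : ∏ j : Fin m, (z ν (σ j.succ) - s * (Complex.exp logq * z ν (σ 0))) =
      (-s) ^ m * ∏ j : Fin m, (Complex.exp logq * z ν (σ 0) -
        Complex.exp (τ * logq) * z ν (σ j.succ)) := by
    have : (-s) ^ m = ∏ _j : Fin m, (-s) := by simp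
    rw [this, ← Finset.prod_mul_distrib]
    refine Finset.prod_congr rfl fun j _ => ?_
    simp only [s]
    field_simp
    ring
  have e2 : (-s) ^ m * (Complex.exp (τ * logq) ^ 2) ^ m =
      (-1) ^ m * Complex.exp (τ * logq) ^ m := by
    rw [← mul_pow, ← mul_pow]
    congr 1
    simp only [s]
    field_simp
  rw [e]
  generalize wordPoly m s a₁ b₂ w _ = W
  simp only [z, Φ] at h ⊢
  linear_combination ((-s) ^ m * W) * h + (Complex.exp (α * logq) *
    ((1 - b₁ * Complex.exp (latticePoint logq u ν (σ 0))) *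
      (1 - b₂ * Complex.exp (latticePoint logq u ν (σ 0)))) *
    (∏ j : Fin m, (Complex.exp (latticePoint logq u ν (σ 0)) -
      s * Complex.exp (latticePoint logq u ν (σ j.succ)))) * W *
    selbergPhi logq τ α ![a₁, a₂] ![b₁, b₂] (latticePoint logq u ν)) * e2

/-- The Jackson sum of the skew-symmetrized polynomial of a word, times `Φ`. -/
noncomputable def wordSum (logq τ α a₁ a₂ b₁ b₂ : ℂ) (u : Fin n → ℂ) (l : List Letter) : ℂ :=
  skewSum (fun ν i => Complex.exp (latticePoint logq u ν i))
    (fun ν => selbergPhi logq τ α ![a₁, a₂] ![b₁, b₂] (latticePoint logq u ν))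
    (wordPoly n (Complex.exp (τ * logq))⁻¹ a₁ b₂ l)

/-- The Jackson sums of words form a word functional: `swap_a` and `swap_b` hold because the
difference of the two polynomials is symmetric in two neighbouring variables, `cyc` by exactness,
after a cyclic rotation of the variables. -/
theorem isWordFunctional_wordSum (hq : ‖Complex.exp logq‖ < 1)
    (ha₁ : a₁ ≠ 0) (ha₂ : a₂ ≠ 0) (hb₁ : b₁ ≠ 0) (hb₂ : b₂ ≠ 0)
    (hpoles : LatticeAvoidsPoles (Complex.exp logq) (Complex.exp (τ * logq)) ![b₁, b₂]
      fun i => Complex.exp (u i))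
    (hconv : ConvergenceCondition n logq τ α a₁ a₂ b₁ b₂)
    (hconv' : ConvergenceCondition n logq τ (α + 1) a₁ a₂ b₁ b₂) :
    IsWordFunctional n (Complex.exp (τ * logq)) (Complex.exp (α * logq)) a₁ a₂ b₁ b₂
      (wordSum logq τ α a₁ a₂ b₁ b₂ u) := by
  have ht0 := Complex.exp_ne_zero (τ * logq)
  have hS := skewSummable_wordPoly hq ha₁ ha₂ hb₁ hb₂ hpoles hconv hconv'
    (Complex.exp (τ * logq))⁻¹
  have hswap : ∀ x y : Letter, (∀ z, y.eval a₁ b₂ z = z * x.eval a₁ b₂ z) →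
      ∀ u' v : List Letter, u'.length + 2 + v.length = n →
      Complex.exp (τ * logq) * wordSum logq τ α a₁ a₂ b₁ b₂ u (u' ++ x :: y :: v) =
        wordSum logq τ α a₁ a₂ b₁ b₂ u (u' ++ y :: x :: v) := by
    intro x y hxy u' v hn
    have h0 := skewSum_eq_zero (z := fun ν i => Complex.exp (latticePoint logq u ν i))
      (w := fun ν => selbergPhi logq τ α ![a₁, a₂] ![b₁, b₂] (latticePoint logq u ν))
      (φ := fun z => Complex.exp (τ * logq) * wordPoly n (Complex.exp (τ * logq))⁻¹ a₁ b₂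
          (u' ++ x :: y :: v) z +
        (-1) * wordPoly n (Complex.exp (τ * logq))⁻¹ a₁ b₂ (u' ++ y :: x :: v) z)
      (i := ⟨u'.length, by omega⟩) (j := ⟨u'.length + 1, by omega⟩) (by simp)
      (wordPoly_swap_comp hxy (mul_inv_cancel₀ ht0) u' v hn)
    rw [skewSum_add ((hS _).const_mul _) ((hS _).const_mul _), skewSum_const_mul,
      skewSum_const_mul] at h0
    simp only [wordSum]
    linear_combination h0
  refine ⟨fun u' v hn => ?_, hswap a za fun z => rfl, hswap b zb fun z => rfl, fun w hw => ?_⟩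
  · have h : wordPoly n (Complex.exp (τ * logq))⁻¹ a₁ b₂ (u' ++ b :: v) = _ :=
      funext fun z => wordPoly_subst u' v hn z
    unfold wordSum
    rw [h, skewSum_add (hS _) (((hS _).const_mul _).add ((hS _).const_mul _)),
      skewSum_add ((hS _).const_mul _) ((hS _).const_mul _), skewSum_const_mul, skewSum_const_mul]
    ring
  · subst hw
    have h := skewSum_comp_perm (z := fun ν i => Complex.exp (latticePoint logq u ν i))
      (w := fun ν => selbergPhi logq τ α ![a₁, a₂] ![b₁, b₂] (latticePoint logq u ν))
      (fun x => wordPoly (w.length + 1) (Complex.exp (τ * logq))⁻¹ a₁ b₂ (w ++ [a]) x +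
        (-a₂⁻¹) * wordPoly (w.length + 1) (Complex.exp (τ * logq))⁻¹ a₁ b₂ (w ++ [za]) x)
      (finRotate (w.length + 1))
    have h' : skewSum (fun ν i => Complex.exp (latticePoint logq u ν i))
        (fun ν => selbergPhi logq τ α ![a₁, a₂] ![b₁, b₂] (latticePoint logq u ν))
        (fun x => wordPoly (w.length + 1) (Complex.exp (τ * logq))⁻¹ a₁ b₂ (w ++ [a])
            (x ∘ finRotate (w.length + 1)) +
          (-a₂⁻¹) * wordPoly (w.length + 1) (Complex.exp (τ * logq))⁻¹ a₁ b₂ (w ++ [za])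
            (x ∘ finRotate (w.length + 1))) =
        (-1) ^ w.length * (Complex.exp (α * logq) * Complex.exp (τ * logq) ^ w.length) *
          skewSum (fun ν i => Complex.exp (latticePoint logq u ν i))
          (fun ν => selbergPhi logq τ α ![a₁, a₂] ![b₁, b₂] (latticePoint logq u ν))
          (fun x => wordPoly (w.length + 1) (Complex.exp (τ * logq))⁻¹ a₁ b₂ (b :: w) x +
            (-b₁) * wordPoly (w.length + 1) (Complex.exp (τ * logq))⁻¹ a₁ b₂ (zb :: w) x) := by
      unfold skewSum
      rw [Finset.mul_sum]
      refine Finset.sum_congr rfl fun σ _ => ?_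
      rw [mul_left_comm]
      congr 1
      exact tsum_wordPoly_finRotate hq hpoles w rfl σ
    rw [h', sign_finRotate, skewSum_add (hS _) ((hS _).const_mul _),
      skewSum_add (hS _) ((hS _).const_mul _), skewSum_const_mul, skewSum_const_mul] at h
    have hsgn : ((-1 : ℂ) ^ w.length) * (-1) ^ w.length = 1 := by
      rw [← mul_pow]; simp
    push_cast at h
    replace h := congrArg (fun c => (-1) ^ w.length * c) h
    simp only [← mul_assoc, hsgn, one_mul] at h
    simp only [wordSum]
    linear_combination -h

end Jackson

end WordSums

/-! ### The shift of `α` -/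

section AlphaShift

open Letter

variable {n : ℕ}

theorem SkewSummable.hasSum {N : Type*} {z : N → Fin n → ℂ} {w : N → ℂ} {φ : (Fin n → ℂ) → ℂ}
    (h : SkewSummable z w φ) :
    HasSum (fun ν => (∑ σ : Equiv.Perm (Fin n), ((Equiv.Perm.sign σ : ℤˣ) : ℂ) * φ (z ν ∘ σ)) *
      w ν) (skewSum z w φ) := by
  simp only [Finset.sum_mul, mul_assoc]
  exact hasSum_sum fun σ _ => (h σ).hasSum.mul_left _

theorem eval_skewSymm (f : MvPolynomial (Fin n) ℂ) (x : Fin n → ℂ) :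
    MvPolynomial.eval x (skewSymm f) = ∑ σ : Equiv.Perm (Fin n),
      ((Equiv.Perm.sign σ : ℤˣ) : ℂ) * MvPolynomial.eval (x ∘ σ) f := by
  simp [skewSymm, MvPolynomial.eval_rename]

theorem getD_replicate_append {i : ℕ} (hi : i ≤ n) (x y : Letter) (j : Fin n) :
    (List.replicate (n - i) x ++ List.replicate i y).getD j a =
      if (j : ℕ) + i < n then x else y := by
  split_ifs with h
  · rw [List.getD_append _ _ _ _ (by simp; omega), List.getD_replicate _ (by omega)]
  · rw [List.getD_append_right _ _ _ _ (by simp; omega), List.length_replicate,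
      List.getD_replicate _ (by omega)]

theorem eval_matsuoSeed (t a₁ b₂ : ℂ) {i : ℕ} (hi : i ≤ n) (x : Fin n → ℂ) :
    MvPolynomial.eval x (matsuoSeed n t a₁ b₂ i) =
      wordPoly n t⁻¹ a₁ b₂ (List.replicate (n - i) b ++ List.replicate i a) x := by
  unfold matsuoSeed wordPoly
  rw [map_mul, map_prod, map_prod]
  congr 1
  · refine Finset.prod_congr rfl fun j _ => ?_
    rw [getD_replicate_append hi]
    split_ifs <;> simp [Letter.eval]
  · simp

theorem wordPoly_replicate_zb_za (s a₁ b₂ : ℂ) {i : ℕ} (hi : i ≤ n) (x : Fin n → ℂ) :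
    wordPoly n s a₁ b₂ (List.replicate (n - i) zb ++ List.replicate i za) x =
      (∏ j, x j) * wordPoly n s a₁ b₂ (List.replicate (n - i) b ++ List.replicate i a) x := by
  unfold wordPoly
  rw [← mul_assoc, ← Finset.prod_mul_distrib]
  congr 1
  refine Finset.prod_congr rfl fun j _ => ?_
  rw [getD_replicate_append hi, getD_replicate_append hi]
  split_ifs <;> rfl

theorem selbergIntegrand_matsuoPoly {m : ℕ} (logq τ β t a₁ b₂ : ℂ) (a b : Fin m → ℂ) (i : ℕ)
    (u : Fin n → ℂ) :
    selbergIntegrand logq τ β a b (matsuoPoly n t a₁ b₂ i) u =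
      (∑ σ : Equiv.Perm (Fin n), ((Equiv.Perm.sign σ : ℤˣ) : ℂ) *
        MvPolynomial.eval ((fun i => Complex.exp (u i)) ∘ σ) (matsuoSeed n t a₁ b₂ i)) *
      selbergPhi logq τ β a b u := by
  rw [← eval_skewSymm, ← deltaPoly_mul_matsuoPoly, map_mul, selbergIntegrand]
  ring

theorem selbergPhi_add_one {m : ℕ} (logq τ α : ℂ) (a b : Fin m → ℂ) (u : Fin n → ℂ) :
    selbergPhi logq τ (α + 1) a b u = (∏ i, Complex.exp (u i)) * selbergPhi logq τ α a b u := by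
  simp only [selbergPhi]
  rw [← mul_assoc, ← Finset.prod_mul_distrib]
  congr 1
  refine Finset.prod_congr rfl fun i _ => ?_
  rw [add_mul, Complex.exp_add, one_mul]
  ring

variable {logq τ α a₁ a₂ b₁ b₂ : ℂ} {u : Fin n → ℂ}

/-- Both kinds of Jackson integrals are values of one word functional: the shift `α → α + 1`
multiplies `Φ` by `z_1 ⋯ z_n`, which turns the letters `a`, `b` into `za`, `zb`. -/
theorem hasSum_selbergIntegrand (hq : ‖Complex.exp logq‖ < 1)
    (ha₁ : a₁ ≠ 0) (ha₂ : a₂ ≠ 0) (hb₁ : b₁ ≠ 0) (hb₂ : b₂ ≠ 0)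
    (hpoles : LatticeAvoidsPoles (Complex.exp logq) (Complex.exp (τ * logq)) ![b₁, b₂]
      fun i => Complex.exp (u i))
    (hconv : ConvergenceCondition n logq τ α a₁ a₂ b₁ b₂)
    (hconv' : ConvergenceCondition n logq τ (α + 1) a₁ a₂ b₁ b₂) {i : ℕ} (hi : i ≤ n) :
    HasSum (fun ν => selbergIntegrand logq τ α ![a₁, a₂] ![b₁, b₂]
        (matsuoPoly n (Complex.exp (τ * logq)) a₁ b₂ i) (latticePoint logq u ν))
      (wordSum logq τ α a₁ a₂ b₁ b₂ u (List.replicate (n - i) b ++ List.replicate i a)) ∧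
    HasSum (fun ν => selbergIntegrand logq τ (α + 1) ![a₁, a₂] ![b₁, b₂]
        (matsuoPoly n (Complex.exp (τ * logq)) a₁ b₂ i) (latticePoint logq u ν))
      (wordSum logq τ α a₁ a₂ b₁ b₂ u (List.replicate (n - i) zb ++ List.replicate i za)) := by
  have hS := fun l => (skewSummable_wordPoly hq ha₁ ha₂ hb₁ hb₂ hpoles hconv hconv'
    (Complex.exp (τ * logq))⁻¹ l).hasSum
  refine ⟨(hS _).congr_fun fun ν => ?_, (hS _).congr_fun fun ν => ?_⟩
  · simp only [selbergIntegrand_matsuoPoly, eval_matsuoSeed _ _ _ hi]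
  · simp only [selbergIntegrand_matsuoPoly, eval_matsuoSeed _ _ _ hi,
      wordPoly_replicate_zb_za _ _ _ hi, selbergPhi_add_one, Function.comp_apply]
    simp only [Equiv.prod_comp _ fun j => Complex.exp (latticePoint logq u ν j), Finset.sum_mul]
    exact Finset.sum_congr rfl fun σ _ => by ring

/-- The denominators of `D_A` and `D'_A` that contain `a₁ a₂ b₁ b₂` need no separate hypothesis:
they do not vanish by the convergence conditions. -/
theorem admissible_of_convergenceCondition (ha₁ : a₁ ≠ 0) (ha₂ : a₂ ≠ 0) (hb₁ : b₁ ≠ 0)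
    (hb₂ : b₂ ≠ 0)
    (hconv : ConvergenceCondition n logq τ α a₁ a₂ b₁ b₂)
    (hconv' : ConvergenceCondition n logq τ (α + 1) a₁ a₂ b₁ b₂)
    (htk : ∀ k : ℕ, 1 ≤ k → k ≤ n → Complex.exp (τ * logq) ^ k ≠ 1)
    (hden : ∀ k : ℕ, k + 2 ≤ 2 * n →
      Complex.exp (α * logq) * a₂ * b₂ * Complex.exp (τ * logq) ^ k ≠ 1)
    (hden' : ∀ k : ℕ, k + 2 ≤ 2 * n →
      Complex.exp (α * logq) * a₁ * b₁ * Complex.exp (τ * logq) ^ k ≠ 1) :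
    Admissible n (Complex.exp (τ * logq)) (Complex.exp (α * logq)) a₁ a₂ b₁ b₂ where
  t_ne := Complex.exp_ne_zero _
  Q_ne := Complex.exp_ne_zero _
  a₁_ne := ha₁
  a₂_ne := ha₂
  b₁_ne := hb₁
  b₂_ne := hb₂
  t_pow := htk
  den₂ := hden
  den₁ := hden'
  den k _ hk h := by
    -- `|Q t^k|` lies between `|Q|` and `|Q t^(2n-2)|`, hence above `|a₁ a₂ b₁ b₂|⁻¹`
    have ht0 := Complex.exp_ne_zero (τ * logq)
    have hQ0 := Complex.exp_ne_zero (α * logq)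
    obtain ⟨h1, h2⟩ := hconv.mem_Ioo logq hconv'
    have h3 := (mul_pow_mem_Ioo (d := k) (norm_pos_iff.2 ht0) (norm_pos_iff.2 hQ0) (by omega)
      h1 h2).1
    have hB : 0 < ‖a₁ * a₂ * b₁ * b₂‖ :=
      norm_pos_iff.2 (mul_ne_zero (mul_ne_zero (mul_ne_zero ha₁ ha₂) hb₁) hb₂)
    rw [inv_lt_iff_one_lt_mul₀ hB, ← norm_pow, ← norm_mul, ← norm_mul] at h3
    rw [← norm_one (α := ℂ), ← h] at h3
    exact absurd h3 (by rw [not_lt]; exact le_of_eq (congrArg norm (by ring)))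

end AlphaShift

theorem theorem1p4
    (n : ℕ)
    -- `q` with a logarithm; `t = q ^ τ` and `Q = q ^ α`
    (q logq τ α t Q : ℂ) (hq : Complex.exp logq = q) (hq1 : ‖q‖ < 1)
    (ht : t = Complex.exp (τ * logq)) (hQ : Q = Complex.exp (α * logq))
    (a₁ a₂ b₁ b₂ : ℂ) (ha₁ : a₁ ≠ 0) (ha₂ : a₂ ≠ 0) (hb₁ : b₁ ≠ 0) (hb₂ : b₂ ≠ 0)
    -- the point `ξ`, with logarithms of its coordinates
    (ξ logξ : Fin n → ℂ) (hξ : ∀ i, Complex.exp (logξ i) = ξ i)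
    (hpoles : LatticeAvoidsPoles q t ![b₁, b₂] ξ)
    -- the convergence conditions for the Jackson integrals at `α` and at `α + 1`
    (hconv : ConvergenceCondition n logq τ α a₁ a₂ b₁ b₂)
    (hconv' : ConvergenceCondition n logq τ (α + 1) a₁ a₂ b₁ b₂)
    -- the denominators in the entries of the matrices do not vanish
    (htk : ∀ k : ℕ, 1 ≤ k → k ≤ n → t ^ k ≠ 1)
    (hden : ∀ k : ℕ, k + 2 ≤ 2 * n → Q * a₂ * b₂ * t ^ k ≠ 1)
    (hden' : ∀ k : ℕ, k + 2 ≤ 2 * n → Q * a₁ * b₁ * t ^ k ≠ 1) :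
    -- `F β i` is the integrand, and `I β i` the value, of `⟨e_i(a₁, b₂), ξ⟩` at `α = β`
    let F : ℂ → Fin (n + 1) → (Fin n → ℂ) → ℂ := fun β i =>
      selbergIntegrand logq τ β ![a₁, a₂] ![b₁, b₂] (matsuoPoly n t a₁ b₂ i)
    let I : ℂ → Fin (n + 1) → ℂ := fun β i => jacksonIntegral logq logξ (F β i)
    (∀ i, JacksonConverges logq logξ (F α i) ∧ JacksonConverges logq logξ (F (α + 1) i)) ∧
      ∃ A : Matrix (Fin (n + 1)) (Fin (n + 1)) ℂ,
        I (α + 1) = Matrix.vecMul (I α) A ∧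
          A = matLA n Q t a₂ b₂ * matDA n Q t a₁ a₂ b₁ b₂ * matUA n Q t a₁ a₂ b₁ b₂ ∧
          A = matUA' n Q t a₁ b₁ * matDA' n Q t a₁ a₂ b₁ b₂ *
            matLA' n Q t a₁ a₂ b₁ b₂ := by
  intro F I
  subst hq ht hQ
  obtain rfl : (fun i => Complex.exp (logξ i)) = ξ := funext hξ
  have hadm := admissible_of_convergenceCondition ha₁ ha₂ hb₁ hb₂ hconv hconv' htk hden hden'
  have hΛ := isWordFunctional_wordSum hq1 ha₁ ha₂ hb₁ hb₂ hpoles hconv hconv'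
  have hF := fun i : Fin (n + 1) =>
    hasSum_selbergIntegrand hq1 ha₁ ha₂ hb₁ hb₂ hpoles hconv hconv' (Nat.le_of_lt_succ i.is_lt)
  refine ⟨fun i => ⟨(hF i).1.summable, (hF i).2.summable⟩, _, ?_, rfl, gauss_eq_gauss' hadm⟩
  funext j
  simp only [I, F, jacksonIntegral, Matrix.vecMul, dotProduct]
  rw [(hF j).2.tsum_eq, hΛ.gauss hadm j, Finset.mul_sum]
  refine Finset.sum_congr rfl fun i _ => ?_
  rw [(hF i).1.tsum_eq]
  exact (mul_assoc _ _ _).symm
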